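/- Let $p\ge 1$, let $\Sigma=(\sigma_{jk})\in\mathbb C^{p\times p}$ be Hermitian positive semidefinite, and let $a_j,\nu_j>0$ $(1\le j\le p)$. Put $c_j=c(1,\nu_j,a_j)>0$ with $c(1,\nu,a)^2=a^{2\nu}\Gamma(\nu+\tfrac12)/(\pi^{1/2}\Gamma(\nu))$. Let $B=(B_1,\dots,B_p)$ be a zero-mean, square-integrable, Hermitian ($B(-A)=\overline{B(A)}$ a.s.) $\mathbb C^p$-valued random measure on the Borel sets of $\mathbb R$ of finite length, with orthogonal increments, $\mathbb E[B_j(A)\overline{B_k(A')}]=\int_{A\cap A'}(\Re\sigma_{jk}+i\,\mathrm{sign}(x)\,\Im\sigma_{jk})\,dx$, and let $Y$ be the $\mathbb R^p$-valued process (multivariate Matérn process) with components $Y_j(s)=\int_{\mathbb R}e^{isx}c_j(a_j+ix)^{-\nu_j-1/2}B_j(dx)$. Fix $j,k$ and let $$g_{jk}(x)=c_jc_k(a_j+ix)^{-\nu_j-\frac12}(a_k-ix)^{-\nu_k-\frac12},$$ $$C^{\Re}_{jk}(h)=\int_{\mathbb R}e^{ihx}g_{jk}(x)\,dx,\qquad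 C^{\Im}_{jk}(h)=i\int_{\mathbb R}e^{ihx}g_{jk}(x)\,\mathrm{sign}(x)\,dx ,$$ where powers are principal and $\mathrm{sign}(0)=0$. **Theorem 3.2.** The cross-covariance $C_{jk}(h)=\mathrm{Cov}(Y_j(t+h),Y_k(t))$ equals, for all $t,h\in\mathbb R$, $$c_jc_k\int_{\mathbb R}e^{ihx}(a_j+ix)^{-\nu_j-\frac12}(\Re\sigma_{jk}+i\,\mathrm{sign}(x)\,\Im\sigma_{jk})(a_k-ix)^{-\nu_k-\frac12}dx=\Re(\sigma_{jk})\,C^{\Re}_{jk}(h)+\Im(\sigma_{jk})\,C^{\Im}_{jk}(h),$$ $C^{\Re}_{jk}$ and $C^{\Im}_{jk}$ are real-valued, and for every $h\in\mathbb R$ $$C^{\Im}_{jk}(h)=-\mathcal H[C^{\Re}_{jk}](h),\qquad \mathcal H[C](h)=\frac1\pi\,\mathrm{p.v.}\!\int_{-\infty}^{\infty}\frac{C(u)}{h-u}\,du,$$ the principal value being convergent. Suppose moreover that $\Re(\sigma_{jk})=0$. For $z>0$ and real $\nu$ with $2\nu\notin\mathbb Z$ let $$I_\nu(z)=\sum_{m\ge0}\frac{(z/2)^{\nu+2m}}{\Gamma(m+1)\Gamma(\nu+m+1)},\qquad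 L_\nu(z)=\sum_{m\ge0}\frac{(z/2)^{2m+\nu+1}}{\Gamma(m+\frac32)\Gamma(m+\nu+\frac32)},$$ $E_1(x)=\int_1^\infty e^{-tx}t^{-1}dt$ for $x>0$, $\mathrm{Ei}(x)=-\int_{-x}^\infty e^{-t}t^{-1}dt$ for $x\ne0$ (a principal value if $x>0$), and for $h\ne0$ and $\alpha,\beta>0$ $$R(h,\alpha,\beta)=\frac{-\mathrm{sign}(h)}{\pi}\left(e^{\alpha|h|}E_1(\alpha|h|)+e^{-\beta|h|}\mathrm{Ei}(\beta|h|)\right).$$ 1. If $\nu_j=\nu_k=\nu$ with $\nu\ne m/2$ for all $m\in\mathbb N$, and $a_j=a_k=a$, then for $h\ne0$ $$C_{jk}(h)=\Im(\sigma_{jk})\frac{\pi\,\mathrm{sign}(h)}{2\cos(\pi\nu)}\frac{2^{1-\nu}}{\Gamma(\nu)}(a|h|)^\nu\left(L_{-\nu}(a|h|)-I_\nu(a|h|)\right),$$ and $C_{jk}(0)=0$. 2. If $\nu_j=\nu_k=\tfrac12$, then with $a_+=(a_j+a_k)/2$, for $h\ne0$, $$C_{jk}(h)=\Im(\sigma_{jk})\frac{(a_ja_k)^{1/2}}{a_+}\left(\mathbb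 I(h\le0)R(h,a_j,a_k)+\mathbb I(h>0)R(h,a_k,a_j)\right),$$ and $C_{jk}(0)=\Im(\sigma_{jk})\frac{(a_ja_k)^{1/2}}{a_+}\cdot\frac1\pi\log\frac{a_k}{a_j}$ (the limit of this expression as $h\to0$). In particular, if $a_j=a_k=a$, then $C_{jk}(h)=\Im(\sigma_{jk})R(h,a,a)$ for $h\ne0$. 3. If $\nu_j=\nu_k=\tfrac32$ and $a_j=a_k=a$, then for $h\ne0$ $$C_{jk}(h)=\Im(\sigma_{jk})\left((a|h|+1)R(h,a,a)-\frac{2ahe^{a|h|}}{\pi}\mathrm{Ei}(-a|h|)\right),$$ and $C_{jk}(0)=0$. -/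

import Mathlib

open MeasureTheory ProbabilityTheory Filter Topology
open scoped ComplexOrder

noncomputable section

namespace MultivariateMatern

/-! ### Principal values, the Hilbert transform, and special functions -/

/-- The Cauchy principal value of the integral of `f` over `s`, with a symmetric interval around the
(only) singular point `c` cut out, exists and equals `l`. Away from `c` the integrals are required to
converge absolutely. -/
def HasPVIntegral (f : ℝ → ℝ) (s : Set ℝ) (c l : ℝ) : Prop :=
  (∀ ε : ℝ, 0 < ε → IntegrableOn f {u | u ∈ s ∧ ε < |u - c|}) ∧
    Tendsto (fun ε : ℝ => ∫ u in {u | u ∈ s ∧ ε < |u - c|}, f u) (𝓝[>] 0) (𝓝 l)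

/-- The principal value integral of `f` over `s` with singular point `c`
(only meaningful if `HasPVIntegral f s c l` for some `l`, which is then its value). -/
def pvIntegral (f : ℝ → ℝ) (s : Set ℝ) (c : ℝ) : ℝ :=
  limUnder (𝓝[>] (0 : ℝ)) fun ε : ℝ => ∫ u in {u | u ∈ s ∧ ε < |u - c|}, f u

/-- The integral defining the Hilbert transform of `C` at `h` converges (as a principal value). -/
def HilbertConverges (C : ℝ → ℝ) (h : ℝ) : Prop :=
  ∃ l : ℝ, HasPVIntegral (fun u => C u / (h - u)) Set.univ h l

/-- The Hilbert transform `H[C](h) = (1/π) p.v. ∫ C(u) / (h - u) du`. -/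
def hilbertTransform (C : ℝ → ℝ) (h : ℝ) : ℝ :=
  1 / Real.pi * pvIntegral (fun u => C u / (h - u)) Set.univ h

/-- The modified Bessel function of the first kind, `I_ν(z)`, for real `z > 0`. -/
def besselI (ν z : ℝ) : ℝ :=
  ∑' m : ℕ, (z / 2) ^ (ν + 2 * m) / (Real.Gamma (m + 1) * Real.Gamma (ν + m + 1))

/-- The modified Struve function of the first kind, `L_ν(z)`, for real `z > 0`. -/
def struveL (ν z : ℝ) : ℝ :=
  ∑' m : ℕ, (z / 2) ^ (2 * m + ν + 1) / (Real.Gamma (m + 3 / 2) * Real.Gamma (m + ν + 3 / 2))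

/-- The exponential integral `E₁(x) = ∫_1^∞ e^{-tx} / t dt`, for `x > 0`. -/
def expE1 (x : ℝ) : ℝ := ∫ t in Set.Ioi (1 : ℝ), Real.exp (-t * x) / t

/-- The exponential integral `Ei(x) = - p.v. ∫_{-x}^∞ e^{-t} / t dt`, for `x ≠ 0`
(for `x < 0` the principal value is an ordinary integral). -/
def expEi (x : ℝ) : ℝ := -pvIntegral (fun t => Real.exp (-t) / t) (Set.Ioi (-x)) 0

/-- The function `R(h, a, b)`, for `h ≠ 0`. -/
def expR (h a b : ℝ) : ℝ :=
  -Real.sign h / Real.pi *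
    (Real.exp (a * |h|) * expE1 (a * |h|) + Real.exp (-b * |h|) * expEi (b * |h|))

/-! ### The spectral quantities of the one-dimensional multivariate Matérn model -/

/-- The normalizing constant `c(1, ν, a) > 0`, with
`c(1, ν, a)² = a^{2ν} Γ(ν + 1/2) / (π^{1/2} Γ(ν))`. -/
def normConst (ν a : ℝ) : ℝ :=
  Real.sqrt (a ^ (2 * ν) * Real.Gamma (ν + 1 / 2) / (Real.pi ^ (1 / 2 : ℝ) * Real.Gamma ν))

/-- The (`j`-th diagonal) factor `c (a + i x)^{-ν - 1/2}`, with the principal branch of the power. -/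
def factor (ν a x : ℝ) : ℂ :=
  (normConst ν a : ℂ) * ((a : ℂ) + Complex.I * x) ^ (-(ν : ℂ) - 1 / 2)

/-- `g_jk(x) = c_j c_k (a_j + i x)^{-ν_j - 1/2} (a_k - i x)^{-ν_k - 1/2}`. -/
def gFun (νj aj νk ak x : ℝ) : ℂ :=
  (normConst νj aj : ℂ) * normConst νk ak * ((aj : ℂ) + Complex.I * x) ^ (-(νj : ℂ) - 1 / 2) *
    ((ak : ℂ) - Complex.I * x) ^ (-(νk : ℂ) - 1 / 2)

/-- The entry `Re σ + i sign(x) Im σ` of the density of the directional measure. -/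
def dirDensity (σ : ℂ) (x : ℝ) : ℂ := (σ.re : ℂ) + (Real.sign x : ℂ) * Complex.I * σ.im

/-- The cross-covariance function `C_jk` in spectral form. -/
def crossCov (σ : ℂ) (νj aj νk ak h : ℝ) : ℂ :=
  (normConst νj aj : ℂ) * normConst νk ak *
    ∫ x : ℝ, Complex.exp (Complex.I * h * x) * ((aj : ℂ) + Complex.I * x) ^ (-(νj : ℂ) - 1 / 2) *
      dirDensity σ x * ((ak : ℂ) - Complex.I * x) ^ (-(νk : ℂ) - 1 / 2)

/-- The part `C_jk^Re` of the cross-covariance that belongs to `Re σ_jk`. -/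
def crossRe (νj aj νk ak h : ℝ) : ℂ :=
  ∫ x : ℝ, Complex.exp (Complex.I * h * x) * gFun νj aj νk ak x

/-- The part `C_jk^Im` of the cross-covariance that belongs to `Im σ_jk`. -/
def crossIm (νj aj νk ak h : ℝ) : ℂ :=
  Complex.I * ∫ x : ℝ, Complex.exp (Complex.I * h * x) * gFun νj aj νk ak x * (Real.sign x : ℂ)

/-! ### The process: stochastic integrals with respect to a random measure -/

variable {Ω : Type*} [MeasurableSpace Ω] {p : ℕ}

/-- `B = (B_1, …, B_p)` is a zero-mean square-integrable `ℂ^p`-valued random measure on the Borel sets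
of `ℝ` of finite length, it is Hermitian, and it has orthogonal increments with control measure
`(Re S + i sign(x) Im S) dx`. -/
structure IsRandomMeasure (S : Matrix (Fin p) (Fin p) ℂ) (P : Measure Ω)
    (B : Fin p → Set ℝ → Ω → ℂ) : Prop where
  /-- square integrability -/
  memLp : ∀ j A, MeasurableSet A → volume A < ⊤ → MemLp (B j A) 2 P
  /-- zero mean -/
  mean_zero : ∀ j A, MeasurableSet A → volume A < ⊤ → ∫ ω, B j A ω ∂P = 0
  /-- σ-additivity, in mean square -/
  additive : ∀ (j : Fin p) (A : ℕ → Set ℝ), (∀ n, MeasurableSet (A n)) →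
    Pairwise (Function.onFun Disjoint A) → volume (⋃ n, A n) < ⊤ →
    Tendsto (fun N : ℕ =>
      eLpNorm (fun ω => ∑ n ∈ Finset.range N, B j (A n) ω - B j (⋃ n, A n) ω) 2 P) atTop (𝓝 0)
  /-- the Hermitian property `B(-A) = conj B(A)` almost surely -/
  hermitian : ∀ j A, MeasurableSet A → volume A < ⊤ →
    ∀ᵐ ω ∂P, B j (Neg.neg ⁻¹' A) ω = starRingEnd ℂ (B j A ω)
  /-- orthogonal increments with the given control measure -/
  orthogonal : ∀ j k A A', MeasurableSet A → volume A < ⊤ → MeasurableSet A' → volume A' < ⊤ →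
    ∫ ω, B j A ω * starRingEnd ℂ (B k A' ω) ∂P = ∫ x in A ∩ A', dirDensity (S j k) x

/-- The stochastic integral `∑_y y b({F = y})` of a simple function (the value `y = 0`, whose level
set may have infinite length, does not contribute). -/
def simpleStochInt (b : Set ℝ → Ω → ℂ) (F : SimpleFunc ℝ ℂ) (ω : Ω) : ℂ :=
  ∑ y ∈ F.range, y * b (F ⁻¹' {y}) ω

/-- The random variable `ξ` is the stochastic integral `∫ f(x) b(dx)`: it is the mean-square limit of
the integrals of simple functions that approximate `f` in `L²(ℝ)`. -/
def IsStochInt (P : Measure Ω) (b : Set ℝ → Ω → ℂ) (f : ℝ → ℂ) (ξ : Ω → ℂ) : Prop :=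
  MemLp f 2 volume ∧ MemLp ξ 2 P ∧
    ∃ F : ℕ → SimpleFunc ℝ ℂ, (∀ n, MemLp (F n) 2 volume) ∧
      Tendsto (fun n => eLpNorm (fun x => F n x - f x) 2 volume) atTop (𝓝 0) ∧
      Tendsto (fun n => eLpNorm (fun ω => simpleStochInt b (F n) ω - ξ ω) 2 P) atTop (𝓝 0)

/-- The real `ℝ^p`-valued process `Y` is the multivariate Matérn process
`Y(s) = ∫ e^{isx} diag(c_j (a_j + i x)^{-ν_j - 1/2}) B(dx)` (written in components), for a Hermitian
random measure `B` with control measure `(Re S + i sign(x) Im S) dx`. -/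
def IsMaternProcess (S : Matrix (Fin p) (Fin p) ℂ) (ν a : Fin p → ℝ) (P : Measure Ω)
    (Y : ℝ → Fin p → Ω → ℝ) : Prop :=
  ∃ B : Fin p → Set ℝ → Ω → ℂ, IsRandomMeasure S P B ∧
    ∀ (s : ℝ) (j : Fin p),
      IsStochInt P (B j) (fun x => Complex.exp (Complex.I * s * x) * factor (ν j) (a j) x)
        (fun ω => (Y s j ω : ℂ))

end MultivariateMatern

end

open MultivariateMatern

open MultivariateMatern

namespace MultivariateMatern

/-- The power `(a + i x)^{-ν - 1/2}`. -/
noncomputable def specPow (ν a x : ℝ) : ℂ := ((a : ℂ) + Complex.I * x) ^ (-(ν : ℂ) - 1 / 2)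

lemma add_I_mul_mem_slitPlane {a : ℝ} (ha : 0 < a) (x : ℝ) :
    (a : ℂ) + Complex.I * x ∈ Complex.slitPlane := by
  left; simpa using ha

lemma conj_specPow {a : ℝ} (ha : 0 < a) (ν x : ℝ) :
    starRingEnd ℂ (specPow ν a x) = specPow ν a (-x) := by
  unfold specPow
  have h := Complex.conj_cpow ((a : ℂ) + Complex.I * x) (-(ν : ℂ) - 1 / 2)
    (Complex.slitPlane_arg_ne_pi (add_I_mul_mem_slitPlane ha x))
  have e : starRingEnd ℂ (-(ν : ℂ) - 1 / 2) = -(ν : ℂ) - 1 / 2 := by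
    simp only [map_sub, map_neg, map_div₀, map_one, map_ofNat, Complex.conj_ofReal]
  rw [e] at h
  rw [← h]
  simp [Complex.conj_ofReal]

lemma norm_add_I_mul (a x : ℝ) : ‖(a : ℂ) + Complex.I * x‖ = (a ^ 2 + x ^ 2) ^ (1 / 2 : ℝ) := by
  rw [← Real.sqrt_eq_rpow, mul_comm, Complex.norm_add_mul_I]

lemma norm_specPow (ν a x : ℝ) :
    ‖specPow ν a x‖ = (a ^ 2 + x ^ 2) ^ (-(ν + 1 / 2) / 2) := by
  unfold specPow
  have : (-(ν : ℂ) - 1 / 2) = ((-ν - 1 / 2 : ℝ) : ℂ) := by push_cast; ring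
  rw [this, Complex.norm_cpow_real, norm_add_I_mul, ← Real.rpow_mul (by positivity)]
  congr 1; ring

lemma norm_specPow_le {ν a : ℝ} (ha : 0 < a) (hν : 0 < ν) :
    ∃ K : ℝ, 0 < K ∧ ∀ x, ‖specPow ν a x‖ ≤ K * (1 + x ^ 2) ^ (-(ν + 1 / 2) / 2) := by
  set m := min 1 (a ^ 2)
  have hm : 0 < m := by positivity
  refine ⟨m ^ (-(ν + 1 / 2) / 2), by positivity, fun x => ?_⟩
  rw [norm_specPow, ← Real.mul_rpow hm.le (by positivity)]
  apply Real.rpow_le_rpow_of_nonpos (by positivity) _ (by linarith)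
  have h1 : m ≤ 1 := min_le_left _ _
  have h2 : m ≤ a ^ 2 := min_le_right _ _
  nlinarith [sq_nonneg x]

lemma hasDerivAt_specPow {a : ℝ} (ha : 0 < a) (ν x : ℝ) :
    HasDerivAt (specPow ν a) (-Complex.I * (ν + 1 / 2) * specPow (ν + 1) a x) x := by
  have h1 : HasDerivAt (fun x : ℂ => (a : ℂ) + Complex.I * x) Complex.I x := by
    simpa using ((hasDerivAt_id (x : ℂ)).const_mul Complex.I).const_add (a : ℂ)
  have h2 := (h1.cpow_const (c := -(ν : ℂ) - 1 / 2) (add_I_mul_mem_slitPlane ha x)).comp_ofReal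
  unfold specPow
  convert! h2 using 1
  rw [show (-((ν + 1 : ℝ) : ℂ) - 1 / 2) = -(ν : ℂ) - 1 / 2 - 1 by push_cast; ring]
  ring

lemma continuous_specPow {a : ℝ} (ha : 0 < a) (ν : ℝ) : Continuous (specPow ν a) :=
  continuous_iff_continuousAt.2 fun x => (hasDerivAt_specPow ha ν x).continuousAt

lemma integrable_specPow_mul {νj νk aj ak : ℝ} (hνj : 0 < νj) (hνk : 0 < νk) (haj : 0 < aj)
    (hak : 0 < ak) : Integrable fun x : ℝ => specPow νj aj x * specPow νk ak (-x) := by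
  obtain ⟨K, hK, hj⟩ := norm_specPow_le haj hνj
  obtain ⟨K', hK', hk⟩ := norm_specPow_le hak hνk
  have h := integrable_rpow_neg_one_add_norm_sq (E := ℝ) (μ := volume) (r := νj + νk + 1)
    (by simp; linarith)
  refine (h.const_mul (K * K')).mono' ?_ (Eventually.of_forall fun x => ?_)
  · exact ((continuous_specPow haj νj).mul
      ((continuous_specPow hak νk).comp continuous_neg)).aestronglyMeasurable
  · rw [norm_mul]
    refine (mul_le_mul (hj x) (hk (-x)) (norm_nonneg _) (by positivity)).trans (le_of_eq ?_)
    rw [neg_sq, Real.norm_eq_abs, sq_abs, show -(νj + νk + 1) / 2 =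
      -(νj + 1 / 2) / 2 + -(νk + 1 / 2) / 2 by ring, Real.rpow_add (by positivity)]
    ring

section
variable {νj aj νk ak : ℝ}

lemma gFun_eq (νj aj νk ak x : ℝ) : gFun νj aj νk ak x =
    (normConst νj aj : ℂ) * normConst νk ak * (specPow νj aj x * specPow νk ak (-x)) := by
  simp only [gFun, specPow, Complex.ofReal_neg, mul_neg, ← sub_eq_add_neg]
  ring

lemma conj_gFun (haj : 0 < aj) (hak : 0 < ak) (x : ℝ) :
    starRingEnd ℂ (gFun νj aj νk ak x) = gFun νj aj νk ak (-x) := by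
  simp [gFun_eq, conj_specPow haj, conj_specPow hak, Complex.conj_ofReal]

lemma integrable_gFun (hνj : 0 < νj) (hνk : 0 < νk) (haj : 0 < aj) (hak : 0 < ak) :
    Integrable (gFun νj aj νk ak) := by
  rw [show gFun νj aj νk ak = _ from funext (gFun_eq νj aj νk ak)]
  exact (integrable_specPow_mul hνj hνk haj hak).const_mul _

lemma exists_hasDerivAt_gFun (hνj : 0 < νj) (hνk : 0 < νk) (haj : 0 < aj) (hak : 0 < ak) :
    ∃ g' : ℝ → ℂ, Integrable g' ∧ ∀ x, HasDerivAt (gFun νj aj νk ak) (g' x) x := by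
  refine ⟨fun x => (normConst νj aj : ℂ) * normConst νk ak *
    ((-Complex.I * (νj + 1 / 2)) * (specPow (νj + 1) aj x * specPow νk ak (-x)) +
      (Complex.I * (νk + 1 / 2)) * (specPow νj aj x * specPow (νk + 1) ak (-x))), ?_, fun x => ?_⟩
  · exact (((integrable_specPow_mul (by linarith) hνk haj hak).const_mul _).add
      ((integrable_specPow_mul hνj (by linarith) haj hak).const_mul _)).const_mul _
  · rw [show gFun νj aj νk ak = _ from funext (gFun_eq νj aj νk ak)]
    have h2 := (hasDerivAt_specPow hak νk (-x)).scomp x (hasDerivAt_neg x)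
    have h := ((hasDerivAt_specPow haj νj x).mul h2).const_mul
      ((normConst νj aj : ℂ) * normConst νk ak)
    refine h.congr_deriv ?_
    simp only [Function.comp_apply, neg_smul, one_smul]
    ring

lemma norm_cexp_I_mul (h x : ℝ) : ‖Complex.exp (Complex.I * h * x)‖ = 1 := by
  rw [show Complex.I * h * x = ((h * x : ℝ) : ℂ) * Complex.I by push_cast; ring,
    Complex.norm_exp_ofReal_mul_I]

lemma integrable_exp_mul {g : ℝ → ℂ} (hg : Integrable g) (h : ℝ) :
    Integrable fun x : ℝ => Complex.exp (Complex.I * h * x) * g x := by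
  refine hg.bdd_mul (c := 1) (Continuous.aestronglyMeasurable (by fun_prop)) ?_
  exact Eventually.of_forall fun x => (norm_cexp_I_mul h x).le

lemma measurable_sign : Measurable Real.sign := by
  unfold Real.sign
  exact Measurable.ite measurableSet_Iio measurable_const
    (Measurable.ite measurableSet_Ioi measurable_const measurable_const)

lemma abs_sign_le (x : ℝ) : |Real.sign x| ≤ 1 := by
  rcases Real.sign_apply_eq x with h | h | h <;> simp [h]

lemma integrable_mul_sign {g : ℝ → ℂ} (hg : Integrable g) :
    Integrable fun x : ℝ => g x * (Real.sign x : ℂ) := by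
  refine hg.mul_bdd (c := 1) ?_ (Eventually.of_forall fun x => ?_)
  · exact (Complex.measurable_ofReal.comp measurable_sign).aestronglyMeasurable
  · simpa using abs_sign_le x

lemma crossCov_eq (σ : ℂ) (hνj : 0 < νj) (hνk : 0 < νk) (haj : 0 < aj) (hak : 0 < ak) (h : ℝ) :
    crossCov σ νj aj νk ak h =
      σ.re * crossRe νj aj νk ak h + σ.im * crossIm νj aj νk ak h := by
  have hg := integrable_exp_mul (integrable_gFun hνj hνk haj hak) h
  unfold crossCov crossRe crossIm
  rw [← integral_const_mul, ← mul_assoc, ← integral_const_mul, ← integral_const_mul,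
    ← integral_add (hg.const_mul _) ((integrable_mul_sign hg).const_mul _)]
  congr 1; ext x
  simp only [gFun, dirDensity]
  ring

lemma im_integral_eq_zero {f : ℝ → ℂ} (hf : ∀ x, starRingEnd ℂ (f x) = f (-x)) :
    (∫ x, f x).im = 0 := by
  rw [← Complex.conj_eq_iff_im, ← integral_conj]
  simp_rw [hf]
  exact integral_neg_eq_self f volume

lemma conj_exp_mul (haj : 0 < aj) (hak : 0 < ak) (h x : ℝ) :
    starRingEnd ℂ (Complex.exp (Complex.I * h * x) * gFun νj aj νk ak x) =
      Complex.exp (Complex.I * h * (-x : ℝ)) * gFun νj aj νk ak (-x) := by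
  rw [map_mul, conj_gFun haj hak, ← Complex.exp_conj]
  simp [Complex.conj_ofReal]

lemma crossRe_im (haj : 0 < aj) (hak : 0 < ak) (h : ℝ) : (crossRe νj aj νk ak h).im = 0 :=
  im_integral_eq_zero fun x => conj_exp_mul haj hak h x

lemma crossIm_im (haj : 0 < aj) (hak : 0 < ak) (h : ℝ) : (crossIm νj aj νk ak h).im = 0 := by
  unfold crossIm
  rw [← integral_const_mul]
  apply im_integral_eq_zero fun x => ?_
  rw [map_mul, map_mul, conj_exp_mul haj hak]
  simp [Complex.conj_ofReal, Real.sign_neg]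

lemma crossIm_zero_of_eq (ν a : ℝ) : crossIm ν a ν a 0 = 0 := by
  unfold crossIm
  have : (∫ x : ℝ, Complex.exp (Complex.I * (0 : ℝ) * x) * gFun ν a ν a x * (Real.sign x : ℂ)) = 0 := by
    have h := integral_neg_eq_self (fun x : ℝ =>
      Complex.exp (Complex.I * (0 : ℝ) * x) * gFun ν a ν a x * (Real.sign x : ℂ)) volume
    have hs : ∀ x : ℝ, gFun ν a ν a (-x) = gFun ν a ν a x := fun x => by
      simp only [gFun_eq, neg_neg]; ring
    simp only [hs, Real.sign_neg, Complex.ofReal_zero, mul_zero, zero_mul, neg_zero, Complex.exp_zero,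
      one_mul, Complex.ofReal_neg, mul_neg, integral_neg] at h ⊢
    linear_combination (-1 / 2 : ℂ) * h
  rw [this, mul_zero]

end

lemma tendsto_integral_mul_conj {α : Type*} [MeasurableSpace α] {μ : Measure α}
    {X Y : ℕ → α → ℂ} {X₀ Y₀ : α → ℂ} (hX : ∀ n, MemLp (X n) 2 μ) (hX₀ : MemLp X₀ 2 μ)
    (hY : ∀ n, MemLp (Y n) 2 μ) (hY₀ : MemLp Y₀ 2 μ)
    (hXt : Tendsto (fun n => eLpNorm (fun ω => X n ω - X₀ ω) 2 μ) atTop (𝓝 0))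
    (hYt : Tendsto (fun n => eLpNorm (fun ω => Y n ω - Y₀ ω) 2 μ) atTop (𝓝 0)) :
    Tendsto (fun n => ∫ ω, X n ω * starRingEnd ℂ (Y n ω) ∂μ) atTop
      (𝓝 (∫ ω, X₀ ω * starRingEnd ℂ (Y₀ ω) ∂μ)) := by
  have key : ∀ {U V : α → ℂ} (hU : MemLp U 2 μ) (hV : MemLp V 2 μ),
      inner ℂ (hV.toLp V) (hU.toLp U) = ∫ ω, U ω * starRingEnd ℂ (V ω) ∂μ := by
    intro U V hU hV
    rw [L2.inner_def]
    refine integral_congr_ae ?_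
    filter_upwards [hU.coeFn_toLp, hV.coeFn_toLp] with ω h1 h2
    rw [h1, h2, RCLike.inner_apply]
  have hXL : Tendsto (fun n => (hX n).toLp (X n)) atTop (𝓝 (hX₀.toLp X₀)) :=
    (Lp.tendsto_Lp_iff_tendsto_eLpNorm'' X hX X₀ hX₀).2 hXt
  have hYL : Tendsto (fun n => (hY n).toLp (Y n)) atTop (𝓝 (hY₀.toLp Y₀)) :=
    (Lp.tendsto_Lp_iff_tendsto_eLpNorm'' Y hY Y₀ hY₀).2 hYt
  have h := hYL.inner (𝕜 := ℂ) hXL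
  simpa only [key] using h

lemma measurable_dirDensity (σ : ℂ) : Measurable (dirDensity σ) := by
  unfold dirDensity
  exact measurable_const.add (((Complex.measurable_ofReal.comp measurable_sign).mul_const _).mul_const _)

lemma norm_dirDensity_le (σ : ℂ) (x : ℝ) : ‖dirDensity σ x‖ ≤ |σ.re| + |σ.im| := by
  unfold dirDensity
  refine (norm_add_le _ _).trans (add_le_add (by simp) ?_)
  simpa using mul_le_of_le_one_left (abs_nonneg _) (abs_sign_le x)

section
variable {Ω : Type*} [MeasurableSpace Ω] {p : ℕ} {P : Measure Ω}
  {S : Matrix (Fin p) (Fin p) ℂ} {B : Fin p → Set ℝ → Ω → ℂ}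

lemma IsRandomMeasure.memLp_term (hB : IsRandomMeasure S P B) (j : Fin p) {F : SimpleFunc ℝ ℂ}
    (hF : MemLp F 2 volume) (y : ℂ) : MemLp (fun ω => y * B j (F ⁻¹' {y}) ω) 2 P := by
  by_cases hy : y = 0
  · simp [hy]
  · exact (hB.memLp j _ (F.measurableSet_fiber y)
      (SimpleFunc.measure_preimage_lt_top_of_memLp (by simp) (by simp) F hF y hy)).const_mul y

lemma IsRandomMeasure.memLp_simpleStochInt (hB : IsRandomMeasure S P B) (j : Fin p)
    {F : SimpleFunc ℝ ℂ} (hF : MemLp F 2 volume) : MemLp (simpleStochInt (B j) F) 2 P := by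
  unfold simpleStochInt
  exact memLp_finsetSum _ fun y _ => hB.memLp_term j hF y

lemma IsRandomMeasure.integral_simpleStochInt [IsFiniteMeasure P] (hB : IsRandomMeasure S P B)
    (j : Fin p) {F : SimpleFunc ℝ ℂ} (hF : MemLp F 2 volume) :
    ∫ ω, simpleStochInt (B j) F ω ∂P = 0 := by
  unfold simpleStochInt
  rw [integral_finsetSum _ fun y _ => (hB.memLp_term j hF y).integrable (by norm_num)]
  refine Finset.sum_eq_zero fun y _ => ?_
  rw [integral_const_mul]
  by_cases hy : y = 0
  · simp [hy]
  · rw [hB.mean_zero j _ (F.measurableSet_fiber y)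
      (SimpleFunc.measure_preimage_lt_top_of_memLp (by simp) (by simp) F hF y hy), mul_zero]

lemma IsRandomMeasure.integral_simpleStochInt_mul_conj (hB : IsRandomMeasure S P B)
    (j k : Fin p) {F G : SimpleFunc ℝ ℂ} (hF : MemLp F 2 volume) (hG : MemLp G 2 volume) :
    ∫ ω, simpleStochInt (B j) F ω * starRingEnd ℂ (simpleStochInt (B k) G ω) ∂P =
      ∫ x, F x * starRingEnd ℂ (G x) *
        dirDensity (S j k) x := by
  have hfin : ∀ {H : SimpleFunc ℝ ℂ}, MemLp H 2 volume → ∀ y, y ≠ 0 → volume (H ⁻¹' {y}) < ⊤ :=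
    fun {H} hH y hy => SimpleFunc.measure_preimage_lt_top_of_memLp (by simp) (by simp) H hH y hy
  have hI : ∀ y z : ℂ, Integrable (fun ω => (y * B j (F ⁻¹' {y}) ω) *
      starRingEnd ℂ (z * B k (G ⁻¹' {z}) ω)) P := fun y z =>
    (hB.memLp_term j hF y).integrable_mul (hB.memLp_term k hG z).star
  have hE : ∀ x, F x * starRingEnd ℂ (G x) * dirDensity (S j k) x =
      ∑ y ∈ F.range, ∑ z ∈ G.range, (F ⁻¹' {y} ∩ G ⁻¹' {z}).indicator
        (fun x => (y * starRingEnd ℂ z) * dirDensity (S j k) x) x := by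
    intro x
    rw [Finset.sum_eq_single (F x), Finset.sum_eq_single (G x)]
    · simp
    · intro z _ hz; simp [Ne.symm hz]
    · intro h; exact absurd (SimpleFunc.mem_range_self G x) h
    · intro y _ hy; simp [Ne.symm hy]
    · intro h; exact absurd (SimpleFunc.mem_range_self F x) h
  have hJ : ∀ y z : ℂ, Integrable ((F ⁻¹' {y} ∩ G ⁻¹' {z}).indicator
      (fun x => (y * starRingEnd ℂ z) * dirDensity (S j k) x)) := by
    intro y z
    rw [integrable_indicator_iff ((F.measurableSet_fiber y).inter (G.measurableSet_fiber z))]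
    by_cases hy : y = 0
    · simp [hy, IntegrableOn]
    refine Integrable.const_mul ?_ _
    exact Measure.integrableOn_of_bounded
      ((measure_mono Set.inter_subset_left).trans_lt (hfin hF y hy)).ne
      (measurable_dirDensity _).aestronglyMeasurable
      (Eventually.of_forall fun x => norm_dirDensity_le _ x)

  simp_rw [hE]
  simp only [simpleStochInt, map_sum, Finset.sum_mul_sum]
  rw [integral_finsetSum _ fun y _ => integrable_finsetSum _ fun z _ => hI y z,
    integral_finsetSum _ fun y _ => integrable_finsetSum _ fun z _ => hJ y z]
  refine Finset.sum_congr rfl fun y _ => ?_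
  rw [integral_finsetSum _ fun z _ => hI y z, integral_finsetSum _ fun z _ => hJ y z]
  refine Finset.sum_congr rfl fun z _ => ?_
  rw [integral_indicator ((F.measurableSet_fiber y).inter (G.measurableSet_fiber z)),
    integral_const_mul]
  by_cases hy : y = 0
  · simp [hy]
  by_cases hz : z = 0
  · simp [hz]
  rw [← hB.orthogonal j k _ _ (F.measurableSet_fiber y) (hfin hF y hy)
    (G.measurableSet_fiber z) (hfin hG z hz), ← integral_const_mul]
  congr 1; ext ω
  simp only [map_mul]; ring

lemma IsStochInt.integral_eq_zero [IsProbabilityMeasure P] (hB : IsRandomMeasure S P B)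
    {j : Fin p} {f : ℝ → ℂ} {ξ : Ω → ℂ} (h : IsStochInt P (B j) f ξ) : ∫ ω, ξ ω ∂P = 0 := by
  obtain ⟨_, hξ, F, hF, _, hFξ⟩ := h
  have h := tendsto_integral_mul_conj (Y := fun _ _ => 1) (Y₀ := fun _ => 1)
    (fun n => hB.memLp_simpleStochInt j (hF n)) hξ (fun _ => memLp_const 1) (memLp_const 1) hFξ
    (by simp)
  simp only [map_one, mul_one, hB.integral_simpleStochInt j (hF _)] at h
  exact tendsto_nhds_unique h tendsto_const_nhds

lemma IsStochInt.integral_mul_conj (hB : IsRandomMeasure S P B) {j k : Fin p} {f g : ℝ → ℂ}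
    {ξ η : Ω → ℂ} (hf : IsStochInt P (B j) f ξ) (hg : IsStochInt P (B k) g η) :
    ∫ ω, ξ ω * starRingEnd ℂ (η ω) ∂P = ∫ x, f x * starRingEnd ℂ (g x) * dirDensity (S j k) x := by
  obtain ⟨hf2, hξ, F, hF, hFf, hFξ⟩ := hf
  obtain ⟨hg2, hη, G, hG, hGg, hGη⟩ := hg
  have h1 := tendsto_integral_mul_conj (fun n => hB.memLp_simpleStochInt j (hF n)) hξ
    (fun n => hB.memLp_simpleStochInt k (hG n)) hη hFξ hGη
  set d := dirDensity (S j k)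
  have hd : ∀ {u : ℝ → ℂ}, MemLp u 2 volume → MemLp (fun x => u x * d x) 2 volume := fun {u} hu =>
    hu.of_le_mul (c := |(S j k).re| + |(S j k).im|)
      (hu.1.mul (measurable_dirDensity _).aestronglyMeasurable)
      (Eventually.of_forall fun x => by
        rw [norm_mul, mul_comm]
        exact mul_le_mul_of_nonneg_right (norm_dirDensity_le _ x) (norm_nonneg _))
  have hFd : Tendsto (fun n => eLpNorm (fun x => F n x * d x - f x * d x) 2 volume)
      atTop (𝓝 0) := by
    have hc := ENNReal.Tendsto.const_mul (a := ENNReal.ofReal (|(S j k).re| + |(S j k).im|)) hFf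
      (Or.inr (by simp))
    rw [mul_zero] at hc
    refine tendsto_of_tendsto_of_tendsto_of_le_of_le tendsto_const_nhds hc (fun _ => zero_le)
      fun n => eLpNorm_le_mul_eLpNorm_of_ae_le_mul (Eventually.of_forall fun x => ?_) 2
    rw [← sub_mul, norm_mul, mul_comm]
    exact mul_le_mul_of_nonneg_right (norm_dirDensity_le _ x) (norm_nonneg _)
  have h2 := tendsto_integral_mul_conj (fun n => hd (hF n)) (hd hf2) hG hg2 hFd hGg
  refine tendsto_nhds_unique h1 ?_
  simp only [hB.integral_simpleStochInt_mul_conj j k (hF _) (hG _)]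
  simpa only [mul_right_comm] using h2

end

theorem covariance_eq_crossCov {Ω : Type*} [MeasurableSpace Ω] {P : Measure Ω}
    [IsProbabilityMeasure P] {p : ℕ} {S : Matrix (Fin p) (Fin p) ℂ} {ν a : Fin p → ℝ}
    (ha : ∀ i, 0 < a i) {Y : ℝ → Fin p → Ω → ℝ}
    (hY : IsMaternProcess S ν a P Y) (j k : Fin p) (t h : ℝ) :
    ((covariance (Y (t + h) j) (Y t k) P : ℝ) : ℂ) =
      crossCov (S j k) (ν j) (a j) (ν k) (a k) h := by
  obtain ⟨B, hB, hI⟩ := hY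
  have hmem : ∀ s i, MemLp (Y s i) 2 P := fun s i => by simpa using (hI s i).2.1.re
  have hmean : ∫ ω, Y t k ω ∂P = 0 := by
    have := (hI t k).integral_eq_zero hB
    rw [integral_complex_ofReal] at this
    exact_mod_cast this
  rw [covariance_eq_sub (hmem _ _) (hmem _ _), hmean, mul_zero, sub_zero]
  have hm := (hI (t + h) j).integral_mul_conj hB (hI t k)
  simp only [Complex.conj_ofReal, ← Complex.ofReal_mul] at hm
  rw [integral_complex_ofReal] at hm
  simp only [Pi.mul_apply]
  rw [hm, crossCov, ← integral_const_mul]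
  congr 1; ext x
  have hf : ∀ i (x : ℝ), factor (ν i) (a i) x = normConst (ν i) (a i) * specPow (ν i) (a i) x :=
    fun i x => rfl
  have hexp : Complex.exp (Complex.I * ↑(t + h) * x) *
      starRingEnd ℂ (Complex.exp (Complex.I * t * x)) = Complex.exp (Complex.I * h * x) := by
    rw [← Complex.exp_conj, ← Complex.exp_add]
    congr 1
    simp [Complex.conj_ofReal]; ring
  rw [← hexp, hf, hf, map_mul, map_mul, conj_specPow (ha k), Complex.conj_ofReal]
  simp only [specPow, Complex.ofReal_neg, mul_neg, ← sub_eq_add_neg]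
  ring

/-! ### The sine integral -/

/-- The sine integral `Si(y) = ∫_0^y sin v / v dv`. -/
noncomputable def sinInt (y : ℝ) : ℝ := ∫ v in (0 : ℝ)..y, Real.sinc v

lemma integral_exp_neg_mul_Ioi_zero {b : ℝ} (hb : 0 < b) :
    IntegrableOn (fun s : ℝ => Real.exp (-(s * b))) (Set.Ioi 0) ∧
      ∫ s in Set.Ioi (0 : ℝ), Real.exp (-(s * b)) = 1 / b := by
  have h : ∀ s : ℝ, -(s * b) = -b * s := fun s => by ring
  simp only [h]
  refine ⟨exp_neg_integrableOn_Ioi 0 hb, ?_⟩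
  rw [integral_exp_mul_Ioi (by linarith)]
  simp [neg_div_neg_eq]

lemma integral_sin_mul_exp (s R : ℝ) :
    ∫ v in (0 : ℝ)..R, Real.sin v * Real.exp (-(s * v)) =
      1 / (1 + s ^ 2) - Real.exp (-(s * R)) * (Real.cos R + s * Real.sin R) / (1 + s ^ 2) := by
  have hs : (1 + s ^ 2) ≠ 0 := by positivity
  have hd : ∀ v ∈ Set.uIcc (0 : ℝ) R, HasDerivAt
      (fun v => -(Real.exp (-(s * v)) * (Real.cos v + s * Real.sin v) / (1 + s ^ 2)))
      (Real.sin v * Real.exp (-(s * v))) v := by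
    intro v _
    have h1 : HasDerivAt (fun v : ℝ => -(s * v)) (-s) v := by
      simpa using ((hasDerivAt_id v).const_mul s).fun_neg
    have h2 := ((h1.exp.mul ((Real.hasDerivAt_cos v).add
      ((Real.hasDerivAt_sin v).const_mul s))).div_const (1 + s ^ 2)).neg
    refine h2.congr_deriv ?_
    simp only [Pi.add_apply]
    field_simp
    ring
  rw [intervalIntegral.integral_eq_sub_of_hasDerivAt hd
    (Continuous.intervalIntegrable (by fun_prop) _ _)]
  simp
  ring

lemma abs_sinInt_sub_le {R : ℝ} (hR : 0 < R) : |sinInt R - Real.pi / 2| ≤ 2 / R := by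
  have hint : Integrable (Function.uncurry fun v s : ℝ => Real.sin v * Real.exp (-(s * v)))
      ((volume.restrict (Set.uIoc 0 R)).prod (volume.restrict (Set.Ioi 0))) := by
    rw [integrable_prod_iff (Continuous.aestronglyMeasurable (by fun_prop))]
    rw [Set.uIoc_of_le hR.le]
    constructor
    · filter_upwards [ae_restrict_mem measurableSet_Ioc] with v hv
      exact (integral_exp_neg_mul_Ioi_zero hv.1).1.const_mul (Real.sin v)
    · have hc : IntegrableOn (fun v : ℝ => |Real.sinc v|) (Set.Ioc 0 R) :=
        (Real.continuous_sinc.abs.intervalIntegrable 0 R).1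
      refine hc.congr_fun (fun v hv => ?_) measurableSet_Ioc
      simp only [Function.uncurry, norm_mul, Real.norm_eq_abs, Real.abs_exp]
      rw [integral_const_mul, (integral_exp_neg_mul_Ioi_zero hv.1).2,
        Real.sinc_of_ne_zero hv.1.ne', abs_div, abs_of_pos hv.1]
      ring
  have h1 : sinInt R = ∫ s in Set.Ioi (0 : ℝ),
      (1 / (1 + s ^ 2) - Real.exp (-(s * R)) * (Real.cos R + s * Real.sin R) / (1 + s ^ 2)) := by
    have := intervalIntegral_integral_swap (a := 0) (b := R) hint
    simp only [integral_sin_mul_exp] at this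
    rw [← this, sinInt]
    apply intervalIntegral.integral_congr_ae
    refine Eventually.of_forall fun v hv => ?_
    rw [Set.uIoc_of_le hR.le] at hv
    rw [integral_const_mul, (integral_exp_neg_mul_Ioi_zero hv.1).2,
      Real.sinc_of_ne_zero hv.1.ne', div_eq_mul_one_div]
  have hI1 : IntegrableOn (fun s : ℝ => 1 / (1 + s ^ 2)) (Set.Ioi 0) := by
    simpa [one_div] using integrable_inv_one_add_sq.integrableOn
  have hb : ∀ s ∈ Set.Ioi (0 : ℝ),
      ‖Real.exp (-(s * R)) * (Real.cos R + s * Real.sin R) / (1 + s ^ 2)‖ ≤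
        2 * Real.exp (-(s * R)) := by
    intro s hs
    have hs : 0 < s := hs
    rw [norm_div, norm_mul, Real.norm_eq_abs, Real.norm_eq_abs, Real.norm_eq_abs, Real.abs_exp,
      abs_of_pos (by positivity : 0 < 1 + s ^ 2), div_le_iff₀ (by positivity)]
    have : |Real.cos R + s * Real.sin R| ≤ 1 + s := by
      refine (abs_add_le _ _).trans (add_le_add (Real.abs_cos_le_one R) ?_)
      rw [abs_mul, abs_of_pos hs]
      exact mul_le_of_le_one_right hs.le (Real.abs_sin_le_one R)
    nlinarith [Real.exp_pos (-(s * R)), mul_le_mul_of_nonneg_left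
      (this.trans (by nlinarith [sq_nonneg (s - 1)] : 1 + s ≤ 2 * (1 + s ^ 2)))
      (Real.exp_pos (-(s * R))).le]
  have hE := (integral_exp_neg_mul_Ioi_zero hR)
  have hI2 : IntegrableOn (fun s : ℝ =>
      Real.exp (-(s * R)) * (Real.cos R + s * Real.sin R) / (1 + s ^ 2)) (Set.Ioi 0) := by
    refine Integrable.mono' (hE.1.const_mul 2) ?_
      ((ae_restrict_iff' measurableSet_Ioi).2 (Eventually.of_forall hb))
    refine Continuous.aestronglyMeasurable (Continuous.div (by fun_prop) (by fun_prop) ?_)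
    intro s; positivity
  rw [h1, integral_sub hI1 hI2]
  have : ∫ s in Set.Ioi (0 : ℝ), 1 / (1 + s ^ 2) = Real.pi / 2 := by
    simp only [one_div, integral_Ioi_inv_one_add_sq, Real.arctan_zero, sub_zero]
  rw [this, sub_sub_cancel_left, abs_neg, ← Real.norm_eq_abs]
  refine (norm_integral_le_of_norm_le (hE.1.const_mul 2)
    ((ae_restrict_iff' measurableSet_Ioi).2 (Eventually.of_forall hb))).trans (le_of_eq ?_)
  rw [integral_const_mul, hE.2]; ring

lemma sinInt_neg (y : ℝ) : sinInt (-y) = -sinInt y := by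
  unfold sinInt
  have := intervalIntegral.integral_comp_neg (a := 0) (b := y) Real.sinc
  simp only [Real.sinc_neg, neg_zero] at this
  rw [this, intervalIntegral.integral_symm]

lemma continuous_sinInt : Continuous sinInt :=
  intervalIntegral.continuous_primitive (fun _ _ => Real.continuous_sinc.intervalIntegrable _ _) 0

lemma abs_sinInt_le (y : ℝ) : |sinInt y| ≤ 4 := by
  wlog hy : 0 ≤ y generalizing y
  · rw [← abs_neg, ← sinInt_neg]; exact this (-y) (by linarith)
  rcases le_total y 1 with h | h
  · have := intervalIntegral.norm_integral_le_of_norm_le_const (a := 0) (b := y) (C := 1)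
      (f := Real.sinc) fun x _ => Real.abs_sinc_le_one x
    rw [Real.norm_eq_abs, sub_zero, abs_of_nonneg hy] at this
    unfold sinInt; linarith
  · have h1 := abs_sinInt_sub_le (by linarith : 0 < y)
    have h2 : 2 / y ≤ 2 := by rw [div_le_iff₀ (by linarith)]; linarith
    have h3 := abs_le.1 (h1.trans h2)
    exact abs_le.2 ⟨by linarith [Real.pi_pos], by linarith [Real.pi_le_four]⟩

lemma tendsto_sinInt_atTop : Tendsto sinInt atTop (𝓝 (Real.pi / 2)) := by
  rw [tendsto_iff_norm_sub_tendsto_zero]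
  refine tendsto_of_tendsto_of_tendsto_of_le_of_le' tendsto_const_nhds
    (tendsto_const_nhds.div_atTop tendsto_id : Tendsto (fun R : ℝ => (2 : ℝ) / R) atTop (𝓝 0))
    (Eventually.of_forall fun _ => norm_nonneg _) ?_
  filter_upwards [eventually_gt_atTop 0] with R hR using abs_sinInt_sub_le hR

lemma tendsto_sinInt_mul (x : ℝ) :
    Tendsto (fun R => sinInt (R * x)) atTop (𝓝 (Real.pi / 2 * Real.sign x)) := by
  rcases lt_trichotomy x 0 with hx | rfl | hx
  · have := (tendsto_sinInt_atTop.comp (tendsto_id.atTop_mul_const (neg_pos.2 hx))).neg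
    rw [Real.sign_of_neg hx]
    simpa [Function.comp_def, sinInt_neg] using this
  · simp [sinInt]
  · rw [Real.sign_of_pos hx, mul_one]
    exact tendsto_sinInt_atTop.comp (tendsto_id.atTop_mul_const hx)

lemma integral_sin_mul_div {ε R : ℝ} (hε : 0 < ε) (hR : ε ≤ R) (x : ℝ) :
    ∫ v in ε..R, Real.sin (x * v) / v = sinInt (R * x) - sinInt (ε * x) := by
  have h0 : ∀ v ∈ Set.uIcc ε R, Real.sin (x * v) / v = x * Real.sinc (x * v) := by
    intro v hv
    rw [Set.uIcc_of_le hR] at hv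
    have hv0 : v ≠ 0 := (hε.trans_le hv.1).ne'
    by_cases hx : x = 0
    · simp [hx]
    · rw [Real.sinc_of_ne_zero (mul_ne_zero hx hv0)]; field_simp
  rw [intervalIntegral.integral_congr h0, intervalIntegral.integral_const_mul,
    intervalIntegral.mul_integral_comp_mul_left, mul_comm R, mul_comm ε]
  unfold sinInt
  rw [intervalIntegral.integral_interval_sub_left] <;>
  exact Real.continuous_sinc.intervalIntegrable _ _

/-! ### Truncated Hilbert transforms of Fourier transforms -/

/-- The Fourier integral `∫ e^{iux} g(x) dx`. -/
noncomputable def fourierInt (g : ℝ → ℂ) (u : ℝ) : ℂ := ∫ x : ℝ, Complex.exp (Complex.I * u * x) * g x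

lemma fourierInt_sub_fourierInt {g : ℝ → ℂ} (hg : Integrable g) (h v : ℝ) :
    fourierInt g (h - v) - fourierInt g (h + v) =
      ∫ x : ℝ, Complex.exp (Complex.I * h * x) * g x * (-2 * Complex.I) * (Real.sin (x * v) : ℂ) := by
  unfold fourierInt
  rw [← integral_sub (integrable_exp_mul hg _) (integrable_exp_mul hg _)]
  congr 1; ext x
  have h1 : Complex.exp (Complex.I * (h - v : ℝ) * x) =
      Complex.exp (Complex.I * h * x) * Complex.exp (-(x * v : ℝ) * Complex.I) := by
    rw [← Complex.exp_add]; congr 1; push_cast; ring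
  have h2 : Complex.exp (Complex.I * (h + v : ℝ) * x) =
      Complex.exp (Complex.I * h * x) * Complex.exp ((x * v : ℝ) * Complex.I) := by
    rw [← Complex.exp_add]; congr 1; push_cast; ring
  rw [h1, h2, Complex.ofReal_sin, Complex.sin]
  linear_combination (Complex.exp (Complex.I * h * x) * g x *
    (Complex.exp (-(x * v : ℝ) * Complex.I) - Complex.exp ((x * v : ℝ) * Complex.I))) * Complex.I_sq

lemma integral_fourierInt_sub_div {g : ℝ → ℂ} (hg : Integrable g) (h : ℝ) {ε R : ℝ} (hε : 0 < ε)
    (hR : ε ≤ R) :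
    ∫ v in ε..R, (fourierInt g (h - v) - fourierInt g (h + v)) / (v : ℂ) =
      ∫ x : ℝ, Complex.exp (Complex.I * h * x) * g x * (-2 * Complex.I) *
        ((sinInt (R * x) - sinInt (ε * x) : ℝ) : ℂ) := by
  set G : ℝ → ℂ := fun x => Complex.exp (Complex.I * h * x) * g x * (-2 * Complex.I) with hG
  have hGi : Integrable G := (integrable_exp_mul hg h).mul_const _
  have hfin : IsFiniteMeasure (volume.restrict (Set.uIoc ε R)) :=
    ⟨by rw [Measure.restrict_apply_univ, Set.uIoc_of_le hR]; simp⟩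
  have hint : Integrable (Function.uncurry fun v x : ℝ => G x * ((Real.sin (x * v) / v : ℝ) : ℂ))
      ((volume.restrict (Set.uIoc ε R)).prod volume) := by
    refine ((hGi.norm.comp_snd (volume.restrict (Set.uIoc ε R))).const_mul (1 / ε)).mono' ?_ ?_
    · refine AEStronglyMeasurable.mul hGi.1.comp_snd ?_
      exact Measurable.aestronglyMeasurable (by fun_prop)
    · have : ∀ᵐ z : ℝ × ℝ ∂((volume.restrict (Set.uIoc ε R)).prod volume), z.1 ∈ Set.uIoc ε R :=
        Measure.quasiMeasurePreserving_fst.ae (ae_restrict_mem measurableSet_uIoc)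
      filter_upwards [this] with z hz
      rw [Set.uIoc_of_le hR] at hz
      simp only [Function.uncurry, norm_mul, Complex.norm_real, norm_div, Real.norm_eq_abs]
      rw [mul_comm]
      refine mul_le_mul_of_nonneg_right ?_ (norm_nonneg _)
      exact div_le_div₀ zero_le_one (Real.abs_sin_le_one _) hε (hz.1.le.trans (le_abs_self _))
  have h1 := intervalIntegral_integral_swap (a := ε) (b := R) hint
  have h2 : ∀ x : ℝ, ∫ v in ε..R, G x * ((Real.sin (x * v) / v : ℝ) : ℂ) =
      G x * ((sinInt (R * x) - sinInt (ε * x) : ℝ) : ℂ) := by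
    intro x
    rw [intervalIntegral.integral_const_mul, intervalIntegral.integral_ofReal,
      integral_sin_mul_div hε hR]
  simp only [h2] at h1
  rw [← h1]
  congr 1; ext v
  rw [fourierInt_sub_fourierInt hg, div_eq_mul_inv, ← integral_mul_const]
  congr 1; ext x
  simp only [hG]; push_cast; ring

lemma integral_Ioi_fourierInt_sub_div {g : ℝ → ℂ} (hg : Integrable g) (h : ℝ) {ε : ℝ} (hε : 0 < ε)
    (hi : IntegrableOn (fun v : ℝ => (fourierInt g (h - v) - fourierInt g (h + v)) / (v : ℂ))
      (Set.Ioi ε)) :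
    ∫ v in Set.Ioi ε, (fourierInt g (h - v) - fourierInt g (h + v)) / (v : ℂ) =
      ∫ x : ℝ, Complex.exp (Complex.I * h * x) * g x * (-2 * Complex.I) *
        ((Real.pi / 2 * Real.sign x - sinInt (ε * x) : ℝ) : ℂ) := by
  have h1 := intervalIntegral_tendsto_integral_Ioi ε hi tendsto_id
  refine tendsto_nhds_unique (h1.congr' (f₂ := fun R => ∫ x : ℝ, Complex.exp (Complex.I * h * x) *
    g x * (-2 * Complex.I) * ((sinInt (R * x) - sinInt (ε * x) : ℝ) : ℂ)) ?_) ?_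
  · filter_upwards [eventually_ge_atTop ε] with R hR using integral_fourierInt_sub_div hg h hε hR
  have hGi := (integrable_exp_mul hg h).mul_const (-2 * Complex.I)
  refine tendsto_integral_filter_of_dominated_convergence
    (fun x => ‖Complex.exp (Complex.I * h * x) * g x * (-2 * Complex.I)‖ * 8) ?_ ?_
    (hGi.norm.mul_const 8) ?_
  · refine Eventually.of_forall fun R => hGi.1.mul (Continuous.aestronglyMeasurable ?_)
    have := continuous_sinInt
    fun_prop
  · refine Eventually.of_forall fun R => Eventually.of_forall fun x => ?_
    rw [norm_mul, Complex.norm_real]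
    refine mul_le_mul_of_nonneg_left ?_ (norm_nonneg _)
    refine (abs_sub _ _).trans ?_
    linarith [abs_sinInt_le (R * x), abs_sinInt_le (ε * x)]
  · refine Eventually.of_forall fun x => Tendsto.const_mul _ ?_
    exact (Complex.continuous_ofReal.tendsto _).comp ((tendsto_sinInt_mul x).sub_const _)

lemma tendsto_integral_Ioi_fourierInt_sub_div {g : ℝ → ℂ} (hg : Integrable g) (h : ℝ)
    (hi : ∀ ε, 0 < ε → IntegrableOn
      (fun v : ℝ => (fourierInt g (h - v) - fourierInt g (h + v)) / (v : ℂ)) (Set.Ioi ε)) :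
    Tendsto (fun ε : ℝ => ∫ v in Set.Ioi ε, (fourierInt g (h - v) - fourierInt g (h + v)) / (v : ℂ))
      (𝓝[>] 0) (𝓝 (-Real.pi * (Complex.I *
        ∫ x : ℝ, Complex.exp (Complex.I * h * x) * g x * (Real.sign x : ℂ)))) := by
  have hGi := (integrable_exp_mul hg h).mul_const (-2 * Complex.I)
  have : Tendsto (fun ε : ℝ => ∫ x : ℝ, Complex.exp (Complex.I * h * x) * g x * (-2 * Complex.I) *
        ((Real.pi / 2 * Real.sign x - sinInt (ε * x) : ℝ) : ℂ)) (𝓝[>] 0)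
      (𝓝 (∫ x : ℝ, Complex.exp (Complex.I * h * x) * g x * (-2 * Complex.I) *
        ((Real.pi / 2 * Real.sign x : ℝ) : ℂ))) := by
    refine tendsto_integral_filter_of_dominated_convergence
      (fun x => ‖Complex.exp (Complex.I * h * x) * g x * (-2 * Complex.I)‖ * 8) ?_ ?_
      (hGi.norm.mul_const 8) ?_
    · refine Eventually.of_forall fun R => hGi.1.mul (Measurable.aestronglyMeasurable ?_)
      have := continuous_sinInt.measurable
      have := measurable_sign
      fun_prop
    · refine Eventually.of_forall fun R => Eventually.of_forall fun x => ?_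
      rw [norm_mul, Complex.norm_real]
      refine mul_le_mul_of_nonneg_left ?_ (norm_nonneg _)
      refine (abs_sub _ _).trans ?_
      have h1 : |Real.pi / 2 * Real.sign x| ≤ 2 := by
        rw [abs_mul, abs_of_pos (by positivity : 0 < Real.pi / 2)]
        nlinarith [abs_sign_le x, Real.pi_le_four, Real.pi_pos, abs_nonneg (Real.sign x)]
      linarith [abs_sinInt_le (R * x)]
    · refine Eventually.of_forall fun x => Tendsto.const_mul _ ?_
      refine (Complex.continuous_ofReal.tendsto _).comp ?_
      have : Tendsto (fun ε => sinInt (ε * x)) (𝓝[>] 0) (𝓝 0) := by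
        have hc : Continuous fun ε => sinInt (ε * x) :=
          continuous_sinInt.comp (continuous_id.mul continuous_const)
        have := hc.tendsto 0
        simp only [zero_mul] at this
        rw [show sinInt 0 = 0 by simp [sinInt]] at this
        exact this.mono_left nhdsWithin_le_nhds
      simpa using this.const_sub (Real.pi / 2 * Real.sign x)
  convert this.congr' ?_ using 2
  · rw [← integral_const_mul, ← integral_const_mul]
    congr 1; ext x; push_cast; ring
  · filter_upwards [self_mem_nhdsWithin] with ε hε
    exact (integral_Ioi_fourierInt_sub_div hg h hε (hi ε hε)).symm

lemma continuous_fourierInt {g : ℝ → ℂ} (hg : Integrable g) : Continuous (fourierInt g) := by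
  refine continuous_of_dominated (bound := fun x => ‖g x‖)
    (fun u => (integrable_exp_mul hg u).1) (fun u => Eventually.of_forall fun x => ?_) hg.norm
    (Eventually.of_forall fun x => by fun_prop)
  rw [norm_mul, norm_cexp_I_mul, one_mul]

lemma norm_fourierInt_le (g : ℝ → ℂ) (u : ℝ) : ‖fourierInt g u‖ ≤ ∫ x, ‖g x‖ := by
  refine (norm_integral_le_integral_norm _).trans (le_of_eq ?_)
  simp only [norm_mul, norm_cexp_I_mul, one_mul]

lemma fourierInt_deriv {g g' : ℝ → ℂ} (hg : Integrable g) (hg' : Integrable g')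
    (hd : ∀ x, HasDerivAt g (g' x) x) (u : ℝ) :
    fourierInt g' u = -(Complex.I * u * fourierInt g u) := by
  have hE : ∀ x : ℝ, HasDerivAt (fun x : ℝ => Complex.exp (Complex.I * u * x))
      (Complex.I * u * Complex.exp (Complex.I * u * x)) x := by
    intro x
    have h1 : HasDerivAt (fun z : ℂ => Complex.I * u * z) (Complex.I * u) (x : ℂ) := by
      simpa using (hasDerivAt_id (x : ℂ)).const_mul (Complex.I * u)
    exact (h1.cexp.comp_ofReal).congr_deriv (by ring)
  have h := integral_mul_deriv_eq_deriv_mul_of_integrable (u := fun x : ℝ =>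
    Complex.exp (Complex.I * u * x)) (v := g)
    (u' := fun x : ℝ => Complex.I * u * Complex.exp (Complex.I * u * x)) (v' := g')
    (fun x _ => hE x) (fun x _ => hd x) (integrable_exp_mul hg' u)
    (by
      refine ((integrable_exp_mul hg u).const_mul (Complex.I * u)).congr
        (Eventually.of_forall fun x => ?_)
      simp only [Pi.mul_apply]; ring) (integrable_exp_mul hg u)
  unfold fourierInt
  rw [h, ← integral_const_mul]
  congr 2; ext x; ring

lemma exists_norm_fourierInt_gFun_le {νj aj νk ak : ℝ} (hνj : 0 < νj) (hνk : 0 < νk) (haj : 0 < aj)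
    (hak : 0 < ak) : ∃ M, ∀ u, ‖fourierInt (gFun νj aj νk ak) u‖ * (1 + |u|) ≤ M := by
  obtain ⟨g', hg', hd⟩ := exists_hasDerivAt_gFun hνj hνk haj hak
  have hg := integrable_gFun hνj hνk haj hak
  refine ⟨(∫ x, ‖gFun νj aj νk ak x‖) + ∫ x, ‖g' x‖, fun u => ?_⟩
  have h1 := norm_fourierInt_le g' u
  rw [fourierInt_deriv hg hg' hd] at h1
  simp only [norm_neg, norm_mul, Complex.norm_I, one_mul, Complex.norm_real, Real.norm_eq_abs] at h1
  linarith [norm_fourierInt_le (gFun νj aj νk ak) u]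

/-! ### Truncated integrals -/

lemma setOf_lt_abs_sub (c ε : ℝ) :
    {u : ℝ | u ∈ Set.univ ∧ ε < |u - c|} = Set.Iio (c - ε) ∪ Set.Ioi (c + ε) := by
  ext u
  simp only [Set.mem_univ, true_and, Set.mem_ofPred_eq, lt_abs, Set.mem_union, Set.mem_Iio,
    Set.mem_Ioi]
  constructor
  · rintro (h | h)
    · right; linarith
    · left; linarith
  · rintro (h | h)
    · right; linarith
    · left; linarith

lemma integrableOn_comp_add_Ioi {E : Type*} [NormedAddCommGroup E] {f : ℝ → E} {c ε : ℝ} :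
    IntegrableOn (fun v => f (c + v)) (Set.Ioi ε) ↔ IntegrableOn f (Set.Ioi (c + ε)) := by
  have := (measurePreserving_add_left volume c).integrableOn_comp_preimage (f := f)
    (s := Set.Ioi (c + ε)) (measurableEmbedding_addLeft c)
  simpa [Function.comp_def] using this

lemma integrableOn_comp_sub_Ioi {E : Type*} [NormedAddCommGroup E] {f : ℝ → E} {c ε : ℝ} :
    IntegrableOn (fun v => f (c - v)) (Set.Ioi ε) ↔ IntegrableOn f (Set.Iio (c - ε)) := by
  have := (Measure.measurePreserving_sub_left volume c).integrableOn_comp_preimage (f := f)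
    (s := Set.Iio (c - ε)) (MeasurableEquiv.subLeft c).measurableEmbedding
  simpa [Function.comp_def] using this

lemma integral_comp_add_Ioi {E : Type*} [NormedAddCommGroup E] [NormedSpace ℝ E] (f : ℝ → E)
    (c ε : ℝ) : ∫ v in Set.Ioi ε, f (c + v) = ∫ u in Set.Ioi (c + ε), f u := by
  have := (measurePreserving_add_left volume c).setIntegral_preimage_emb
    (measurableEmbedding_addLeft c) f (Set.Ioi (c + ε))
  simpa using this

lemma integral_comp_sub_Ioi {E : Type*} [NormedAddCommGroup E] [NormedSpace ℝ E] (f : ℝ → E)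
    (c ε : ℝ) : ∫ v in Set.Ioi ε, f (c - v) = ∫ u in Set.Iio (c - ε), f u := by
  have := (Measure.measurePreserving_sub_left volume c).setIntegral_preimage_emb
    (MeasurableEquiv.subLeft c).measurableEmbedding f (Set.Iio (c - ε))
  simpa using this

lemma integral_setOf_lt_abs_sub {f : ℝ → ℝ} {c ε : ℝ} (hε : 0 < ε)
    (hf : IntegrableOn f {u : ℝ | u ∈ Set.univ ∧ ε < |u - c|}) :
    IntegrableOn (fun v => f (c - v) + f (c + v)) (Set.Ioi ε) ∧
    ∫ u in {u : ℝ | u ∈ Set.univ ∧ ε < |u - c|}, f u =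
      ∫ v in Set.Ioi ε, (f (c - v) + f (c + v)) := by
  rw [setOf_lt_abs_sub] at hf ⊢
  have h1 := hf.mono_set (Set.subset_union_left)
  have h2 := hf.mono_set (Set.subset_union_right)
  have h1' := integrableOn_comp_sub_Ioi.2 h1
  have h2' := integrableOn_comp_add_Ioi.2 h2
  refine ⟨h1'.add h2', ?_⟩
  rw [integral_add h1' h2', integral_comp_sub_Ioi f, integral_comp_add_Ioi f]
  refine setIntegral_union ?_ measurableSet_Ioi h1 h2
  rw [Set.disjoint_left]
  intro u hu hu'
  simp only [Set.mem_Iio, Set.mem_Ioi] at hu hu'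
  linarith

lemma integrableOn_div_sub {C : ℝ → ℝ} (hC : Continuous C) {M : ℝ} (hM : ∀ u, |C u| * (1 + |u|) ≤ M)
    (h : ℝ) {ε : ℝ} (hε : 0 < ε) :
    IntegrableOn (fun u => C u / (h - u)) {u : ℝ | u ∈ Set.univ ∧ ε < |u - h|} := by
  set K := 1 + (1 + |h|) / ε with hK
  have hms : MeasurableSet {u : ℝ | u ∈ Set.univ ∧ ε < |u - h|} := by
    rw [setOf_lt_abs_sub]; exact measurableSet_Iio.union measurableSet_Ioi
  have hdom : Integrable fun u : ℝ => (M * K) * (1 + u ^ 2)⁻¹ :=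
    integrable_inv_one_add_sq.const_mul _
  refine Integrable.mono' (hdom.integrableOn) (Measurable.aestronglyMeasurable ?_)
    ((ae_restrict_iff' hms).2 (Eventually.of_forall ?_))
  · have := hC.measurable; fun_prop
  · rintro u ⟨-, hu⟩
    have hu0 : 0 < |h - u| := by rw [abs_sub_comm]; linarith
    have h1 : 1 + |u| ≤ K * |h - u| := by
      have h2 : |u| ≤ |h - u| + |h| := by
        have := abs_sub h (h - u); rw [sub_sub_cancel] at this; linarith
      have h3 : 1 + |h| ≤ (1 + |h|) / ε * |h - u| := by
        rw [div_mul_eq_mul_div, le_div_iff₀ hε, abs_sub_comm]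
        exact mul_le_mul_of_nonneg_left hu.le (by positivity)
      rw [hK]; linarith
    have hM0 : 0 ≤ M := le_trans (by positivity) (hM 0)
    have hK0 : 0 < K := by positivity
    rw [Real.norm_eq_abs, abs_div, ← div_eq_mul_inv, div_le_div_iff₀ hu0 (by positivity)]
    have h4 : |C u| * (1 + |u|) ^ 2 ≤ M * (K * |h - u|) := by
      rw [sq, ← mul_assoc]
      exact mul_le_mul (hM u) h1 (by positivity) hM0
    have h5 : 1 + u ^ 2 ≤ (1 + |u|) ^ 2 := by nlinarith [abs_nonneg u, sq_abs u]
    nlinarith [mul_le_mul_of_nonneg_left h5 (abs_nonneg (C u))]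

section
variable {νj aj νk ak : ℝ}

lemma continuous_crossRe_re (hνj : 0 < νj) (hνk : 0 < νk) (haj : 0 < aj) (hak : 0 < ak) :
    Continuous fun u => (crossRe νj aj νk ak u).re :=
  Complex.continuous_re.comp (continuous_fourierInt (integrable_gFun hνj hνk haj hak))

theorem hasPVIntegral_crossRe (hνj : 0 < νj) (hνk : 0 < νk) (haj : 0 < aj) (hak : 0 < ak) (h : ℝ) :
    HasPVIntegral (fun u => (crossRe νj aj νk ak u).re / (h - u)) Set.univ h
      (-Real.pi * (crossIm νj aj νk ak h).re) := by
  have hg := integrable_gFun hνj hνk haj hak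
  obtain ⟨M, hM⟩ := exists_norm_fourierInt_gFun_le hνj hνk haj hak
  have hint : ∀ ε : ℝ, 0 < ε → IntegrableOn (fun u => (crossRe νj aj νk ak u).re / (h - u))
      {u | u ∈ Set.univ ∧ ε < |u - h|} := fun ε hε =>
    integrableOn_div_sub (continuous_crossRe_re hνj hνk haj hak) (M := M) (fun u =>
      (mul_le_mul_of_nonneg_right (Complex.abs_re_le_norm _) (by positivity)).trans (hM u)) h hε
  refine ⟨hint, ?_⟩
  have hcast : ∀ u, ((crossRe νj aj νk ak u).re : ℂ) = fourierInt (gFun νj aj νk ak) u := fun u =>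
    Complex.ext rfl (by rw [Complex.ofReal_im]; exact (crossRe_im haj hak u).symm)
  have hfun : ∀ v : ℝ, (((crossRe νj aj νk ak (h - v)).re / (h - (h - v)) +
      (crossRe νj aj νk ak (h + v)).re / (h - (h + v)) : ℝ) : ℂ) =
      (fourierInt (gFun νj aj νk ak) (h - v) - fourierInt (gFun νj aj νk ak) (h + v)) / (v : ℂ) := by
    intro v
    rw [← hcast, ← hcast, sub_sub_cancel, sub_add_cancel_left, div_neg]
    push_cast; ring
  have hi : ∀ ε : ℝ, 0 < ε → IntegrableOn (fun v : ℝ =>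
      (fourierInt (gFun νj aj νk ak) (h - v) - fourierInt (gFun νj aj νk ak) (h + v)) / (v : ℂ))
      (Set.Ioi ε) := fun ε hε => by
    have := (integral_setOf_lt_abs_sub hε (hint ε hε)).1.ofReal (𝕜 := ℂ)
    exact this.congr (Eventually.of_forall fun v => hfun v)
  have ht := tendsto_integral_Ioi_fourierInt_sub_div hg h hi
  have ht' := (Complex.continuous_re.tendsto _).comp ht
  convert ht'.congr' ?_ using 2
  · change -Real.pi * (crossIm νj aj νk ak h).re = (-(Real.pi : ℂ) * crossIm νj aj νk ak h).re
    rw [← Complex.ofReal_neg, Complex.re_ofReal_mul]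
  · filter_upwards [self_mem_nhdsWithin] with ε hε
    rw [(integral_setOf_lt_abs_sub hε (hint ε hε)).2, Function.comp_apply,
      ← Complex.ofReal_re (∫ v in Set.Ioi ε, _), ← integral_complex_ofReal]
    simp only [hfun]

lemma pvIntegral_eq {f : ℝ → ℝ} {s : Set ℝ} {c l : ℝ} (h : HasPVIntegral f s c l) :
    pvIntegral f s c = l := h.2.limUnder_eq

theorem crossIm_re_eq_neg_hilbertTransform (hνj : 0 < νj) (hνk : 0 < νk) (haj : 0 < aj)
    (hak : 0 < ak) (h : ℝ) : (crossIm νj aj νk ak h).re =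
      -hilbertTransform (fun u => (crossRe νj aj νk ak u).re) h := by
  rw [hilbertTransform, pvIntegral_eq (hasPVIntegral_crossRe hνj hνk haj hak h)]
  field_simp

end

open scoped FourierTransform in
/-- Fourier inversion, with the transform normalized as `∫ e^{-iux} f(u) du`. -/
lemma fourierInt_eq_of_fourier {f g : ℝ → ℂ} (hf : Continuous f) (hfi : Integrable f)
    (hg : Integrable g) (h : ∀ x : ℝ, ∫ u : ℝ, Complex.exp (-(Complex.I * x * u)) * f u = g x) (u : ℝ) :
    fourierInt g u = 2 * Real.pi * f u := by
  have h2 : (2 * Real.pi) ≠ 0 := by positivity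
  have hF : 𝓕 f = fun w => g ((2 * Real.pi) * w) := by
    ext w
    rw [Real.fourier_real_eq_integral_exp_smul, ← h]
    congr 1; ext v
    rw [smul_eq_mul]; congr 2; push_cast; ring
  have hI := hf.fourierInv_fourier_eq hfi (by rw [hF]; exact hg.comp_mul_left' h2)
  have hu := congrFun hI u
  rw [Real.fourierInv_eq', hF] at hu
  have hs := Measure.integral_comp_mul_left
    (fun x : ℝ => Complex.exp (Complex.I * u * x) * g x) (2 * Real.pi)
  unfold fourierInt
  rw [← hu]
  have he : ∀ w : ℝ, Complex.exp (((2 * Real.pi * inner ℝ w u : ℝ) : ℂ) * Complex.I) •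
      g (2 * Real.pi * w) =
      Complex.exp (Complex.I * u * (2 * Real.pi * w : ℝ)) * g (2 * Real.pi * w) := by
    intro w
    rw [smul_eq_mul]; congr 2
    simp; ring
  simp only [he]
  rw [hs, abs_of_pos (by positivity), Complex.real_smul, ← mul_assoc]
  push_cast
  rw [mul_inv_cancel₀ (by exact_mod_cast h2), one_mul]

/-- A two-sided exponential, with a linear factor. -/
noncomputable def expKernel (b α β u : ℝ) : ℝ :=
  if 0 ≤ u then (1 + b * u) * Real.exp (-(α * u)) else (1 - b * u) * Real.exp (β * u)

lemma continuous_expKernel (b α β : ℝ) : Continuous (expKernel b α β) := by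
  unfold expKernel
  refine Continuous.if_le (by fun_prop) (by fun_prop) continuous_const continuous_id ?_
  intro x hx
  simp [← hx]

lemma integrableOn_id_mul_exp {z : ℂ} (hz : 0 < z.re) :
    IntegrableOn (fun u : ℝ => (u : ℂ) * Complex.exp (-(z * u))) (Set.Ioi 0) := by
  have h := integrableOn_rpow_mul_exp_neg_mul_rpow (s := 1) (p := 1) (b := z.re) (by norm_num)
    one_pos hz
  refine Integrable.mono' h (Continuous.aestronglyMeasurable (by fun_prop)) ?_
  refine (ae_restrict_iff' measurableSet_Ioi).2 (Eventually.of_forall fun u hu => ?_)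
  have hu : 0 < u := hu
  simp [Complex.norm_exp, abs_of_pos hu]

lemma integrableOn_exp_neg_mul {z : ℂ} (hz : 0 < z.re) :
    IntegrableOn (fun u : ℝ => Complex.exp (-(z * u))) (Set.Ioi 0) := by
  simpa using integrableOn_exp_mul_complex_Ioi (a := -z) (by simpa using hz) 0

lemma integral_one_add_mul_exp {z : ℂ} (hz : 0 < z.re) (b : ℝ) :
    ∫ u in Set.Ioi (0 : ℝ), (1 + b * u) * Complex.exp (-(z * u)) = 1 / z + b / z ^ 2 := by
  have h1 : ∫ u in Set.Ioi (0 : ℝ), Complex.exp (-(z * u)) = 1 / z := by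
    have := integral_exp_mul_complex_Ioi (a := -z) (by simpa using hz) 0
    simpa [neg_div_neg_eq] using this
  have h2 : ∫ u in Set.Ioi (0 : ℝ), (u : ℂ) * Complex.exp (-(z * u)) = 1 / z ^ 2 := by
    have hz0 : z ≠ 0 := fun h => by simp [h] at hz
    have hd : ∀ u ∈ Set.Ici (0 : ℝ), HasDerivAt
        (fun u : ℝ => -(1 / z) * ((u : ℂ) * Complex.exp (-(z * u))) -
          1 / z ^ 2 * Complex.exp (-(z * u))) ((u : ℂ) * Complex.exp (-(z * u))) u := by
      intro u _
      have h1 : HasDerivAt (fun w : ℂ => -(z * w)) (-z) (u : ℂ) := by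
        simpa using ((hasDerivAt_id (u : ℂ)).const_mul z).fun_neg
      have h2 := h1.cexp
      have h3 := (((((hasDerivAt_id (u : ℂ)).mul h2).const_mul (-(1 / z))).sub
        (h2.const_mul (1 / z ^ 2)))).comp_ofReal
      refine h3.congr_deriv ?_
      simp only [id]
      field_simp
      ring
    have hi := integrableOn_id_mul_exp hz
    have ht := tendsto_zero_of_hasDerivAt_of_integrableOn_Ioi (fun u hu => hd u (Set.Ioi_subset_Ici_self hu)) hi
      ((hi.const_mul _).sub ((integrableOn_exp_neg_mul hz).const_mul _))
    rw [integral_Ioi_of_hasDerivAt_of_tendsto' hd hi ht]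
    simp
  simp only [add_mul, one_mul, mul_assoc]
  rw [integral_add (integrableOn_exp_neg_mul hz) ((integrableOn_id_mul_exp hz).const_mul _), h1,
    integral_const_mul, h2]
  ring

lemma integrableOn_one_add_mul_exp {z : ℂ} (hz : 0 < z.re) (b : ℝ) :
    IntegrableOn (fun u : ℝ => (1 + b * u) * Complex.exp (-(z * u))) (Set.Ioi 0) := by
  simp only [add_mul, one_mul, mul_assoc]
  exact (integrableOn_exp_neg_mul hz).add ((integrableOn_id_mul_exp hz).const_mul _)

lemma integrable_expKernel_aux {b α β : ℝ} (hα : 0 < α) (hβ : 0 < β) (x : ℝ) :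
    Integrable (fun u : ℝ => Complex.exp (-(Complex.I * x * u)) * (expKernel b α β u : ℂ)) ∧
    ∫ u : ℝ, Complex.exp (-(Complex.I * x * u)) * (expKernel b α β u : ℂ) =
      (1 / (α + Complex.I * x) + b / (α + Complex.I * x) ^ 2) +
        (1 / (β - Complex.I * x) + b / (β - Complex.I * x) ^ 2) := by
  set F : ℝ → ℂ := fun u => Complex.exp (-(Complex.I * x * u)) * (expKernel b α β u : ℂ) with hF
  have hz : 0 < ((α : ℂ) + Complex.I * x).re := by simpa using hα
  have hw : 0 < ((β : ℂ) - Complex.I * x).re := by simpa using hβ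
  have e1 : ∀ u ∈ Set.Ioi (0 : ℝ),
      (1 + b * u) * Complex.exp (-(((α : ℂ) + Complex.I * x) * u)) = F u := by
    intro u hu
    have hu : 0 < u := hu
    simp only [hF, expKernel, if_pos hu.le]
    push_cast
    rw [show -(((α : ℂ) + Complex.I * x) * u) = -(Complex.I * x * u) + -(α * u) by ring,
      Complex.exp_add]
    ring
  have e2 : ∀ u ∈ Set.Ioi (0 : ℝ),
      (1 + b * u) * Complex.exp (-(((β : ℂ) - Complex.I * x) * u)) = F (-u) := by
    intro u hu
    have hu : 0 < u := hu
    simp only [hF, expKernel, if_neg (by linarith : ¬ 0 ≤ -u)]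
    push_cast
    rw [show -(((β : ℂ) - Complex.I * x) * u) = -(Complex.I * x * -u) + β * -u by ring,
      Complex.exp_add]
    ring
  have i1 : IntegrableOn F (Set.Ioi 0) :=
    (integrableOn_one_add_mul_exp hz b).congr_fun e1 measurableSet_Ioi
  have i2 : IntegrableOn F (Set.Iic 0) := by
    rw [integrableOn_Iic_iff_integrableOn_Iio, show (0 : ℝ) = 0 - 0 by simp, ← integrableOn_comp_sub_Ioi]
    exact (integrableOn_one_add_mul_exp hw b).congr_fun
      (fun u hu => by simpa only [zero_sub] using e2 u hu) measurableSet_Ioi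
  refine ⟨?_, ?_⟩
  · rw [← integrableOn_univ, ← Set.Iic_union_Ioi (a := (0 : ℝ))]
    exact i2.union i1
  · rw [← intervalIntegral.integral_Iic_add_Ioi i2 i1, ← setIntegral_congr_fun measurableSet_Ioi e1,
      integral_one_add_mul_exp hz, ← integral_one_add_mul_exp hw,
      setIntegral_congr_fun measurableSet_Ioi e2, integral_comp_neg_Ioi, neg_zero, add_comm]

lemma crossRe_eq_of_gFun {νj aj νk ak b K : ℝ} (hνj : 0 < νj) (hνk : 0 < νk) (haj : 0 < aj)
    (hak : 0 < ak) (hK : K ≠ 0)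
    (hg : ∀ x : ℝ, gFun νj aj νk ak x = (K / (2 * Real.pi) : ℝ) *
      ((1 / (aj + Complex.I * x) + b / (aj + Complex.I * x) ^ 2) +
        (1 / (ak - Complex.I * x) + b / (ak - Complex.I * x) ^ 2))) (u : ℝ) :
    (crossRe νj aj νk ak u).re = K * expKernel b aj ak u := by
  have hc : (K / (2 * Real.pi)) ≠ 0 := by positivity
  have h0 := (integrable_expKernel_aux (b := b) haj hak 0).1
  simp only [Complex.ofReal_zero, mul_zero, zero_mul, neg_zero, Complex.exp_zero, one_mul] at h0
  have := fourierInt_eq_of_fourier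
    (f := fun u => ((K / (2 * Real.pi) : ℝ) : ℂ) * (expKernel b aj ak u : ℂ))
    (continuous_const.mul (Complex.continuous_ofReal.comp (continuous_expKernel b aj ak)))
    (h0.const_mul _) (integrable_gFun hνj hνk haj hak) (fun x => by
      rw [hg, ← (integrable_expKernel_aux (b := b) haj hak x).2, ← integral_const_mul]
      congr 1; ext u; ring) u
  have e : crossRe νj aj νk ak u = ((K * expKernel b aj ak u : ℝ) : ℂ) := by
    change fourierInt _ u = _
    rw [this]
    push_cast
    have : (Real.pi : ℂ) ≠ 0 := by exact_mod_cast Real.pi_ne_zero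
    field_simp
  rw [e, Complex.ofReal_re]

lemma normConst_half {a : ℝ} : normConst (1 / 2) a = Real.sqrt (a / Real.pi) := by
  unfold normConst
  rw [Real.Gamma_one_half_eq, Real.sqrt_eq_rpow Real.pi, ← Real.rpow_add Real.pi_pos]
  norm_num

lemma normConst_three_halves_sq {a : ℝ} (ha : 0 < a) :
    normConst (3 / 2) a ^ 2 = 2 * a ^ 3 / Real.pi := by
  unfold normConst
  have h1 : Real.Gamma (3 / 2) = 1 / 2 * Real.sqrt Real.pi := by
    rw [show (3 / 2 : ℝ) = 1 / 2 + 1 by norm_num, Real.Gamma_add_one (by norm_num),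
      Real.Gamma_one_half_eq]
  have h2 : Real.Gamma (3 / 2 + 1 / 2) = 1 := by norm_num
  have h3 : Real.pi ^ (1 / 2 : ℝ) * (1 / 2 * Real.sqrt Real.pi) = Real.pi / 2 := by
    rw [← Real.sqrt_eq_rpow]
    linear_combination (1 / 2) * Real.mul_self_sqrt Real.pi_pos.le
  rw [h1, h2, h3, mul_one, Real.sq_sqrt (by positivity)]
  rw [show (2 * (3 / 2) : ℝ) = (3 : ℕ) by norm_num, Real.rpow_natCast]
  field_simp

lemma specPow_half (a x : ℝ) : specPow (1 / 2) a x = ((a : ℂ) + Complex.I * x)⁻¹ := by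
  unfold specPow
  rw [show (-((1 / 2 : ℝ) : ℂ) - 1 / 2) = -1 by push_cast; ring, Complex.cpow_neg_one]

lemma specPow_three_halves (a x : ℝ) :
    specPow (3 / 2) a x = (((a : ℂ) + Complex.I * x) ^ 2)⁻¹ := by
  unfold specPow
  rw [show (-((3 / 2 : ℝ) : ℂ) - 1 / 2) = -((2 : ℕ) : ℂ) by push_cast; ring, Complex.cpow_neg,
    Complex.cpow_natCast]

lemma crossRe_half {aj ak : ℝ} (haj : 0 < aj) (hak : 0 < ak) (u : ℝ) :
    (crossRe (1 / 2) aj (1 / 2) ak u).re =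
      (aj * ak) ^ (1 / 2 : ℝ) / ((aj + ak) / 2) * expKernel 0 aj ak u := by
  refine crossRe_eq_of_gFun (by norm_num) (by norm_num) haj hak (by positivity) (fun x => ?_) u
  have hz : (aj : ℂ) + Complex.I * x ≠ 0 :=
    Complex.slitPlane_ne_zero (add_I_mul_mem_slitPlane haj x)
  have hw : (ak : ℂ) - Complex.I * x ≠ 0 := by
    have := Complex.slitPlane_ne_zero (add_I_mul_mem_slitPlane hak (-x))
    simpa [← sub_eq_add_neg] using this
  rw [gFun_eq, specPow_half, specPow_half, normConst_half, normConst_half, ← Complex.ofReal_mul,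
    ← Real.sqrt_mul (by positivity), div_mul_div_comm, ← sq, Real.sqrt_div (by positivity),
    Real.sqrt_sq Real.pi_pos.le, Real.sqrt_eq_rpow]
  have hs : (aj : ℂ) + ak ≠ 0 := by exact_mod_cast (by positivity : aj + ak ≠ 0)
  have hpi : (Real.pi : ℂ) ≠ 0 := by exact_mod_cast Real.pi_ne_zero
  have hw' : (ak : ℂ) + Complex.I * (-x : ℝ) = ak - Complex.I * x := by push_cast; ring
  rw [hw']
  simp only [Complex.ofReal_zero, zero_div, add_zero]
  push_cast
  field_simp
  ring

lemma crossRe_three_halves {a : ℝ} (ha : 0 < a) (u : ℝ) :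
    (crossRe (3 / 2) a (3 / 2) a u).re = 1 * expKernel a a a u := by
  refine crossRe_eq_of_gFun (by norm_num) (by norm_num) ha ha one_ne_zero (fun x => ?_) u
  have hz : (a : ℂ) + Complex.I * x ≠ 0 :=
    Complex.slitPlane_ne_zero (add_I_mul_mem_slitPlane ha x)
  have hw : (a : ℂ) - Complex.I * x ≠ 0 := by
    have := Complex.slitPlane_ne_zero (add_I_mul_mem_slitPlane ha (-x))
    simpa [← sub_eq_add_neg] using this
  rw [gFun_eq, specPow_three_halves, specPow_three_halves, ← Complex.ofReal_mul, ← sq,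
    normConst_three_halves_sq ha]
  have hpi : (Real.pi : ℂ) ≠ 0 := by exact_mod_cast Real.pi_ne_zero
  have hw' : (a : ℂ) + Complex.I * (-x : ℝ) = a - Complex.I * x := by push_cast; ring
  rw [hw']
  push_cast
  field_simp
  ring

lemma expE1_eq_integral_Ioi {x : ℝ} (hx : 0 < x) :
    expE1 x = ∫ s in Set.Ioi x, Real.exp (-s) / s := by
  have h := integral_comp_mul_left_Ioi (fun s => Real.exp (-s) / s) 1 hx
  rw [mul_one, smul_eq_mul] at h
  rw [← mul_right_inj' (inv_ne_zero hx.ne'), ← h, expE1, ← integral_const_mul]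
  refine setIntegral_congr_fun measurableSet_Ioi fun t ht => ?_
  have ht : (1 : ℝ) < t := ht
  rw [neg_mul, mul_comm t x]
  field_simp

lemma integral_exp_div_add {β h : ℝ} (hβ : 0 < β) (hh : 0 < h) :
    ∫ v in Set.Ioi (0 : ℝ), Real.exp (-(β * v)) / (h + v) = Real.exp (β * h) * expE1 (β * h) := by
  have h1 := integral_comp_add_Ioi (fun w : ℝ => Real.exp (β * h) * β *
    (Real.exp (-(β * w)) / (β * w))) h 0
  have h2 := integral_comp_mul_left_Ioi (fun s => Real.exp (-s) / s) h hβ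
  rw [add_zero, integral_const_mul (μ := volume.restrict (Set.Ioi h)), h2, smul_eq_mul, ← expE1_eq_integral_Ioi (by positivity),
    show Real.exp (β * h) * β * (β⁻¹ * expE1 (β * h)) = Real.exp (β * h) * expE1 (β * h) by
      field_simp] at h1
  rw [← h1]
  refine setIntegral_congr_fun measurableSet_Ioi fun v hv => ?_
  have hv : (0 : ℝ) < v := hv
  rw [show -(β * (h + v)) = -(β * h) + -(β * v) by ring, Real.exp_add, Real.exp_neg (β * h)]
  field_simp

lemma expEi_neg {x : ℝ} (hx : 0 < x) : expEi (-x) = -expE1 x := by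
  rw [expEi, neg_neg, expE1_eq_integral_Ioi hx]
  congr 1
  refine Tendsto.limUnder_eq (tendsto_const_nhds.congr' ?_)
  filter_upwards [Ioo_mem_nhdsGT hx] with ε hε
  congr 2
  ext u
  simp only [Set.mem_Ioi, Set.mem_ofPred_eq, sub_zero]
  refine ⟨fun h => ⟨h, ?_⟩, fun h => h.1⟩
  rw [abs_of_pos (hx.trans h)]
  exact hε.2.trans h

lemma integral_exp_div_sub {α h : ℝ} (hα : 0 < α) (ε : ℝ) :
    ∫ u in {u | u ∈ Set.Ioi (0 : ℝ) ∧ ε < |u - h|}, Real.exp (-(α * u)) / (h - u) =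
      -Real.exp (-(α * h)) *
        ∫ t in {t | t ∈ Set.Ioi (-(α * h)) ∧ α * ε < |t - 0|}, Real.exp (-t) / t := by
  have hm : ∀ c d e : ℝ, MeasurableSet {u : ℝ | u ∈ Set.Ioi c ∧ e < |u - d|} := fun c d e =>
    measurableSet_Ioi.inter (measurableSet_lt measurable_const
      (by fun_prop : Measurable fun u : ℝ => |u - d|))
  rw [← integral_indicator (hm _ _ _), ← integral_indicator (hm _ _ _)]
  set G := Set.indicator {t | t ∈ Set.Ioi (-(α * h)) ∧ α * ε < |t - 0|}
    (fun t : ℝ => Real.exp (-t) / t)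
  have h1 := integral_sub_right_eq_self (μ := volume) (fun u : ℝ => G (α * u)) h
  rw [Measure.integral_comp_mul_left, smul_eq_mul, abs_of_pos (inv_pos.2 hα)] at h1
  have h2 : ∫ t, G t = ∫ u, α * G (α * (u - h)) := by
    rw [integral_const_mul, h1]; field_simp
  rw [h2, ← integral_const_mul]
  congr 1; ext u
  have hmem : α * (u - h) ∈ {t : ℝ | t ∈ Set.Ioi (-(α * h)) ∧ α * ε < |t - 0|} ↔
      u ∈ {u | u ∈ Set.Ioi (0 : ℝ) ∧ ε < |u - h|} := by
    simp only [Set.mem_ofPred_eq, Set.mem_Ioi, sub_zero, abs_mul, abs_of_pos hα,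
      mul_lt_mul_iff_right₀ hα]
    refine and_congr_left fun _ => ?_
    rw [mul_sub, neg_lt_sub_iff_lt_add, lt_add_iff_pos_right, mul_pos_iff_of_pos_left hα]
  by_cases hu : u ∈ {u | u ∈ Set.Ioi (0 : ℝ) ∧ ε < |u - h|}
  · have hG : G (α * (u - h)) = Real.exp (-(α * (u - h))) / (α * (u - h)) :=
      Set.indicator_of_mem (hmem.2 hu) _
    rw [Set.indicator_of_mem hu, hG,
      show -(α * u) = -(α * h) + -(α * (u - h)) by ring, Real.exp_add,
      show h - u = -(u - h) by ring, mul_div_assoc', mul_div_mul_left _ _ hα.ne', div_neg, neg_mul,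
      mul_div_assoc]
  · have hG : G (α * (u - h)) = 0 := Set.indicator_of_notMem (fun h' => hu (hmem.1 h')) _
    rw [Set.indicator_of_notMem hu, hG]; simp

lemma tendsto_integral_exp_excise {α : ℝ} (hα : 0 < α) (h : ℝ) :
    Tendsto (fun ε : ℝ => ∫ u in {u | u ∈ Set.Ioi (0 : ℝ) ∧ ε < |u - h|}, Real.exp (-(α * u)))
      (𝓝[>] 0) (𝓝 (1 / α)) := by
  have hi := integral_exp_neg_mul_Ioi_zero hα
  simp only [mul_comm _ α] at hi
  rw [← hi.2]
  have hms : ∀ ε : ℝ, MeasurableSet {u : ℝ | ε < |u - h|} := fun ε =>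
    measurableSet_lt measurable_const (by fun_prop)
  have he : ∀ ε : ℝ, ∫ u in {u | u ∈ Set.Ioi (0 : ℝ) ∧ ε < |u - h|}, Real.exp (-(α * u)) =
      ∫ u in Set.Ioi (0 : ℝ), Set.indicator {u : ℝ | ε < |u - h|}
        (fun u => Real.exp (-(α * u))) u := fun ε => by
    rw [setIntegral_indicator (hms ε)]; rfl
  simp only [he]
  refine tendsto_integral_filter_of_dominated_convergence (fun u => Real.exp (-(α * u))) ?_ ?_
    hi.1 ?_
  · exact Eventually.of_forall fun ε => AEStronglyMeasurable.indicator
      (Continuous.aestronglyMeasurable (by fun_prop)) (hms ε)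
  · refine Eventually.of_forall fun ε => Eventually.of_forall fun u => ?_
    refine (norm_indicator_le_norm_self _ _).trans (le_of_eq ?_)
    rw [Real.norm_eq_abs, Real.abs_exp]
  · have : ∀ᵐ u : ℝ ∂(volume.restrict (Set.Ioi 0)), u ≠ h :=
      ae_restrict_of_ae (by simp [ae_iff, measure_singleton])
    filter_upwards [this] with u hu
    refine tendsto_const_nhds.congr' ?_
    filter_upwards [Ioo_mem_nhdsGT (abs_pos.2 (sub_ne_zero.2 hu))] with ε hε
    rw [Set.indicator_of_mem]
    exact hε.2

lemma hasPVIntegral_expKernel_eq {α β b h l : ℝ} (hα : 0 < α) (hβ : 0 < β) (hb : 0 ≤ b) (hh : 0 < h)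
    (hl : HasPVIntegral (fun u => expKernel b α β u / (h - u)) Set.univ h l) :
    l = (1 - b * h) * (Real.exp (β * h) * expE1 (β * h)) +
      (1 + b * h) * (Real.exp (-(α * h)) * expEi (α * h)) + (b / β - b / α) := by
  set F : ℝ → ℝ := fun u => expKernel b α β u / (h - u) with hF
  have hA : ∫ u in Set.Iic (0 : ℝ), F u =
      (1 - b * h) * (Real.exp (β * h) * expE1 (β * h)) + b / β := by
    have hi := integral_exp_neg_mul_Ioi_zero hβ
    simp only [mul_comm _ β] at hi
    have hq : IntegrableOn (fun v : ℝ => Real.exp (-(β * v)) / (h + v)) (Set.Ioi 0) := by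
      refine Integrable.mono' (hi.1.const_mul h⁻¹) (Measurable.aestronglyMeasurable (by fun_prop))
        ((ae_restrict_iff' measurableSet_Ioi).2 (Eventually.of_forall fun v hv => ?_))
      have hv : (0 : ℝ) < v := hv
      rw [Real.norm_eq_abs, abs_of_pos (by positivity), div_eq_inv_mul]
      gcongr
      linarith
    rw [← integral_exp_div_add hβ hh, ← mul_one_div b β, ← hi.2, ← integral_const_mul,
      ← integral_const_mul, ← integral_add (hq.const_mul _) (hi.1.const_mul _), ← neg_zero,
      ← integral_comp_neg_Ioi]
    simp only [neg_zero]
    refine setIntegral_congr_fun measurableSet_Ioi fun v hv => ?_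
    have hv : (0 : ℝ) < v := hv
    have hv' : h + v ≠ 0 := by positivity
    simp only [hF, expKernel, if_neg (by linarith : ¬ 0 ≤ -v), mul_neg, sub_neg_eq_add]
    field_simp
    ring
  have hT : ∀ ε ∈ Set.Ioo 0 h, ∫ u in {u | u ∈ Set.univ ∧ ε < |u - h|}, F u =
      (∫ u in Set.Iic (0 : ℝ), F u) + (1 + b * h) *
        (∫ u in {u | u ∈ Set.Ioi (0 : ℝ) ∧ ε < |u - h|}, Real.exp (-(α * u)) / (h - u)) -
        b * ∫ u in {u | u ∈ Set.Ioi (0 : ℝ) ∧ ε < |u - h|}, Real.exp (-(α * u)) := by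
    intro ε hε
    have hFi := hl.1 ε hε.1
    rw [← integral_inter_add_sdiff measurableSet_Iic hFi (t := Set.Iic 0)]
    have hs1 : {u | u ∈ Set.univ ∧ ε < |u - h|} ∩ Set.Iic 0 = Set.Iic 0 := by
      refine Set.inter_eq_right.2 fun u hu => ⟨trivial, ?_⟩
      have hu : u ≤ 0 := hu
      rw [abs_of_neg (by linarith)]
      linarith [hε.2]
    have hs2 : {u | u ∈ Set.univ ∧ ε < |u - h|} \ Set.Iic 0 =
        {u | u ∈ Set.Ioi (0 : ℝ) ∧ ε < |u - h|} := by
      ext u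
      simp only [Set.mem_sdiff, Set.mem_ofPred_eq, Set.mem_univ, true_and, Set.mem_Iic, not_le,
        Set.mem_Ioi]
      exact and_comm
    rw [hs1, hs2]
    set W := {u | u ∈ Set.Ioi (0 : ℝ) ∧ ε < |u - h|} with hW
    have hWm : MeasurableSet W :=
      measurableSet_Ioi.inter (measurableSet_lt measurable_const
        (by fun_prop : Measurable fun u : ℝ => |u - h|))
    have hFW : IntegrableOn F W := by
      rw [← hs2]; exact hFi.mono_set Set.sdiff_subset
    have hEW : IntegrableOn (fun u => Real.exp (-(α * u))) W := by
      have hi := (integral_exp_neg_mul_Ioi_zero hα).1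
      simp only [mul_comm _ α] at hi
      exact hi.mono_set fun u hu => hu.1
    rw [← integral_const_mul, ← integral_const_mul, add_sub_assoc]
    congr 1
    rw [eq_sub_iff_add_eq, ← integral_add hFW (hEW.const_mul b)]
    refine setIntegral_congr_fun hWm fun u hu => ?_
    have hu0 : 0 < u := hu.1
    have hu1 : h - u ≠ 0 := by
      have : 0 < |u - h| := hε.1.trans hu.2
      rw [← neg_sub, neg_ne_zero]
      exact abs_pos.1 this
    simp only [hF, expKernel, if_pos hu0.le]
    field_simp
    ring
  have hbh : 0 < 1 + b * h := by positivity
  set J : ℝ → ℝ := fun δ => ∫ t in {t | t ∈ Set.Ioi (-(α * h)) ∧ δ < |t - 0|}, Real.exp (-t) / t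
    with hJ
  set L : ℝ := -((l - ((1 - b * h) * (Real.exp (β * h) * expE1 (β * h)) + b / β) + b * (1 / α)) /
    ((1 + b * h) * Real.exp (-(α * h)))) with hL
  have hlim : Tendsto (fun ε => J (α * ε)) (𝓝[>] 0) (𝓝 L) := by
    have := ((((hl.2.sub_const ((1 - b * h) * (Real.exp (β * h) * expE1 (β * h)) + b / β)).add
      ((tendsto_integral_exp_excise hα h).const_mul b)).div_const
        ((1 + b * h) * Real.exp (-(α * h)))).neg)
    refine this.congr' ?_
    filter_upwards [Ioo_mem_nhdsGT hh] with ε hε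
    have hJε : ∫ u in {u | u ∈ Set.Ioi (0 : ℝ) ∧ ε < |u - h|}, Real.exp (-(α * u)) / (h - u) =
      -Real.exp (-(α * h)) * J (α * ε) := integral_exp_div_sub hα ε
    rw [hT ε hε, hA, hJε]
    field_simp
    ring
  have hJlim : Tendsto J (𝓝[>] 0) (𝓝 L) := by
    have hdiv : Tendsto (fun δ : ℝ => δ / α) (𝓝[>] 0) (𝓝[>] 0) := by
      refine tendsto_nhdsWithin_iff.2 ⟨?_, ?_⟩
      · have : Tendsto (fun δ : ℝ => δ / α) (𝓝 0) (𝓝 (0 / α)) := tendsto_id.div_const α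
        rw [zero_div] at this
        exact this.mono_left nhdsWithin_le_nhds
      · filter_upwards [self_mem_nhdsWithin] with δ hδ
        exact div_pos hδ hα
    refine (hlim.comp hdiv).congr fun δ => ?_
    rw [Function.comp_apply, mul_div_cancel₀ _ hα.ne']
  have hEi : expEi (α * h) = -L := by
    rw [expEi, pvIntegral, hJlim.limUnder_eq]
  rw [hEi, hL]
  field_simp
  ring

section
variable {νj aj νk ak : ℝ}

lemma crossIm_re_of_expKernel {b K h : ℝ} (hνj : 0 < νj) (hνk : 0 < νk) (haj : 0 < aj) (hak : 0 < ak)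
    (hb : 0 ≤ b) (hK : K ≠ 0) (hC : ∀ u, (crossRe νj aj νk ak u).re = K * expKernel b aj ak u)
    (hh : 0 < h) :
    (crossIm νj aj νk ak h).re = -(K / Real.pi) *
      ((1 - b * h) * (Real.exp (ak * h) * expE1 (ak * h)) +
      (1 + b * h) * (Real.exp (-(aj * h)) * expEi (aj * h)) + (b / ak - b / aj)) := by
  have h1 := hasPVIntegral_crossRe hνj hνk haj hak h
  simp only [hC] at h1
  have h2 : HasPVIntegral (fun u => expKernel b aj ak u / (h - u)) Set.univ h
      (K⁻¹ * (-Real.pi * (crossIm νj aj νk ak h).re)) := by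
    have he : ∀ u, expKernel b aj ak u / (h - u) = K⁻¹ * (K * expKernel b aj ak u / (h - u)) :=
      fun u => by field_simp
    simp only [he]
    refine ⟨fun ε hε => (h1.1 ε hε).const_mul _, ?_⟩
    simp only [integral_const_mul]
    exact h1.2.const_mul _
  rw [← hasPVIntegral_expKernel_eq haj hak hb hh h2]
  field_simp

lemma crossIm_neg (νj aj νk ak h : ℝ) : crossIm νj aj νk ak (-h) = -crossIm νk ak νj aj h := by
  unfold crossIm
  rw [← mul_neg, ← integral_neg, ← integral_neg_eq_self]
  congr 2; ext x
  rw [Real.sign_neg, show gFun νj aj νk ak (-x) = gFun νk ak νj aj x by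
    simp only [gFun_eq, neg_neg]; ring]
  push_cast
  rw [show Complex.I * -(h : ℂ) * -(x : ℂ) = Complex.I * h * x by ring]
  ring

lemma expR_neg (h a b : ℝ) : expR (-h) a b = -expR h a b := by
  unfold expR
  rw [Real.sign_neg, abs_neg]; ring

lemma crossIm_half_of_pos (haj : 0 < aj) (hak : 0 < ak) {h : ℝ} (hh : 0 < h) :
    (crossIm (1 / 2) aj (1 / 2) ak h).re =
      (aj * ak) ^ (1 / 2 : ℝ) / ((aj + ak) / 2) * expR h ak aj := by
  rw [crossIm_re_of_expKernel (by norm_num) (by norm_num) haj hak le_rfl (by positivity)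
    (crossRe_half haj hak) hh, expR, Real.sign_of_pos hh, abs_of_pos hh, neg_mul aj h]
  ring

lemma crossIm_half (haj : 0 < aj) (hak : 0 < ak) {h : ℝ} (hh : h ≠ 0) :
    (crossIm (1 / 2) aj (1 / 2) ak h).re = (aj * ak) ^ (1 / 2 : ℝ) / ((aj + ak) / 2) *
      (if h ≤ 0 then expR h aj ak else expR h ak aj) := by
  rcases lt_or_gt_of_ne hh with h0 | h0
  · have := crossIm_half_of_pos hak haj (neg_pos.2 h0)
    rw [crossIm_neg, expR_neg, Complex.neg_re, mul_neg, neg_inj] at this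
    rw [if_pos h0.le, this, mul_comm ak, add_comm ak]
  · rw [if_neg (not_le.2 h0), crossIm_half_of_pos haj hak h0]

lemma crossIm_three_halves_of_pos {a : ℝ} (ha : 0 < a) {h : ℝ} (hh : 0 < h) :
    (crossIm (3 / 2) a (3 / 2) a h).re = (a * |h| + 1) * expR h a a -
      2 * a * h * Real.exp (a * |h|) / Real.pi * expEi (-a * |h|) := by
  rw [crossIm_re_of_expKernel (by norm_num) (by norm_num) ha ha ha.le one_ne_zero
    (crossRe_three_halves ha) hh, expR, Real.sign_of_pos hh, abs_of_pos hh, neg_mul a h,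
    expEi_neg (by positivity)]
  ring

lemma crossIm_three_halves {a : ℝ} (ha : 0 < a) {h : ℝ} (hh : h ≠ 0) :
    (crossIm (3 / 2) a (3 / 2) a h).re = (a * |h| + 1) * expR h a a -
      2 * a * h * Real.exp (a * |h|) / Real.pi * expEi (-a * |h|) := by
  rcases lt_or_gt_of_ne hh with h0 | h0
  · have := crossIm_three_halves_of_pos ha (neg_pos.2 h0)
    rw [crossIm_neg, expR_neg, Complex.neg_re, abs_neg] at this
    rw [← neg_inj, this]; ring
  · exact crossIm_three_halves_of_pos ha h0

end

section
variable {νj aj νk ak : ℝ}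

lemma crossIm_re_eq_integral_Ioi (haj : 0 < aj) (hak : 0 < ak) (hνj : 0 < νj) (hνk : 0 < νk) (h : ℝ) :
    (crossIm νj aj νk ak h).re =
      -2 * ∫ x in Set.Ioi (0 : ℝ), (Complex.exp (Complex.I * h * x) * gFun νj aj νk ak x).im := by
  set F : ℝ → ℂ := fun x => Complex.exp (Complex.I * h * x) * gFun νj aj νk ak x with hF
  have hodd : ∀ x, (F (-x)).im = -(F x).im := fun x => by
    have := conj_exp_mul (νj := νj) (νk := νk) haj hak h x
    have := congrArg Complex.im this
    rw [Complex.conj_im] at this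
    exact this.symm
  have h1 : ∀ x : ℝ, (F x * (Real.sign x : ℂ)).im = (F |x|).im * Real.sign |x| := by
    intro x
    rw [Complex.im_mul_ofReal]
    rcases abs_cases x with ⟨h, _⟩ | ⟨h, _⟩ <;> rw [h]
    rw [hodd, Real.sign_neg, neg_mul_neg]
  have h2 : (crossIm νj aj νk ak h).re = -∫ x : ℝ, (F x * (Real.sign x : ℂ)).im := by
    have := integral_im (integrable_mul_sign (integrable_exp_mul (integrable_gFun hνj hνk haj hak) h))
    simp only [RCLike.im_to_complex] at this
    rw [hF, this, crossIm, Complex.I_mul_re]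
  rw [h2]
  simp only [h1]
  rw [integral_comp_abs (f := fun x => (F x).im * Real.sign x), ← neg_mul]
  congr 1
  refine setIntegral_congr_fun measurableSet_Ioi fun x hx => ?_
  simp only [hF, Real.sign_of_pos hx, mul_one]

lemma crossIm_half_zero (haj : 0 < aj) (hak : 0 < ak) :
    (crossIm (1 / 2) aj (1 / 2) ak 0).re =
      (aj * ak) ^ (1 / 2 : ℝ) / ((aj + ak) / 2) * (Real.log (ak / aj) / Real.pi) := by
  have hp : ∀ {a : ℝ}, 0 < a → ∀ x : ℝ, 0 < a ^ 2 + x ^ 2 := fun ha x => by positivity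
  have hg : ∀ x : ℝ, (Complex.exp (Complex.I * (0 : ℝ) * x) * gFun (1 / 2) aj (1 / 2) ak x).im =
      (aj * ak) ^ (1 / 2 : ℝ) / Real.pi *
        (x * (aj - ak) / ((aj ^ 2 + x ^ 2) * (ak ^ 2 + x ^ 2))) := by
    intro x
    have hz : (aj : ℂ) + Complex.I * x ≠ 0 :=
      Complex.slitPlane_ne_zero (add_I_mul_mem_slitPlane haj x)
    have hw : (ak : ℂ) + Complex.I * (-x : ℝ) ≠ 0 :=
      Complex.slitPlane_ne_zero (add_I_mul_mem_slitPlane hak (-x))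
    have hj : ((aj : ℂ) ^ 2 + (x : ℂ) ^ 2) ≠ 0 := by exact_mod_cast (hp haj x).ne'
    have hk : ((ak : ℂ) ^ 2 + (x : ℂ) ^ 2) ≠ 0 := by exact_mod_cast (hp hak x).ne'
    have e1 : ((aj : ℂ) + Complex.I * x)⁻¹ = (aj - Complex.I * x) / (aj ^ 2 + x ^ 2) := by
      rw [inv_eq_one_div, div_eq_div_iff hz hj]
      linear_combination ((x : ℂ) ^ 2) * Complex.I_sq
    have e2 : ((ak : ℂ) + Complex.I * (-x : ℝ))⁻¹ = (ak + Complex.I * x) / (ak ^ 2 + x ^ 2) := by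
      rw [inv_eq_one_div, div_eq_div_iff hw hk]
      push_cast
      linear_combination ((x : ℂ) ^ 2) * Complex.I_sq
    rw [gFun_eq, specPow_half, specPow_half, normConst_half, normConst_half, ← Complex.ofReal_mul,
      ← Real.sqrt_mul (by positivity), div_mul_div_comm, ← sq, Real.sqrt_div (by positivity),
      Real.sqrt_sq Real.pi_pos.le, Real.sqrt_eq_rpow, e1, e2]
    have e3 : ((aj : ℂ) - Complex.I * x) / (aj ^ 2 + x ^ 2) * ((ak + Complex.I * x) / (ak ^ 2 + x ^ 2))
        = (((aj * ak + x ^ 2) / ((aj ^ 2 + x ^ 2) * (ak ^ 2 + x ^ 2)) : ℝ) : ℂ) +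
          ((x * (aj - ak) / ((aj ^ 2 + x ^ 2) * (ak ^ 2 + x ^ 2)) : ℝ) : ℂ) * Complex.I := by
      push_cast
      field_simp
      linear_combination (-(x : ℂ) ^ 2) * Complex.I_sq
    rw [e3]
    simp only [Complex.ofReal_zero, mul_zero, zero_mul, Complex.exp_zero, one_mul,
      Complex.im_ofReal_mul, Complex.add_im, Complex.ofReal_im, Complex.I_im, mul_one, zero_add]
  have hint := (integrable_exp_mul (integrable_gFun (νj := 1 / 2) (νk := 1 / 2) (by norm_num)
    (by norm_num) haj hak) 0).im.integrableOn (s := Set.Ioi 0)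
  simp only [RCLike.im_to_complex] at hint
  rw [crossIm_re_eq_integral_Ioi haj hak (by norm_num) (by norm_num)]
  simp only [hg] at hint ⊢
  have hd : ∀ x ∈ Set.Ici (0 : ℝ), HasDerivAt (fun x : ℝ => (aj * ak) ^ (1 / 2 : ℝ) / Real.pi *
      (-(1 / (2 * (aj + ak))) * (Real.log (aj ^ 2 + x ^ 2) - Real.log (ak ^ 2 + x ^ 2))))
      ((aj * ak) ^ (1 / 2 : ℝ) / Real.pi *
        (x * (aj - ak) / ((aj ^ 2 + x ^ 2) * (ak ^ 2 + x ^ 2)))) x := by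
    intro x _
    have hq : ∀ a : ℝ, HasDerivAt (fun x : ℝ => a ^ 2 + x ^ 2) (2 * x) x := fun a => by
      simpa using (hasDerivAt_pow 2 x).const_add (a ^ 2)
    have := ((((hq aj).log (hp haj x).ne').sub ((hq ak).log (hp hak x).ne')).const_mul
      (-(1 / (2 * (aj + ak))))).const_mul ((aj * ak) ^ (1 / 2 : ℝ) / Real.pi)
    refine this.congr_deriv ?_
    have := (hp haj x).ne'
    have := (hp hak x).ne'
    field_simp
    ring
  have hlim : Tendsto (fun x : ℝ => Real.log (aj ^ 2 + x ^ 2) - Real.log (ak ^ 2 + x ^ 2)) atTop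
      (𝓝 0) := by
    have h1 : Tendsto (fun x : ℝ => 1 + (aj ^ 2 - ak ^ 2) / (ak ^ 2 + x ^ 2)) atTop (𝓝 (1 + 0)) :=
      (tendsto_const_nhds.div_atTop
        (tendsto_atTop_add_const_left _ _ (tendsto_pow_atTop two_ne_zero))).const_add 1
    rw [add_zero] at h1
    have h2 := ((Real.continuousAt_log one_ne_zero).tendsto).comp h1
    rw [Real.log_one] at h2
    refine h2.congr fun x => ?_
    rw [Function.comp_apply, ← Real.log_div (hp haj x).ne' (hp hak x).ne']
    congr 1
    have := (hp hak x).ne'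
    field_simp
    ring
  rw [integral_Ioi_of_hasDerivAt_of_tendsto' hd hint
    ((hlim.const_mul (-(1 / (2 * (aj + ak))))).const_mul ((aj * ak) ^ (1 / 2 : ℝ) / Real.pi))]
  rw [Real.log_div hak.ne' haj.ne']
  simp only [ne_eq, OfNat.ofNat_ne_zero, not_false_eq_true, zero_pow, add_zero, Real.log_pow]
  push_cast
  field_simp
  ring

end

/-! ### The series behind the modified Bessel and Struve functions -/

/-- The coefficients `1 / (Γ(m + p) Γ(m + q))`. -/
noncomputable def bsCoeff (p q : ℝ) (m : ℕ) : ℝ := 1 / (Real.Gamma (m + p) * Real.Gamma (m + q))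

/-- The entire function `∑ t^m / (Γ(m + p) Γ(m + q))`. -/
noncomputable def bsSeries (p q t : ℝ) : ℝ := ∑' m : ℕ, bsCoeff p q m * t ^ m

lemma div_Gamma_eq (x : ℝ) : x / Real.Gamma (x + 1) = 1 / Real.Gamma x := by
  by_cases hx : x = 0
  · simp [hx, Real.Gamma_zero]
  · rw [Real.Gamma_add_one hx, div_mul_cancel_left₀ hx, one_div]

lemma bsCoeff_mul_right (p q : ℝ) (m : ℕ) : (m + (q - 1)) * bsCoeff p q m = bsCoeff p (q - 1) m := by
  have := div_Gamma_eq (m + (q - 1))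
  rw [show (m : ℝ) + (q - 1) + 1 = m + q by ring] at this
  unfold bsCoeff
  rw [← one_div_mul_one_div, ← one_div_mul_one_div, ← this]
  ring

lemma bsCoeff_comm (p q : ℝ) (m : ℕ) : bsCoeff p q m = bsCoeff q p m := by
  unfold bsCoeff; rw [mul_comm]

lemma bsCoeff_succ (p q : ℝ) (m : ℕ) : bsCoeff p q (m + 1) = bsCoeff (p + 1) (q + 1) m := by
  unfold bsCoeff
  push_cast
  rw [show (m : ℝ) + 1 + p = m + (p + 1) by ring, show (m : ℝ) + 1 + q = m + (q + 1) by ring]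

lemma summable_bsCoeff (p q t : ℝ) : Summable fun m : ℕ => |bsCoeff p q m| * |t| ^ m := by
  have hratio : ∀ᶠ m : ℕ in atTop, ‖|bsCoeff p q (m + 1)| * |t| ^ (m + 1)‖ ≤
      (1 / 2) * ‖|bsCoeff p q m| * |t| ^ m‖ := by
    obtain ⟨N, hN⟩ := exists_nat_ge (|p| + |q| + 2 * |t| + 1)
    filter_upwards [eventually_ge_atTop N] with m hm
    have hm' : |p| + |q| + 2 * |t| + 1 ≤ (m : ℝ) := hN.trans (by exact_mod_cast hm)
    have hp : 2 * |t| + 1 ≤ m + p := by linarith [neg_abs_le p, abs_nonneg q]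
    have hq : 1 ≤ m + q := by linarith [neg_abs_le q, abs_nonneg p, abs_nonneg t]
    have ht := abs_nonneg t
    have h1 : bsCoeff p q m = (m + p) * (m + q) * bsCoeff p q (m + 1) := by
      unfold bsCoeff
      push_cast
      rw [show (m : ℝ) + 1 + p = m + p + 1 by ring, show (m : ℝ) + 1 + q = m + q + 1 by ring,
        Real.Gamma_add_one (by linarith), Real.Gamma_add_one (by linarith)]
      have := Real.Gamma_pos_of_pos (by linarith : 0 < m + p)
      have := Real.Gamma_pos_of_pos (by linarith : 0 < m + q)
      have : 0 < m + p := by linarith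
      have : 0 < m + q := by linarith
      field_simp
    rw [h1, norm_mul, norm_mul, norm_pow, norm_pow, norm_abs_eq_norm, norm_abs_eq_norm, norm_abs_eq_norm,
      norm_mul, norm_mul, Real.norm_eq_abs, Real.norm_eq_abs, Real.norm_eq_abs,
      Real.norm_eq_abs, abs_of_pos (by linarith : 0 < m + p), abs_of_pos (by linarith : 0 < m + q)]
    have h2 : |t| ≤ 1 / 2 * ((m + p) * (m + q)) := by nlinarith
    calc |bsCoeff p q (m + 1)| * |t| ^ (m + 1) = |t| * (|bsCoeff p q (m + 1)| * |t| ^ m) := by ring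
      _ ≤ 1 / 2 * ((m + p) * (m + q)) * (|bsCoeff p q (m + 1)| * |t| ^ m) :=
        mul_le_mul_of_nonneg_right h2 (by positivity)
      _ = _ := by ring
  exact summable_of_ratio_norm_eventually_le (by norm_num) hratio

lemma summable_bsCoeff_mul_pow (p q t : ℝ) : Summable fun m : ℕ => bsCoeff p q m * t ^ m :=
  Summable.of_norm (by simpa [Real.norm_eq_abs] using summable_bsCoeff p q t)

lemma summable_natCast_mul_bsCoeff_mul_pow (p q t : ℝ) :
    Summable fun m : ℕ => (m : ℝ) * bsCoeff p q m * t ^ m := by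
  have h := (summable_bsCoeff_mul_pow p (q - 1) t).sub
    ((summable_bsCoeff_mul_pow p q t).mul_left (q - 1))
  refine h.congr fun m => ?_
  rw [← bsCoeff_mul_right]; ring

lemma bsSeries_comm (p q t : ℝ) : bsSeries p q t = bsSeries q p t := by
  unfold bsSeries; simp only [bsCoeff_comm p q]

lemma bsSeries_eq_add (p q t : ℝ) :
    bsSeries p q t = 1 / (Real.Gamma p * Real.Gamma q) + t * bsSeries (p + 1) (q + 1) t := by
  unfold bsSeries
  rw [(summable_bsCoeff_mul_pow p q t).tsum_eq_zero_add, ← tsum_mul_left]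
  congr 1
  · simp [bsCoeff]
  · congr 1; ext m; rw [bsCoeff_succ]; ring

/-- The logarithmic derivative `t · d/dt`, applied to `bsSeries p q`. -/
lemma exists_hasDerivAt_bsSeries (p q t : ℝ) :
    ∃ d, HasDerivAt (bsSeries p q) d t ∧ t * d = bsSeries p (q - 1) t - (q - 1) * bsSeries p q t := by
  set R := |t| + 1
  have hu : Summable fun m : ℕ => ‖(m : ℝ) * bsCoeff p q m * R ^ (m - 1)‖ := by
    have h := ((summable_natCast_mul_bsCoeff_mul_pow p q R).norm).mul_left R⁻¹
    refine h.congr fun m => ?_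
    have hR : 0 < R := by positivity
    rcases m with _ | m
    · simp
    · simp only [norm_mul, norm_pow, Real.norm_eq_abs, abs_of_pos hR]
      rw [Nat.add_sub_cancel, pow_succ]
      field_simp
  have hd : HasDerivAt (fun y => ∑' m : ℕ, bsCoeff p q m * y ^ m)
      (∑' m : ℕ, bsCoeff p q m * (m * t ^ (m - 1))) t := by
    refine hasDerivAt_tsum_of_isPreconnected (t := Metric.ball (0 : ℝ) R) hu Metric.isOpen_ball
      (convex_ball _ _).isPreconnected (fun m y _ => (hasDerivAt_pow m y).const_mul _) ?_
      (Metric.mem_ball_self (by positivity)) (summable_bsCoeff_mul_pow p q 0) (by simp [R])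
    intro m y hy
    rw [mem_ball_zero_iff] at hy
    simp only [norm_mul, norm_pow]
    rw [mul_left_comm, ← mul_assoc]
    gcongr
    exact hy.le.trans (le_abs_self _)
  refine ⟨_, hd, ?_⟩
  rw [← tsum_mul_left]
  unfold bsSeries
  rw [← tsum_mul_left, ← (summable_bsCoeff_mul_pow p (q - 1) t).tsum_sub
    ((summable_bsCoeff_mul_pow p q t).mul_left (q - 1))]
  congr 1; ext m
  rw [← bsCoeff_mul_right]
  rcases m with _ | m
  · simp
  · rw [Nat.add_sub_cancel, pow_succ]; ring

lemma continuous_bsSeries (p q : ℝ) : Continuous (bsSeries p q) :=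
  continuous_iff_continuousAt.2 fun t =>
    let ⟨_, hd, _⟩ := exists_hasDerivAt_bsSeries p q t
    hd.continuousAt

/-- `(z/2)^ν I_ν(z)`. -/
noncomputable def besselW (ν z : ℝ) : ℝ := (z / 2) ^ (2 * ν) * bsSeries 1 (ν + 1) ((z / 2) ^ 2)

/-- `(z/2)^ν L_{-ν}(z)`. -/
noncomputable def struveV (ν z : ℝ) : ℝ := z / 2 * bsSeries (3 / 2) (3 / 2 - ν) ((z / 2) ^ 2)

lemma rpow_mul_besselI (ν : ℝ) {z : ℝ} (hz : 0 < z) : (z / 2) ^ ν * besselI ν z = besselW ν z := by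
  unfold besselI besselW bsSeries bsCoeff
  rw [← tsum_mul_left, ← tsum_mul_left]
  congr 1; ext m
  rw [Real.rpow_add (by positivity), two_mul ν, Real.rpow_add (by positivity), ← pow_mul,
    ← Real.rpow_natCast _ (2 * m), add_comm ν (m : ℝ), add_assoc]
  push_cast
  ring

lemma rpow_mul_struveL (ν : ℝ) {z : ℝ} (hz : 0 < z) : (z / 2) ^ ν * struveL (-ν) z = struveV ν z := by
  unfold struveL struveV bsSeries bsCoeff
  rw [← tsum_mul_left, ← tsum_mul_left]
  congr 1; ext m
  have : (z / 2) ^ ν * (z / 2) ^ (2 * (m : ℝ) + -ν + 1) = z / 2 * ((z / 2) ^ 2) ^ m := by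
    rw [← Real.rpow_add (by positivity), ← pow_mul, ← pow_succ',
      ← Real.rpow_natCast _ (2 * m + 1)]
    congr 1; push_cast; ring
  rw [mul_div_assoc', this, show (m : ℝ) + -ν + 3 / 2 = m + (3 / 2 - ν) by ring]
  ring

lemma hasDerivAt_half_sq (z : ℝ) : HasDerivAt (fun z : ℝ => (z / 2) ^ 2) (z / 2) z := by
  have := ((hasDerivAt_id z).div_const 2).pow 2
  refine this.congr_deriv ?_
  simp only [id]
  ring

/-- The derivative of `besselW`, in two forms. -/
lemma hasDerivAt_besselW (ν : ℝ) {z : ℝ} (hz : 0 < z) :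
    HasDerivAt (besselW ν) ((2 * ν * besselW ν z + 2 * besselW (ν + 1) z) / z) z ∧
    2 * ν * besselW ν z + 2 * besselW (ν + 1) z = z * (z / 2 * besselW (ν - 1) z) := by
  obtain ⟨d, hd, htd⟩ := exists_hasDerivAt_bsSeries 1 (ν + 1) ((z / 2) ^ 2)
  obtain ⟨d', hd', htd'⟩ := exists_hasDerivAt_bsSeries (ν + 1) 1 ((z / 2) ^ 2)
  have hdd : d' = d := hd'.unique (by
    rwa [show bsSeries (ν + 1) 1 = bsSeries 1 (ν + 1) from funext fun t => bsSeries_comm _ _ _])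
  rw [hdd, sub_self, zero_mul, sub_zero, bsSeries_eq_add, Real.Gamma_zero, mul_zero, div_zero,
    zero_add, zero_add, bsSeries_comm] at htd'
  rw [add_sub_cancel_right] at htd
  have hz2 : 0 < z / 2 := by positivity
  have hW1 : besselW (ν + 1) z = (z / 2) ^ (2 * ν) * ((z / 2) ^ 2 * d) := by
    unfold besselW
    rw [htd', mul_add, mul_one, Real.rpow_add hz2, show ((2 : ℝ)) = (2 : ℕ) by norm_num,
      Real.rpow_natCast]
    ring
  have hWm : (z / 2) ^ 2 * besselW (ν - 1) z = (z / 2) ^ (2 * ν) * bsSeries 1 ν ((z / 2) ^ 2) := by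
    unfold besselW
    rw [sub_add_cancel, ← mul_assoc]
    congr 1
    rw [← Real.rpow_natCast, ← Real.rpow_add hz2]
    congr 1; push_cast; ring
  constructor
  · have h1 := ((hasDerivAt_id z).div_const 2).rpow_const (p := 2 * ν) (Or.inl hz2.ne')
    have h2 := HasDerivAt.comp z (h₂ := bsSeries 1 (ν + 1)) (h := fun z : ℝ => (z / 2) ^ 2) hd
      (hasDerivAt_half_sq z)
    refine (h1.mul h2).congr_deriv ?_
    rw [hW1, besselW]
    simp only [Function.comp_apply, id]
    rw [Real.rpow_sub hz2, Real.rpow_one]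
    field_simp
  · have : z * (z / 2 * besselW (ν - 1) z) = 2 * ((z / 2) ^ 2 * besselW (ν - 1) z) := by ring
    rw [this, hWm, hW1, htd, besselW]
    ring

/-- The derivative of `struveV`, in two forms. -/
lemma hasDerivAt_struveV (ν : ℝ) {z : ℝ} (hz : 0 < z) :
    HasDerivAt (struveV ν) ((2 * ν * struveV ν z + 2 * struveV (ν + 1) z) / z) z ∧
    2 * ν * struveV ν z + 2 * struveV (ν + 1) z =
      z * (1 / (Real.Gamma (1 / 2) * Real.Gamma (3 / 2 - ν)) + z / 2 * struveV (ν - 1) z) := by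
  obtain ⟨d, hd, htd⟩ := exists_hasDerivAt_bsSeries (3 / 2) (3 / 2 - ν) ((z / 2) ^ 2)
  obtain ⟨d', hd', htd'⟩ := exists_hasDerivAt_bsSeries (3 / 2 - ν) (3 / 2) ((z / 2) ^ 2)
  have hdd : d' = d := hd'.unique (by
    rwa [show bsSeries (3 / 2 - ν) (3 / 2) = bsSeries (3 / 2) (3 / 2 - ν) from
      funext fun t => bsSeries_comm _ _ _])
  rw [hdd, bsSeries_comm _ (3 / 2 - 1), bsSeries_comm _ (3 / 2), bsSeries_eq_add (3 / 2 - 1),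
    show (3 / 2 - 1 + 1 : ℝ) = 3 / 2 by norm_num, show (3 / 2 - 1 : ℝ) = 1 / 2 by norm_num] at htd'
  have hV1 : struveV (ν + 1) z = z / 2 * ((z / 2) ^ 2 * d + (3 / 2 - ν - 1) *
      bsSeries (3 / 2) (3 / 2 - ν) ((z / 2) ^ 2)) := by
    unfold struveV
    rw [htd, show 3 / 2 - (ν + 1) = 3 / 2 - ν - 1 by ring]
    ring
  have hVm : struveV (ν - 1) z = z / 2 * bsSeries (3 / 2) (3 / 2 - ν + 1) ((z / 2) ^ 2) := by
    unfold struveV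
    rw [show 3 / 2 - (ν - 1) = 3 / 2 - ν + 1 by ring]
  constructor
  · have h1 := (hasDerivAt_id z).div_const 2
    have h2 := HasDerivAt.comp z (h₂ := bsSeries (3 / 2) (3 / 2 - ν)) (h := fun z : ℝ => (z / 2) ^ 2)
      hd (hasDerivAt_half_sq z)
    refine (h1.mul h2).congr_deriv ?_
    rw [hV1, struveV]
    simp only [Function.comp_apply, id]
    field_simp
    ring
  · rw [hV1, hVm, struveV]
    linear_combination z * htd'

/-! ### The sine transform of `(1 + x²)^{-r}` -/

/-- `∫_0^∞ sin(zx) (1 + x²)^{-r} dx`. -/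
noncomputable def phiInt (r z : ℝ) : ℝ :=
  ∫ x in Set.Ioi (0 : ℝ), Real.sin (z * x) * (1 + x ^ 2) ^ (-r)

/-- `∫_0^∞ cos(zx) x (1 + x²)^{-r} dx`. -/
noncomputable def psiInt (r z : ℝ) : ℝ :=
  ∫ x in Set.Ioi (0 : ℝ), Real.cos (z * x) * (x * (1 + x ^ 2) ^ (-r))

lemma continuous_one_add_sq_rpow (r : ℝ) : Continuous fun x : ℝ => (1 + x ^ 2) ^ (-r) :=
  Continuous.rpow_const (by fun_prop) fun x => Or.inl (by positivity)

lemma integrable_one_add_sq_rpow {r : ℝ} (hr : 1 / 2 < r) :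
    Integrable fun x : ℝ => (1 + x ^ 2) ^ (-r) := by
  have h := integrable_rpow_neg_one_add_norm_sq (E := ℝ) (μ := volume) (r := 2 * r)
    (by simp; linarith)
  refine h.congr (Eventually.of_forall fun x => ?_)
  simp only [Real.norm_eq_abs, sq_abs]
  congr 1; ring

lemma integrable_sq_mul_one_add_sq_rpow {r : ℝ} (hr : 1 / 2 < r) :
    Integrable fun x : ℝ => x ^ 2 * (1 + x ^ 2) ^ (-(r + 1)) := by
  refine ((integrable_one_add_sq_rpow hr).sub
    (integrable_one_add_sq_rpow (by linarith : 1 / 2 < r + 1))).congr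
    (Eventually.of_forall fun x => ?_)
  have : (1 + x ^ 2) ^ (-r) = (1 + x ^ 2) ^ (-(r + 1)) * (1 + x ^ 2) := by
    rw [← Real.rpow_add_one (by positivity)]; congr 1; ring
  simp only [Pi.sub_apply, this]
  ring

lemma integrable_mul_one_add_sq_rpow {r : ℝ} (hr : 1 / 2 < r) :
    Integrable fun x : ℝ => x * (1 + x ^ 2) ^ (-(r + 1)) := by
  refine ((integrable_one_add_sq_rpow (by linarith : 1 / 2 < r + 1)).add
    (integrable_sq_mul_one_add_sq_rpow hr)).mono'
    ((continuous_id.mul (continuous_one_add_sq_rpow _)).aestronglyMeasurable)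
    (Eventually.of_forall fun x => ?_)
  have h0 : 0 ≤ (1 + x ^ 2) ^ (-(r + 1)) := by positivity
  rw [norm_mul, Real.norm_eq_abs, Real.norm_eq_abs, abs_of_nonneg h0, Pi.add_apply, ← one_add_mul]
  gcongr
  nlinarith [sq_abs x, sq_nonneg (|x| - 1)]

lemma integrable_sin_mul {r : ℝ} (hr : 1 / 2 < r) (z : ℝ) :
    Integrable fun x : ℝ => Real.sin (z * x) * (1 + x ^ 2) ^ (-r) :=
  (integrable_one_add_sq_rpow hr).bdd_mul (c := 1)
    (Continuous.aestronglyMeasurable (by fun_prop))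
    (Eventually.of_forall fun _ => Real.abs_sin_le_one _)

lemma integrable_cos_mul {r : ℝ} (hr : 1 / 2 < r) (z : ℝ) :
    Integrable fun x : ℝ => Real.cos (z * x) * (x * (1 + x ^ 2) ^ (-(r + 1))) :=
  (integrable_mul_one_add_sq_rpow hr).bdd_mul (c := 1)
    (Continuous.aestronglyMeasurable (by fun_prop))
    (Eventually.of_forall fun _ => Real.abs_cos_le_one _)

lemma hasDerivAt_phiInt_aux {r : ℝ} (hr : 1 / 2 < r) (z : ℝ) :
    HasDerivAt (phiInt (r + 1)) (psiInt (r + 1) z) z := by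
  refine (hasDerivAt_integral_of_dominated_loc_of_deriv_le
    (F := fun z x : ℝ => Real.sin (z * x) * (1 + x ^ 2) ^ (-(r + 1)))
    (F' := fun z x : ℝ => Real.cos (z * x) * (x * (1 + x ^ 2) ^ (-(r + 1))))
    (bound := fun x : ℝ => ‖x * (1 + x ^ 2) ^ (-(r + 1))‖)
    (μ := volume.restrict (Set.Ioi 0)) (s := Set.univ) univ_mem ?_ ?_ ?_ ?_ ?_ ?_).2
  · exact Eventually.of_forall fun z =>
      (integrable_sin_mul (by linarith : 1 / 2 < r + 1) z).integrableOn.1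
  · exact (integrable_sin_mul (by linarith : 1 / 2 < r + 1) z).integrableOn
  · exact (integrable_cos_mul hr z).integrableOn.1
  · refine Eventually.of_forall fun x z _ => ?_
    rw [norm_mul]
    exact mul_le_of_le_one_left (norm_nonneg _) (Real.abs_cos_le_one _)
  · exact (integrable_mul_one_add_sq_rpow hr).norm.integrableOn
  · refine Eventually.of_forall fun x z _ => ?_
    have h1 : HasDerivAt (fun z : ℝ => z * x) x z := by
      simpa using (hasDerivAt_id z).mul_const x
    exact (h1.sin.mul_const _).congr_deriv (by ring)

lemma hasDerivAt_psiInt {r : ℝ} (hr : 1 / 2 < r) (z : ℝ) :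
    HasDerivAt (psiInt (r + 1)) (phiInt (r + 1) z - phiInt r z) z := by
  have h := (hasDerivAt_integral_of_dominated_loc_of_deriv_le
    (F := fun z x : ℝ => Real.cos (z * x) * (x * (1 + x ^ 2) ^ (-(r + 1))))
    (F' := fun z x : ℝ => -Real.sin (z * x) * (x ^ 2 * (1 + x ^ 2) ^ (-(r + 1))))
    (bound := fun x : ℝ => ‖x ^ 2 * (1 + x ^ 2) ^ (-(r + 1))‖)
    (μ := volume.restrict (Set.Ioi 0)) (s := Set.univ) (x₀ := z) univ_mem ?_ ?_ ?_ ?_ ?_ ?_).2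
  · refine h.congr_deriv ?_
    unfold phiInt
    rw [← integral_sub (integrable_sin_mul (by linarith : 1 / 2 < r + 1) z).integrableOn
      (integrable_sin_mul hr z).integrableOn]
    congr 1; ext x
    have : (1 + x ^ 2) ^ (-r) = (1 + x ^ 2) ^ (-(r + 1)) * (1 + x ^ 2) := by
      rw [← Real.rpow_add_one (by positivity)]; congr 1; ring
    rw [this]; ring
  · exact Eventually.of_forall fun z => (integrable_cos_mul hr z).integrableOn.1
  · exact (integrable_cos_mul hr z).integrableOn
  · exact Continuous.aestronglyMeasurable
      ((by fun_prop : Continuous fun x : ℝ => -Real.sin (z * x)).mul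
        ((continuous_pow 2).mul (continuous_one_add_sq_rpow _)))
  · refine Eventually.of_forall fun x z _ => ?_
    rw [norm_mul, norm_neg]
    exact mul_le_of_le_one_left (norm_nonneg _) (Real.abs_sin_le_one _)
  · exact (integrable_sq_mul_one_add_sq_rpow hr).norm.integrableOn
  · refine Eventually.of_forall fun x z _ => ?_
    have h1 : HasDerivAt (fun z : ℝ => z * x) x z := by
      simpa using (hasDerivAt_id z).mul_const x
    exact (h1.cos.mul_const _).congr_deriv (by ring)

lemma psiInt_eq {r : ℝ} (hr : 1 / 2 < r) (z : ℝ) :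
    psiInt (r + 1) z = (1 - z * phiInt r z) / (2 * r) := by
  have hr0 : r ≠ 0 := by linarith
  have hd : ∀ x ∈ Set.Ici (0 : ℝ), HasDerivAt
      (fun x : ℝ => Real.cos (z * x) * (-(1 / (2 * r)) * (1 + x ^ 2) ^ (-r)))
      (Real.cos (z * x) * (x * (1 + x ^ 2) ^ (-(r + 1))) +
        z / (2 * r) * (Real.sin (z * x) * (1 + x ^ 2) ^ (-r))) x := by
    intro x _
    have h1 : HasDerivAt (fun x : ℝ => z * x) z x := by
      simpa using (hasDerivAt_id x).const_mul z
    have h2 : HasDerivAt (fun x : ℝ => 1 + x ^ 2) (2 * x) x := by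
      simpa using (hasDerivAt_pow 2 x).const_add 1
    have h3 := (h2.rpow_const (p := -r) (Or.inl (by positivity))).const_mul (-(1 / (2 * r)))
    refine (h1.cos.mul h3).congr_deriv ?_
    rw [show -r - 1 = -(r + 1) by ring]
    field_simp
    ring
  have hi1 := (integrable_cos_mul hr z).integrableOn (s := Set.Ioi 0)
  have hi2 := ((integrable_sin_mul hr z).const_mul (z / (2 * r))).integrableOn (s := Set.Ioi 0)
  have ht : Tendsto (fun x : ℝ => Real.cos (z * x) * (-(1 / (2 * r)) * (1 + x ^ 2) ^ (-r))) atTop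
      (𝓝 0) := by
    have h1 : Tendsto (fun x : ℝ => (1 + x ^ 2) ^ (-r)) atTop (𝓝 0) :=
      (tendsto_rpow_neg_atTop (by linarith)).comp
        (tendsto_atTop_add_const_left _ _ (tendsto_pow_atTop two_ne_zero))
    have h2 := h1.const_mul (-(1 / (2 * r)))
    rw [mul_zero] at h2
    have h3 := h2.norm
    rw [norm_zero] at h3
    refine squeeze_zero_norm (fun x => ?_) h3
    rw [norm_mul]
    exact mul_le_of_le_one_left (norm_nonneg _) (Real.abs_cos_le_one _)
  have h := integral_Ioi_of_hasDerivAt_of_tendsto' hd (hi1.add hi2) ht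
  rw [integral_add hi1 hi2, integral_const_mul] at h
  change psiInt (r + 1) z + z / (2 * r) * phiInt r z = _ at h
  simp only [mul_zero, Real.cos_zero, ne_eq, OfNat.ofNat_ne_zero, not_false_eq_true, zero_pow,
    add_zero, Real.one_rpow] at h
  rw [eq_sub_of_add_eq h]
  field_simp
  ring

lemma hasDerivAt_phiInt_add_one {r : ℝ} (hr : 1 / 2 < r) (z : ℝ) :
    HasDerivAt (phiInt (r + 1)) ((1 - z * phiInt r z) / (2 * r)) z :=
  psiInt_eq hr z ▸ hasDerivAt_phiInt_aux hr z

lemma hasDerivAt_phiInt {r : ℝ} (hr : 1 / 2 < r) {z : ℝ} (hz : 0 < z) :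
    HasDerivAt (phiInt r) (((2 * r - 1) * phiInt r z - 2 * r * phiInt (r + 1) z) / z) z := by
  have hr0 : r ≠ 0 := by linarith
  have h := (((hasDerivAt_psiInt hr z).const_mul (2 * r)).const_sub 1).div (hasDerivAt_id z) hz.ne'
  have he : phiInt r =ᶠ[𝓝 z] fun w => (1 - 2 * r * psiInt (r + 1) w) / id w := by
    filter_upwards [eventually_gt_nhds hz] with w hw
    rw [psiInt_eq hr, id]
    field_simp
    ring
  refine (h.congr_of_eventuallyEq he).congr_deriv ?_
  rw [psiInt_eq hr, id]
  field_simp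
  ring

lemma tendsto_phiInt_zero {r : ℝ} (hr : 1 / 2 < r) : Tendsto (phiInt r) (𝓝[>] 0) (𝓝 0) := by
  have hc : Continuous (phiInt r) := by
    refine continuous_of_dominated (bound := fun x : ℝ => ‖(1 + x ^ 2) ^ (-r)‖)
      (fun z => (integrable_sin_mul hr z).integrableOn.1)
      (fun z => Eventually.of_forall fun x => ?_)
      (integrable_one_add_sq_rpow hr).norm.integrableOn
      (Eventually.of_forall fun x => by fun_prop)
    rw [norm_mul]
    exact mul_le_of_le_one_left (norm_nonneg _) (Real.abs_sin_le_one _)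
  have h := hc.tendsto 0
  rw [show phiInt r 0 = 0 by simp [phiInt]] at h
  exact h.mono_left nhdsWithin_le_nhds

/-! ### A uniqueness theorem at the singular point -/

lemma eq_zero_of_deriv_le_of_tendsto {E E' : ℝ → ℝ} (hE : ∀ z, 0 < z → HasDerivAt E (E' z) z)
    (hle : ∀ z, 0 < z → E' z ≤ 2 * E z) (hnn : ∀ z, 0 < z → 0 ≤ E z)
    (ht : Tendsto E (𝓝[>] 0) (𝓝 0)) {z : ℝ} (hz : 0 < z) : E z = 0 := by
  have hd : ∀ w, 0 < w → HasDerivAt (fun w => E w * Real.exp (-(2 * w)))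
      ((E' w - 2 * E w) * Real.exp (-(2 * w))) w := by
    intro w hw
    have h1 : HasDerivAt (fun w : ℝ => -(2 * w)) (-2) w := by
      simpa using ((hasDerivAt_id w).const_mul 2).fun_neg
    exact ((hE w hw).mul h1.exp).congr_deriv (by ring)
  have hanti : AntitoneOn (fun w => E w * Real.exp (-(2 * w))) (Set.Ioi 0) := by
    refine antitoneOn_of_deriv_nonpos (convex_Ioi 0)
      (fun w hw => (hd w hw).continuousAt.continuousWithinAt) ?_ ?_
    · rw [interior_Ioi]
      exact fun w hw => (hd w hw).differentiableAt.differentiableWithinAt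
    · rw [interior_Ioi]
      intro w hw
      rw [(hd w hw).deriv]
      exact mul_nonpos_of_nonpos_of_nonneg (by linarith [hle w hw]) (Real.exp_pos _).le
  have hlim : Tendsto (fun w => E w * Real.exp (-(2 * w))) (𝓝[>] 0) (𝓝 0) := by
    have h1 : Tendsto (fun w : ℝ => Real.exp (-(2 * w))) (𝓝[>] 0) (𝓝 (Real.exp (-(2 * 0)))) :=
      ((by fun_prop : Continuous fun w : ℝ => Real.exp (-(2 * w))).tendsto 0).mono_left
        nhdsWithin_le_nhds
    simpa using ht.mul h1
  have h0 : E z * Real.exp (-(2 * z)) ≤ 0 := by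
    refine ge_of_tendsto hlim ?_
    filter_upwards [Ioo_mem_nhdsGT hz] with w hw
    exact hanti hw.1 hz hw.2.le
  have := Real.exp_pos (-(2 * z))
  exact le_antisymm (by nlinarith) (hnn z hz)

lemma eq_zero_of_bessel_system {ν : ℝ} (hν : 0 ≤ ν) {δ D : ℝ → ℝ}
    (hδ : ∀ z, 0 < z → HasDerivAt δ ((2 * ν * δ z - (2 * ν + 1) * D z) / z) z)
    (hD : ∀ z, 0 < z → HasDerivAt D (-(z * δ z) / (2 * ν + 1)) z)
    (hδ0 : Tendsto (fun z => z ^ (-(2 * ν)) * δ z) (𝓝[>] 0) (𝓝 0))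
    (hD0 : Tendsto D (𝓝[>] 0) (𝓝 0)) {z : ℝ} (hz : 0 < z) : δ z = 0 := by
  set η : ℝ → ℝ := fun z => z ^ (-(2 * ν)) * δ z with hη
  set ζ : ℝ → ℝ := fun z => -(2 * ν + 1) * (z ^ (-(2 * ν + 1)) * D z) with hζ
  have hpow : ∀ z : ℝ, 0 < z → z ^ (-(2 * ν)) = z ^ (-(2 * ν + 1)) * z := fun z hz => by
    rw [← Real.rpow_add_one hz.ne']; congr 1; ring
  have hηd : ∀ z, 0 < z → HasDerivAt η (ζ z) z := by
    intro z hz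
    have h1 := (hasDerivAt_id z).rpow_const (p := -(2 * ν)) (Or.inl hz.ne')
    refine (h1.mul (hδ z hz)).congr_deriv ?_
    simp only [hζ, id]
    rw [hpow z hz, show -(2 * ν) - 1 = -(2 * ν + 1) by ring]
    field_simp
    ring
  have hζd : ∀ z, 0 < z → HasDerivAt ζ (η z - (2 * ν + 1) * ζ z / z) z := by
    intro z hz
    have h1 := (hasDerivAt_id z).rpow_const (p := -(2 * ν + 1)) (Or.inl hz.ne')
    refine ((h1.mul (hD z hz)).const_mul (-(2 * ν + 1))).congr_deriv ?_
    simp only [hζ, hη, id]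
    rw [hpow z hz, Real.rpow_sub_one hz.ne']
    have : 2 * ν + 1 ≠ 0 := by positivity
    field_simp
    ring
  have hζ0 : Tendsto ζ (𝓝[>] 0) (𝓝 0) := by
    have hb : ∀ᶠ z in 𝓝[>] (0 : ℝ), |η z| ≤ 1 := by
      have := hδ0.eventually (Metric.closedBall_mem_nhds 0 one_pos)
      simpa [Metric.mem_closedBall, Real.dist_eq] using this
    obtain ⟨z₀, hz₀, hb⟩ := (mem_nhdsGT_iff_exists_Ioc_subset).1 hb
    have hz₀ : 0 < z₀ := hz₀
    have hDle : ∀ z ∈ Set.Ioc 0 z₀, |D z| ≤ z ^ (2 * ν + 1) / (2 * ν + 1) * z := by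
      intro z hz
      have hw : ∀ w ∈ Set.Ioc 0 z, |D z - D w| ≤ z ^ (2 * ν + 1) / (2 * ν + 1) * (z - w) := by
        intro w hw
        refine (Convex.norm_image_sub_le_of_norm_hasDerivWithin_le (s := Set.Icc w z) (x := w)
          (f := D) (f' := fun u => -(u * δ u) / (2 * ν + 1)) (C := z ^ (2 * ν + 1) / (2 * ν + 1))
          (fun u hu => (hD u (hw.1.trans_le hu.1)).hasDerivWithinAt) (fun u hu => ?_)
          (convex_Icc w z) (Set.left_mem_Icc.2 hw.2) (Set.right_mem_Icc.2 hw.2)).trans_eq ?_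
        · have hu0 : 0 < u := hw.1.trans_le hu.1
          have hηu : |η u| ≤ 1 := hb ⟨hu0, hu.2.trans hz.2⟩
          have hδu : u * δ u = u ^ (2 * ν + 1) * η u := by
            simp only [hη]
            rw [← mul_assoc, ← Real.rpow_add hu0]
            congr 1
            rw [show 2 * ν + 1 + -(2 * ν) = 1 by ring, Real.rpow_one]
          rw [Real.norm_eq_abs, abs_div, abs_neg, hδu, abs_mul,
            abs_of_pos (by positivity : 0 < 2 * ν + 1), abs_of_pos (by positivity)]
          gcongr
          refine (mul_le_of_le_one_right (by positivity) hηu).trans ?_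
          exact Real.rpow_le_rpow hu0.le hu.2 (by positivity)
        · rw [Real.norm_eq_abs, abs_of_nonneg (by linarith [hw.2])]
      have hl : Tendsto (fun w => |D z - D w|) (𝓝[>] 0) (𝓝 |D z - 0|) :=
        (tendsto_const_nhds.sub hD0).abs
      rw [sub_zero] at hl
      refine le_of_tendsto hl ?_
      filter_upwards [Ioc_mem_nhdsGT hz.1] with w hw'
      refine (hw w hw').trans ?_
      have := hz.1
      gcongr
      linarith [hw'.1]
    have hid : Tendsto (fun z : ℝ => z) (𝓝[>] 0) (𝓝 0) := tendsto_id.mono_left nhdsWithin_le_nhds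
    refine squeeze_zero_norm' ?_ hid
    filter_upwards [Ioc_mem_nhdsGT hz₀] with z hz
    have hz0 := hz.1
    have hp : 0 < z ^ (2 * ν + 1) := by positivity
    simp only [hζ]
    rw [norm_mul, norm_neg, norm_mul, Real.norm_eq_abs, Real.norm_eq_abs, Real.norm_eq_abs,
      abs_of_pos (by positivity : 0 < 2 * ν + 1), Real.rpow_neg hz0.le, abs_of_pos (by positivity)]
    refine (mul_le_mul_of_nonneg_left (mul_le_mul_of_nonneg_left (hDle z hz) (by positivity))
      (by positivity)).trans_eq ?_
    field_simp
  have hE := eq_zero_of_deriv_le_of_tendsto (E := fun z => η z ^ 2 + ζ z ^ 2)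
    (E' := fun z => 2 * η z * ζ z + 2 * ζ z * (η z - (2 * ν + 1) * ζ z / z))
    (fun z hz => (((hηd z hz).pow 2).add ((hζd z hz).pow 2)).congr_deriv (by simp))
    (fun z hz => by
      have h1 : 0 ≤ (2 * ν + 1) * ζ z / z * ζ z := by
        rw [div_mul_eq_mul_div, mul_assoc, ← sq]; positivity
      nlinarith [sq_nonneg (η z - ζ z)])
    (fun z _ => by positivity) (by simpa using (hδ0.pow 2).add (hζ0.pow 2)) hz
  have hη0 : η z = 0 := by
    have h1 := sq_nonneg (η z)
    have h2 := sq_nonneg (ζ z)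
    exact pow_eq_zero_iff two_ne_zero |>.1 (by linarith)
  exact (mul_eq_zero.1 hη0).resolve_left (by positivity)

/-! ### Mellin transforms -/

lemma integral_mul_rpow_neg {φ : ℝ → ℝ} (hφ : Measurable φ) {s : ℝ} (hs : 0 < s)
    (hi : IntegrableOn (fun y => φ y * y ^ (-s)) (Set.Ioi 0)) :
    (∫ y in Set.Ioi (0 : ℝ), φ y * y ^ (-s)) * Real.Gamma s =
      ∫ t in Set.Ioi (0 : ℝ), t ^ (s - 1) * ∫ y in Set.Ioi (0 : ℝ), φ y * Real.exp (-(t * y)) := by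
  have hG : ∀ y : ℝ, 0 < y → ∫ t in Set.Ioi (0 : ℝ), t ^ (s - 1) * Real.exp (-(y * t)) =
      y ^ (-s) * Real.Gamma s := fun y hy => by
    rw [Real.integral_rpow_mul_exp_neg_mul_Ioi hs hy, one_div, Real.inv_rpow hy.le,
      Real.rpow_neg hy.le]
  have hGi : ∀ y : ℝ, 0 < y →
      IntegrableOn (fun t : ℝ => t ^ (s - 1) * Real.exp (-(y * t))) (Set.Ioi 0) := fun y hy => by
    have := integrableOn_rpow_mul_exp_neg_mul_rpow (s := s - 1) (p := 1) (b := y) (by linarith)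
      one_pos hy
    simpa using this
  have hint : Integrable (Function.uncurry fun y t : ℝ =>
      φ y * (t ^ (s - 1) * Real.exp (-(y * t))))
      ((volume.restrict (Set.Ioi 0)).prod (volume.restrict (Set.Ioi 0))) := by
    rw [integrable_prod_iff (Measurable.aestronglyMeasurable (by fun_prop))]
    constructor
    · filter_upwards [ae_restrict_mem measurableSet_Ioi] with y hy
      exact (hGi y hy).const_mul (φ y)
    · have : IntegrableOn (fun y => ‖φ y * y ^ (-s)‖ * Real.Gamma s) (Set.Ioi 0) :=
        hi.norm.mul_const _
      refine this.congr_fun (fun y hy => ?_) measurableSet_Ioi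
      have hy : 0 < y := hy
      have : ∀ t ∈ Set.Ioi (0 : ℝ), ‖φ y * (t ^ (s - 1) * Real.exp (-(y * t)))‖ =
          |φ y| * (t ^ (s - 1) * Real.exp (-(y * t))) := fun t ht => by
        have ht : 0 < t := ht
        rw [norm_mul, Real.norm_eq_abs, Real.norm_eq_abs,
          abs_of_pos (by positivity : 0 < t ^ (s - 1) * Real.exp (-(y * t)))]
      simp only [Function.uncurry]
      rw [setIntegral_congr_fun measurableSet_Ioi this, integral_const_mul, hG y hy, norm_mul,
        Real.norm_eq_abs, Real.norm_eq_abs, abs_of_pos (by positivity : 0 < y ^ (-s))]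
      ring
  have h := integral_integral_swap hint
  rw [← integral_mul_const]
  refine (setIntegral_congr_fun measurableSet_Ioi fun y hy => ?_).trans (h.trans ?_)
  · rw [integral_const_mul, hG y hy]; ring
  · congr 1; ext t
    rw [← integral_const_mul]
    congr 1; ext y
    rw [mul_comm y t]; ring

lemma integral_rpow_div_one_add {s : ℝ} (h0 : 0 < s) (h1 : s < 1) :
    ∫ t in Set.Ioi (0 : ℝ), t ^ (s - 1) * (1 / (1 + t)) = Real.pi / Real.sin (Real.pi * s) := by
  have hi := Real.GammaIntegral_convergent (by linarith : 0 < 1 - s)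
  have hG := Real.Gamma_eq_integral (by linarith : 0 < 1 - s)
  rw [show 1 - s - 1 = -s by ring] at hi hG
  have h := integral_mul_rpow_neg (φ := fun y => Real.exp (-y)) (by fun_prop) h0 hi
  rw [← hG, mul_comm, Real.Gamma_mul_Gamma_one_sub] at h
  rw [h]
  refine setIntegral_congr_fun measurableSet_Ioi fun t ht => ?_
  have ht : 0 < t := ht
  congr 1
  rw [← (integral_exp_neg_mul_Ioi_zero (by linarith : 0 < 1 + t)).2]
  congr 1; ext y
  rw [← Real.exp_add]; congr 1; ring

lemma integral_rpow_div_one_add_sq {q : ℝ} (h0 : 0 < q) (h1 : q < 1) :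
    ∫ t in Set.Ioi (0 : ℝ), t ^ (2 * q - 1) * (1 / (1 + t ^ 2)) =
      Real.pi / (2 * Real.sin (Real.pi * q)) := by
  have h := integral_comp_rpow_Ioi (fun u : ℝ => u ^ (q - 1) * (1 / (1 + u))) (two_ne_zero (α := ℝ))
  rw [integral_rpow_div_one_add h0 h1] at h
  rw [mul_comm (2 : ℝ) (Real.sin _), ← div_div, ← h, ← integral_div]
  refine setIntegral_congr_fun measurableSet_Ioi fun t ht => ?_
  have ht : 0 < t := ht
  simp only [smul_eq_mul]
  rw [← Real.rpow_mul ht.le, Real.rpow_two, abs_of_pos two_pos,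
    show (2 : ℝ) - 1 = 1 by norm_num, Real.rpow_one, show 2 * q - 1 = 2 * (q - 1) + 1 by ring,
    Real.rpow_add_one ht.ne']
  ring

lemma integral_sin_mul_exp_Ioi {t : ℝ} (ht : 0 < t) :
    IntegrableOn (fun y => Real.sin y * Real.exp (-(t * y))) (Set.Ioi 0) ∧
    ∫ y in Set.Ioi (0 : ℝ), Real.sin y * Real.exp (-(t * y)) = 1 / (1 + t ^ 2) := by
  have hE := (integral_exp_neg_mul_Ioi_zero ht).1
  simp only [mul_comm _ t] at hE
  have hi : IntegrableOn (fun y => Real.sin y * Real.exp (-(t * y))) (Set.Ioi 0) :=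
    hE.bdd_mul (c := 1) (Continuous.aestronglyMeasurable (by fun_prop))
      (Eventually.of_forall fun _ => Real.abs_sin_le_one _)
  refine ⟨hi, tendsto_nhds_unique (intervalIntegral_tendsto_integral_Ioi 0 hi tendsto_id) ?_⟩
  simp only [integral_sin_mul_exp, id]
  have h0 : Tendsto (fun R : ℝ => Real.exp (-(t * R)) * (1 + t)) atTop (𝓝 (0 * (1 + t))) :=
    (Real.tendsto_exp_neg_atTop_nhds_zero.comp (tendsto_id.const_mul_atTop ht)).mul_const _
  rw [zero_mul] at h0
  have h1 : Tendsto (fun R : ℝ => Real.exp (-(t * R)) * (Real.cos R + t * Real.sin R)) atTop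
      (𝓝 0) := by
    refine squeeze_zero_norm (fun R => ?_) h0
    rw [norm_mul, Real.norm_eq_abs, Real.norm_eq_abs, Real.abs_exp]
    refine mul_le_mul_of_nonneg_left ((abs_add_le _ _).trans
      (add_le_add (Real.abs_cos_le_one R) ?_)) (Real.exp_pos _).le
    rw [abs_mul, abs_of_pos ht]
    exact mul_le_of_le_one_right ht.le (Real.abs_sin_le_one R)
  simpa only [zero_div, sub_zero] using (h1.div_const (1 + t ^ 2)).const_sub (1 / (1 + t ^ 2))

lemma integral_mul_exp_Ioi {t : ℝ} (ht : 0 < t) :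
    IntegrableOn (fun y => y * Real.exp (-(t * y))) (Set.Ioi 0) ∧
    ∫ y in Set.Ioi (0 : ℝ), y * Real.exp (-(t * y)) = 1 / t ^ 2 := by
  constructor
  · have := integrableOn_rpow_mul_exp_neg_mul_rpow (s := 1) (p := 1) (b := t) (by norm_num)
      one_pos ht
    simpa using this
  · have := Real.integral_rpow_mul_exp_neg_mul_Ioi (a := 2) two_pos ht
    rw [show (2 : ℝ) - 1 = 1 by norm_num, Real.Gamma_two, mul_one, Real.rpow_two, one_div_pow] at this
    simpa using this

lemma integrableOn_mul_rpow_neg {φ : ℝ → ℝ} (hφ : Measurable φ) {s p q K : ℝ} (hp : -1 < p - s)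
    (hq : q - s < -1) (h0 : ∀ y, 0 < y → y ≤ 1 → |φ y| ≤ K * y ^ p)
    (h1 : ∀ y, 1 < y → |φ y| ≤ K * y ^ q) :
    IntegrableOn (fun y => φ y * y ^ (-s)) (Set.Ioi 0) := by
  have hle : ∀ {y e : ℝ}, 0 < y → |φ y| ≤ K * y ^ e → ‖φ y * y ^ (-s)‖ ≤ K * y ^ (e - s) := by
    intro y e hy h
    have hs : 0 ≤ y ^ (-s) := by positivity
    rw [norm_mul, Real.norm_eq_abs, Real.norm_eq_abs, abs_of_nonneg hs, sub_eq_add_neg,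
      Real.rpow_add hy, ← mul_assoc]
    exact mul_le_mul_of_nonneg_right h hs
  have hm : Measurable fun y => φ y * y ^ (-s) := by fun_prop
  rw [← Set.Ioc_union_Ioi_eq_Ioi zero_le_one]
  refine IntegrableOn.union ?_ ?_
  · have h := (intervalIntegral.intervalIntegrable_rpow' (a := 0) (b := 1) hp).1.const_mul K
    refine Integrable.mono' h hm.aestronglyMeasurable
      ((ae_restrict_iff' measurableSet_Ioc).2 (Eventually.of_forall fun y hy => ?_))
    exact hle hy.1 (h0 y hy.1 hy.2)
  · have h := (integrableOn_Ioi_rpow_of_lt hq one_pos).const_mul K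
    refine Integrable.mono' h hm.aestronglyMeasurable
      ((ae_restrict_iff' measurableSet_Ioi).2 (Eventually.of_forall fun y hy => ?_))
    have hy : 1 < y := hy
    exact hle (by linarith) (h1 y hy)

lemma integrableOn_sin_mul_rpow_neg {s : ℝ} (h1 : 1 < s) (h2 : s < 2) :
    IntegrableOn (fun y => Real.sin y * y ^ (-s)) (Set.Ioi 0) := by
  refine integrableOn_mul_rpow_neg (p := 1) (q := 0) (K := 1) (by fun_prop) (by linarith)
    (by linarith) (fun y hy _ => ?_) (fun y hy => ?_)
  · rw [Real.rpow_one, one_mul]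
    have := Real.abs_sin_le_abs (x := y)
    rwa [abs_of_pos hy] at this
  · simpa using Real.abs_sin_le_one y

lemma integrableOn_sin_sub_mul_rpow_neg {s : ℝ} (h2 : 2 < s) (h3 : s < 3) :
    IntegrableOn (fun y => (Real.sin y - y) * y ^ (-s)) (Set.Ioi 0) := by
  refine integrableOn_mul_rpow_neg (p := 3) (q := 1) (K := 2) (by fun_prop) (by linarith)
    (by linarith) (fun y hy _ => ?_) (fun y hy => ?_)
  · have h1 := Real.sin_gt_sub_cube hy
    have h2 := Real.sin_lt hy
    have h3 : (0 : ℝ) < y ^ 3 := by positivity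
    rw [abs_of_neg (by linarith), show (3 : ℝ) = (3 : ℕ) by norm_num, Real.rpow_natCast]
    linarith
  · have := Real.abs_sin_le_one y
    rw [Real.rpow_one]
    refine (abs_sub _ _).trans ?_
    rw [abs_of_pos (by linarith : 0 < y)]
    linarith

lemma integral_sin_mul_rpow_neg {r : ℝ} (h1 : 1 / 2 < r) (h2 : r < 1) :
    ∫ y in Set.Ioi (0 : ℝ), Real.sin y * y ^ (-(2 * r)) =
      Real.pi / (2 * Real.Gamma (2 * r) * Real.sin (Real.pi * r)) := by
  have h := integral_mul_rpow_neg (φ := Real.sin) (by fun_prop) (by linarith : 0 < 2 * r)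
    (integrableOn_sin_mul_rpow_neg (by linarith) (by linarith))
  have h' : ∫ t in Set.Ioi (0 : ℝ), t ^ (2 * r - 1) * ∫ y in Set.Ioi (0 : ℝ),
      Real.sin y * Real.exp (-(t * y)) = Real.pi / (2 * Real.sin (Real.pi * r)) := by
    rw [← integral_rpow_div_one_add_sq (by linarith) h2]
    exact setIntegral_congr_fun measurableSet_Ioi fun t ht => by
      simp only [(integral_sin_mul_exp_Ioi ht).2]
  rw [h'] at h
  rw [eq_div_of_mul_eq (Real.Gamma_pos_of_pos (by linarith)).ne' h, div_div]
  ring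

lemma integral_sin_sub_mul_rpow_neg {r : ℝ} (h1 : 1 < r) (h2 : r < 3 / 2) :
    ∫ y in Set.Ioi (0 : ℝ), (Real.sin y - y) * y ^ (-(2 * r)) =
      Real.pi / (2 * Real.Gamma (2 * r) * Real.sin (Real.pi * r)) := by
  have h := integral_mul_rpow_neg (φ := fun y => Real.sin y - y) (by fun_prop)
    (by linarith : 0 < 2 * r) (integrableOn_sin_sub_mul_rpow_neg (by linarith) (by linarith))
  have h' : ∫ t in Set.Ioi (0 : ℝ), t ^ (2 * r - 1) * ∫ y in Set.Ioi (0 : ℝ),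
      (Real.sin y - y) * Real.exp (-(t * y)) = Real.pi / (2 * Real.sin (Real.pi * r)) := by
    have hsin : Real.pi / (2 * Real.sin (Real.pi * r)) =
        -(Real.pi / (2 * Real.sin (Real.pi * (r - 1)))) := by
      rw [mul_sub, mul_one, Real.sin_sub_pi, mul_neg, div_neg, neg_neg]
    rw [hsin, ← integral_rpow_div_one_add_sq (by linarith) (by linarith), ← integral_neg]
    refine setIntegral_congr_fun measurableSet_Ioi fun t ht => ?_
    have ht : 0 < t := ht
    simp only [sub_mul]
    rw [integral_sub (integral_sin_mul_exp_Ioi ht).1 (integral_mul_exp_Ioi ht).1,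
      (integral_sin_mul_exp_Ioi ht).2, (integral_mul_exp_Ioi ht).2,
      show 2 * r - 1 = 2 * (r - 1) - 1 + (2 : ℕ) by push_cast; ring, Real.rpow_add ht,
      Real.rpow_natCast]
    field_simp
    ring
  rw [h'] at h
  rw [eq_div_of_mul_eq (Real.Gamma_pos_of_pos (by linarith)).ne' h, div_div]
  ring

/-- Scaling limits at the origin of the transforms of `(1 + x²)^{-r}`. -/
lemma tendsto_rpow_mul_integral {φ : ℝ → ℝ} (hφ : Measurable φ) {r : ℝ} (hr : 0 < r)
    (hi : IntegrableOn (fun y => φ y * y ^ (-(2 * r))) (Set.Ioi 0)) :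
    Tendsto (fun z : ℝ => z ^ (-(2 * r - 1)) *
        ∫ x in Set.Ioi (0 : ℝ), φ (z * x) * (1 + x ^ 2) ^ (-r))
      (𝓝[>] 0) (𝓝 (∫ y in Set.Ioi (0 : ℝ), φ y * y ^ (-(2 * r)))) := by
  have hsq : ∀ y : ℝ, 0 < y → y ^ (-(2 * r)) = (y ^ 2) ^ (-r) := fun y hy => by
    rw [← Real.rpow_two, ← Real.rpow_mul hy.le]; congr 1; ring
  have hlim : Tendsto (fun z : ℝ => ∫ y in Set.Ioi (0 : ℝ), φ y * (z ^ 2 + y ^ 2) ^ (-r)) (𝓝[>] 0)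
      (𝓝 (∫ y in Set.Ioi (0 : ℝ), φ y * y ^ (-(2 * r)))) := by
    refine tendsto_integral_filter_of_dominated_convergence (fun y => ‖φ y * y ^ (-(2 * r))‖)
      (Eventually.of_forall fun z => Measurable.aestronglyMeasurable (by fun_prop))
      (Eventually.of_forall fun z => ?_) hi.norm ?_
    · filter_upwards [ae_restrict_mem measurableSet_Ioi] with y hy
      have hy : 0 < y := hy
      rw [norm_mul, norm_mul, hsq y hy]
      refine mul_le_mul_of_nonneg_left ?_ (norm_nonneg _)
      rw [Real.norm_eq_abs, Real.norm_eq_abs, abs_of_pos (by positivity), abs_of_pos (by positivity)]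
      exact Real.rpow_le_rpow_of_nonpos (by positivity) (by nlinarith [sq_nonneg z]) (by linarith)
    · filter_upwards [ae_restrict_mem measurableSet_Ioi] with y hy
      have hy : 0 < y := hy
      rw [hsq y hy]
      refine Tendsto.const_mul _ ?_
      have h1 : ContinuousAt (fun z : ℝ => (z ^ 2 + y ^ 2) ^ (-r)) 0 :=
        ContinuousAt.rpow_const (by fun_prop) (Or.inl (by positivity))
      have h2 := h1.tendsto
      simp only [ne_eq, OfNat.ofNat_ne_zero, not_false_eq_true, zero_pow, zero_add] at h2
      exact h2.mono_left nhdsWithin_le_nhds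
  refine hlim.congr' ?_
  filter_upwards [self_mem_nhdsWithin] with z hz
  have hz : 0 < z := hz
  have h := integral_comp_mul_left_Ioi
    (fun y : ℝ => z ^ (2 * r) * (φ y * (z ^ 2 + y ^ 2) ^ (-r))) 0 hz
  rw [mul_zero, smul_eq_mul, integral_const_mul (μ := volume.restrict (Set.Ioi 0)) (z ^ (2 * r))
    (fun y : ℝ => φ y * (z ^ 2 + y ^ 2) ^ (-r))] at h
  have h' : ∫ x in Set.Ioi (0 : ℝ), φ (z * x) * (1 + x ^ 2) ^ (-r) =
      z⁻¹ * (z ^ (2 * r) * ∫ y in Set.Ioi (0 : ℝ), φ y * (z ^ 2 + y ^ 2) ^ (-r)) := by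
    rw [← h]
    refine setIntegral_congr_fun measurableSet_Ioi fun x hx => ?_
    rw [show z ^ 2 + (z * x) ^ 2 = z ^ 2 * (1 + x ^ 2) by ring,
      Real.mul_rpow (by positivity) (by positivity), ← hsq z hz, mul_left_comm, ← mul_assoc (z ^ _),
      ← Real.rpow_add hz, add_neg_cancel, Real.rpow_zero, one_mul]
  rw [h', ← mul_assoc, ← mul_assoc, neg_sub, sub_eq_add_neg, Real.rpow_add hz, Real.rpow_one,
    Real.rpow_neg hz.le]
  have : z ^ (2 * r) ≠ 0 := by positivity
  field_simp

lemma tendsto_phiInt_of_lt_one {r : ℝ} (h1 : 1 / 2 < r) (h2 : r < 1) :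
    Tendsto (fun z => z ^ (-(2 * r - 1)) * phiInt r z) (𝓝[>] 0)
      (𝓝 (Real.pi / (2 * Real.Gamma (2 * r) * Real.sin (Real.pi * r)))) := by
  rw [← integral_sin_mul_rpow_neg h1 h2]
  exact tendsto_rpow_mul_integral (by fun_prop) (by linarith)
    (integrableOn_sin_mul_rpow_neg (by linarith) (by linarith))

lemma integral_mul_one_add_sq_rpow {r : ℝ} (h1 : 1 < r) :
    IntegrableOn (fun x : ℝ => x * (1 + x ^ 2) ^ (-r)) (Set.Ioi 0) ∧
    ∫ x in Set.Ioi (0 : ℝ), x * (1 + x ^ 2) ^ (-r) = 1 / (2 * (r - 1)) := by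
  have hr : r - 1 ≠ 0 := by linarith
  have hd : ∀ x ∈ Set.Ici (0 : ℝ), HasDerivAt
      (fun x : ℝ => -(1 / (2 * (r - 1))) * (1 + x ^ 2) ^ (-(r - 1)))
      (x * (1 + x ^ 2) ^ (-r)) x := by
    intro x _
    have h2 : HasDerivAt (fun x : ℝ => 1 + x ^ 2) (2 * x) x := by
      simpa using (hasDerivAt_pow 2 x).const_add 1
    refine ((h2.rpow_const (p := -(r - 1)) (Or.inl (by positivity))).const_mul
      (-(1 / (2 * (r - 1))))).congr_deriv ?_
    rw [show -(r - 1) - 1 = -r by ring]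
    field_simp
  have ht : Tendsto (fun x : ℝ => -(1 / (2 * (r - 1))) * (1 + x ^ 2) ^ (-(r - 1))) atTop
      (𝓝 (-(1 / (2 * (r - 1))) * 0)) :=
    ((tendsto_rpow_neg_atTop (by linarith)).comp
      (tendsto_atTop_add_const_left _ _ (tendsto_pow_atTop two_ne_zero))).const_mul _
  have hnn : ∀ x ∈ Set.Ioi (0 : ℝ), 0 ≤ x * (1 + x ^ 2) ^ (-r) := fun x hx => by
    have hx : 0 < x := hx
    positivity
  refine ⟨integrableOn_Ioi_deriv_of_nonneg' hd hnn ht, ?_⟩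
  rw [integral_Ioi_of_hasDerivAt_of_nonneg' hd hnn ht]
  simp

lemma tendsto_phiInt_of_one_lt {r : ℝ} (h1 : 1 < r) (h2 : r < 3 / 2) :
    Tendsto (fun z => z ^ (-(2 * r - 1)) * (phiInt r z - z * (1 / (2 * (r - 1))))) (𝓝[>] 0)
      (𝓝 (Real.pi / (2 * Real.Gamma (2 * r) * Real.sin (Real.pi * r)))) := by
  rw [← integral_sin_sub_mul_rpow_neg h1 h2]
  refine (tendsto_rpow_mul_integral (φ := fun y => Real.sin y - y) (by fun_prop) (by linarith)
    (integrableOn_sin_sub_mul_rpow_neg (by linarith) (by linarith))).congr fun z => ?_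
  obtain ⟨hi, hv⟩ := integral_mul_one_add_sq_rpow h1
  congr 1
  rw [← hv, ← integral_const_mul, phiInt,
    ← integral_sub (integrable_sin_mul (by linarith) z).integrableOn (hi.const_mul z)]
  congr 1; ext x; ring

/-! ### The sine transform in terms of Bessel and Struve functions -/

/-- The constant in front of `(z/2)^ν (I_ν(z) - L_{-ν}(z))`. -/
noncomputable def bsConst (ν : ℝ) : ℝ :=
  Real.Gamma (1 / 2) * Real.pi / (2 * Real.Gamma (ν + 1 / 2) * Real.cos (Real.pi * ν))

/-- The closed form of `phiInt (ν + 1/2)`. -/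
noncomputable def bsForm (ν z : ℝ) : ℝ := bsConst ν * (besselW ν z - struveV ν z)

lemma bsConst_add_one {ν : ℝ} (hν : 0 < ν) : bsConst (ν + 1) = -(bsConst ν / (ν + 1 / 2)) := by
  unfold bsConst
  rw [show ν + 1 + 1 / 2 = ν + 1 / 2 + 1 by ring, Real.Gamma_add_one (by positivity), mul_add,
    mul_one, Real.cos_add_pi, div_div, ← div_neg]
  congr 1; ring

lemma bsConst_div {ν : ℝ} (hν : 0 < ν) (hc : Real.cos (Real.pi * ν) ≠ 0) :
    bsConst ν * (1 / (Real.Gamma (1 / 2) * Real.Gamma (1 / 2 - ν))) = 1 / 2 := by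
  have h := Real.Gamma_mul_Gamma_one_sub (ν + 1 / 2)
  rw [show 1 - (ν + 1 / 2) = 1 / 2 - ν by ring,
    show Real.pi * (ν + 1 / 2) = Real.pi * ν + Real.pi / 2 by ring, Real.sin_add_pi_div_two] at h
  have hG : Real.Gamma (ν + 1 / 2) ≠ 0 := (Real.Gamma_pos_of_pos (by positivity)).ne'
  have hG' : Real.Gamma (1 / 2 - ν) ≠ 0 := by
    intro h0
    rw [h0, mul_zero] at h
    exact (div_ne_zero Real.pi_ne_zero hc) h.symm
  have hG2 : Real.Gamma (1 / 2) ≠ 0 := (Real.Gamma_pos_of_pos (by norm_num)).ne'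
  have h2 : Real.Gamma (ν + 1 / 2) * Real.Gamma (1 / 2 - ν) * Real.cos (Real.pi * ν) = Real.pi := by
    rw [h]; field_simp
  unfold bsConst
  rw [div_mul_div_comm, mul_one, div_eq_div_iff (by positivity) two_ne_zero]
  linear_combination (-2 * Real.Gamma (1 / 2)) * h2

lemma hasDerivAt_bsForm {ν : ℝ} (hν : 0 < ν) {z : ℝ} (hz : 0 < z) :
    HasDerivAt (bsForm ν) ((2 * ν * bsForm ν z - (2 * ν + 1) * bsForm (ν + 1) z) / z) z := by
  refine (((hasDerivAt_besselW ν hz).1.sub (hasDerivAt_struveV ν hz).1).const_mul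
    (bsConst ν)).congr_deriv ?_
  unfold bsForm
  rw [bsConst_add_one hν]
  field_simp
  ring

lemma hasDerivAt_bsForm_add_one {ν : ℝ} (hν : 0 < ν) (hc : Real.cos (Real.pi * ν) ≠ 0) {z : ℝ}
    (hz : 0 < z) :
    HasDerivAt (bsForm (ν + 1)) ((1 - z * bsForm ν z) / (2 * ν + 1)) z := by
  have h1 := hasDerivAt_besselW (ν + 1) hz
  have h2 := hasDerivAt_struveV (ν + 1) hz
  rw [h1.2, mul_div_cancel_left₀ _ hz.ne', add_sub_cancel_right] at h1
  rw [h2.2, mul_div_cancel_left₀ _ hz.ne', add_sub_cancel_right,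
    show 3 / 2 - (ν + 1) = 1 / 2 - ν by ring] at h2
  refine ((h1.1.sub h2.1).const_mul (bsConst (ν + 1))).congr_deriv ?_
  have h := bsConst_div hν hc
  rw [bsConst_add_one hν, bsForm, show 2 * ν + 1 = 2 * (ν + 1 / 2) by ring]
  have h3 : ν + 1 / 2 ≠ 0 := by positivity
  generalize 1 / (Real.Gamma (1 / 2) * Real.Gamma (1 / 2 - ν)) = c at h ⊢
  generalize ν + 1 / 2 = r at h3 ⊢
  field_simp
  linear_combination 2 * h

lemma besselW_eq (ν : ℝ) {z : ℝ} (hz : 0 < z) :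
    besselW ν z = z ^ (2 * ν) * ((2 : ℝ) ^ (-(2 * ν)) * bsSeries 1 (ν + 1) ((z / 2) ^ 2)) := by
  unfold besselW
  rw [Real.div_rpow hz.le two_pos.le, Real.rpow_neg two_pos.le]
  ring

lemma tendsto_bsSeries (p q : ℝ) : Tendsto (fun z : ℝ => bsSeries p q ((z / 2) ^ 2)) (𝓝[>] 0)
    (𝓝 (1 / (Real.Gamma p * Real.Gamma q))) := by
  have h := ((continuous_bsSeries p q).comp
    (by fun_prop : Continuous fun z : ℝ => (z / 2) ^ 2)).tendsto 0
  have h0 := bsSeries_eq_add p q 0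
  rw [zero_mul, add_zero] at h0
  simp only [Function.comp_apply, zero_div, ne_eq, OfNat.ofNat_ne_zero, not_false_eq_true,
    zero_pow, h0] at h
  exact h.mono_left nhdsWithin_le_nhds

lemma tendsto_rpow_nhdsGT_zero {e : ℝ} (he : 0 < e) :
    Tendsto (fun z : ℝ => z ^ e) (𝓝[>] 0) (𝓝 0) := by
  have h := (Real.continuousAt_rpow_const 0 e (Or.inr he.le)).tendsto
  rw [Real.zero_rpow he.ne'] at h
  exact h.mono_left nhdsWithin_le_nhds

lemma tendsto_bsForm_zero {ν : ℝ} (hν : 0 < ν) : Tendsto (bsForm ν) (𝓝[>] 0) (𝓝 0) := by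
  have hW : Tendsto (besselW ν) (𝓝[>] 0) (𝓝 0) := by
    have h := (tendsto_rpow_nhdsGT_zero (by positivity : 0 < 2 * ν)).mul
      ((tendsto_bsSeries 1 (ν + 1)).const_mul ((2 : ℝ) ^ (-(2 * ν))))
    rw [zero_mul] at h
    refine h.congr' ?_
    filter_upwards [self_mem_nhdsWithin] with z hz using (besselW_eq ν hz).symm
  have hz : Tendsto (fun z : ℝ => z / 2) (𝓝[>] 0) (𝓝 0) := by
    have := (by fun_prop : Continuous fun z : ℝ => z / 2).tendsto 0
    rw [zero_div] at this
    exact this.mono_left nhdsWithin_le_nhds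
  have hV : Tendsto (struveV ν) (𝓝[>] 0) (𝓝 0) := by
    have := hz.mul (tendsto_bsSeries (3 / 2) (3 / 2 - ν))
    rwa [zero_mul] at this
  have := (hW.sub hV).const_mul (bsConst ν)
  rwa [sub_zero, mul_zero] at this

lemma bsConst_mul_eq {ν : ℝ} (hν : 0 < ν) :
    bsConst ν * ((2 : ℝ) ^ (-(2 * ν)) * (1 / (Real.Gamma 1 * Real.Gamma (ν + 1)))) =
      Real.pi / (2 * Real.Gamma (2 * (ν + 1 / 2)) * Real.sin (Real.pi * (ν + 1 / 2))) := by
  have h := Real.Gamma_mul_Gamma_add_half (ν + 1 / 2)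
  rw [show ν + 1 / 2 + 1 / 2 = ν + 1 by ring, show 1 - 2 * (ν + 1 / 2) = -(2 * ν) by ring,
    ← Real.Gamma_one_half_eq] at h
  have hs : Real.sin (Real.pi * (ν + 1 / 2)) = Real.cos (Real.pi * ν) := by
    rw [show Real.pi * (ν + 1 / 2) = Real.pi * ν + Real.pi / 2 by ring, Real.sin_add_pi_div_two]
  have hG1 : Real.Gamma (ν + 1 / 2) ≠ 0 := (Real.Gamma_pos_of_pos (by positivity)).ne'
  have hG2 : Real.Gamma (ν + 1) ≠ 0 := (Real.Gamma_pos_of_pos (by positivity)).ne'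
  have hG3 : Real.Gamma (2 * (ν + 1 / 2)) ≠ 0 := (Real.Gamma_pos_of_pos (by positivity)).ne'
  by_cases hc : Real.cos (Real.pi * ν) = 0
  · rw [hs]; simp [bsConst, hc]
  rw [hs, bsConst, Real.Gamma_one, one_mul, mul_one_div, div_mul_div_comm,
    div_eq_div_iff (by positivity) (by positivity)]
  linear_combination (-2 * Real.pi * Real.cos (Real.pi * ν)) * h

lemma tendsto_phiInt_sub_bsForm {ν : ℝ} (h0 : 0 < ν) (h1 : ν < 1) (hh : ν ≠ 1 / 2)
    (hc : Real.cos (Real.pi * ν) ≠ 0) :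
    Tendsto (fun z => z ^ (-(2 * ν)) * (phiInt (ν + 1 / 2) z - bsForm ν z)) (𝓝[>] 0) (𝓝 0) := by
  have hW := ((tendsto_bsSeries 1 (ν + 1)).const_mul ((2 : ℝ) ^ (-(2 * ν)))).const_mul (bsConst ν)
  rw [bsConst_mul_eq h0] at hW
  have hWz : ∀ z : ℝ, 0 < z → z ^ (-(2 * ν)) * besselW ν z =
      (2 : ℝ) ^ (-(2 * ν)) * bsSeries 1 (ν + 1) ((z / 2) ^ 2) := fun z hz => by
    rw [besselW_eq ν hz, ← mul_assoc, ← Real.rpow_add hz, neg_add_cancel, Real.rpow_zero, one_mul]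
  rcases lt_or_gt_of_ne hh with hlt | hgt
  · have hΦ := tendsto_phiInt_of_lt_one (r := ν + 1 / 2) (by linarith) (by linarith)
    have hV := ((tendsto_rpow_nhdsGT_zero (by linarith : 0 < -(2 * ν) + 1)).mul
      (tendsto_bsSeries (3 / 2) (3 / 2 - ν))).const_mul (bsConst ν / 2)
    rw [zero_mul, mul_zero] at hV
    have h := (hΦ.sub hW).add hV
    rw [sub_self, zero_add] at h
    refine h.congr' ?_
    filter_upwards [self_mem_nhdsWithin] with z hz
    rw [← hWz z hz, Real.rpow_add_one (ne_of_gt hz), bsForm, struveV,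
      show -(2 * (ν + 1 / 2) - 1) = -(2 * ν) by ring]
    ring
  · have hΦ := tendsto_phiInt_of_one_lt (r := ν + 1 / 2) (by linarith) (by linarith)
    have hV := ((tendsto_rpow_nhdsGT_zero (by push_cast; linarith : 0 < -(2 * ν) + (3 : ℕ))).mul
      (tendsto_bsSeries (3 / 2 + 1) (3 / 2 - ν + 1))).const_mul (bsConst ν / 8)
    rw [zero_mul, mul_zero] at hV
    have h := (hΦ.sub hW).add hV
    rw [sub_self, zero_add] at h
    refine h.congr' ?_
    filter_upwards [self_mem_nhdsWithin] with z hz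
    have hhalf : (1 / 2 - ν) ≠ 0 := sub_ne_zero.2 (Ne.symm hh)
    have hd := bsConst_div h0 hc
    have hd' : bsConst ν * (1 / (Real.Gamma (3 / 2) * Real.Gamma (3 / 2 - ν))) =
        1 / (1 / 2 - ν) := by
      rw [show (3 / 2 : ℝ) = 1 / 2 + 1 by norm_num, Real.Gamma_add_one (by norm_num),
        show 1 / 2 + 1 - ν = 1 / 2 - ν + 1 by ring, Real.Gamma_add_one hhalf]
      rw [show (1 : ℝ) / (1 / 2 * Real.Gamma (1 / 2) * ((1 / 2 - ν) * Real.Gamma (1 / 2 - ν))) =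
        1 / (Real.Gamma (1 / 2) * Real.Gamma (1 / 2 - ν)) * (2 / (1 / 2 - ν)) by
          rw [div_mul_div_comm, one_mul, div_eq_div_iff_comm]; field_simp, ← mul_assoc, hd]
      field_simp
    have h3 : z * (1 / (2 * (ν + 1 / 2 - 1))) = -(z / 2 * (1 / (1 / 2 - ν))) := by
      rw [show ν + 1 / 2 - 1 = -(1 / 2 - ν) by ring, mul_neg, div_neg, mul_neg,
        ← one_div_mul_one_div]
      ring
    rw [← hWz z hz, Real.rpow_add hz, Real.rpow_natCast, bsForm, struveV, bsSeries_eq_add (3 / 2) _,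
      show -(2 * (ν + 1 / 2) - 1) = -(2 * ν) by ring, h3, ← hd']
    ring

lemma phiInt_eq_bsForm_of_lt_one {ν : ℝ} (h0 : 0 < ν) (h1 : ν < 1) (hh : ν ≠ 1 / 2)
    (hc : Real.cos (Real.pi * ν) ≠ 0) {z : ℝ} (hz : 0 < z) :
    phiInt (ν + 1 / 2) z = bsForm ν z := by
  rw [← sub_eq_zero]
  refine eq_zero_of_bessel_system (δ := fun z => phiInt (ν + 1 / 2) z - bsForm ν z)
    (D := fun z => phiInt (ν + 1 / 2 + 1) z - bsForm (ν + 1) z) h0.le (fun z hz => ?_)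
    (fun z hz => ?_) (tendsto_phiInt_sub_bsForm h0 h1 hh hc) ?_ hz
  · refine ((hasDerivAt_phiInt (by linarith) hz).sub (hasDerivAt_bsForm h0 hz)).congr_deriv ?_
    field_simp
    ring
  · refine ((hasDerivAt_phiInt_add_one (by linarith) z).sub
      (hasDerivAt_bsForm_add_one h0 hc hz)).congr_deriv ?_
    have : 2 * ν + 1 ≠ 0 := by positivity
    rw [show 2 * (ν + 1 / 2) = 2 * ν + 1 by ring]
    field_simp
    ring
  · have := (tendsto_phiInt_zero (by linarith : 1 / 2 < ν + 1 / 2 + 1)).sub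
      (tendsto_bsForm_zero (by linarith : 0 < ν + 1))
    rwa [sub_zero] at this

lemma eq_of_hasDerivAt_of_tendsto_zero {f g f' : ℝ → ℝ} (hf : ∀ z, 0 < z → HasDerivAt f (f' z) z)
    (hg : ∀ z, 0 < z → HasDerivAt g (f' z) z) (hf0 : Tendsto f (𝓝[>] 0) (𝓝 0))
    (hg0 : Tendsto g (𝓝[>] 0) (𝓝 0)) {z : ℝ} (hz : 0 < z) : f z = g z := by
  have hd : ∀ z, 0 < z → HasDerivAt (fun z => f z - g z) 0 z := fun z hz =>
    ((hf z hz).sub (hg z hz)).congr_deriv (sub_self _)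
  have hconst : ∀ w, 0 < w → f w - g w = f z - g z := fun w hw => by
    refine (convex_Ioi (0 : ℝ)).is_const_of_fderivWithin_eq_zero (𝕜 := ℝ)
      (f := fun z => f z - g z)
      (fun u hu => (hd u hu).differentiableAt.differentiableWithinAt) (fun u hu => ?_) hw hz
    rw [fderivWithin_of_isOpen isOpen_Ioi hu, (hd u hu).hasFDerivAt.fderiv]
    ext; simp
  have hlim := hf0.sub hg0
  rw [sub_zero] at hlim
  have h2 : Tendsto (fun w => f w - g w) (𝓝[>] 0) (𝓝 (f z - g z)) := by
    refine tendsto_const_nhds.congr' ?_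
    filter_upwards [self_mem_nhdsWithin] with w hw using (hconst w hw).symm
  exact sub_eq_zero.1 (tendsto_nhds_unique h2 hlim)

lemma cos_pi_mul_ne_zero {ν : ℝ} (h0 : 0 < ν) (hν : ∀ m : ℕ, ν ≠ (m : ℝ) / 2) :
    Real.cos (Real.pi * ν) ≠ 0 := by
  rw [Real.cos_ne_zero_iff]
  intro k hk
  have hν' : ν = (2 * k + 1 : ℤ) / 2 := by
    have : Real.pi * ν = Real.pi * ((2 * k + 1 : ℤ) / 2) := by rw [hk]; push_cast; ring
    exact mul_left_cancel₀ Real.pi_ne_zero this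
  have hk0 : 0 ≤ 2 * k + 1 := by
    by_contra hneg
    have : ((2 * k + 1 : ℤ) : ℝ) < 0 := by exact_mod_cast not_le.1 hneg
    linarith
  obtain ⟨m, hm⟩ := Int.eq_ofNat_of_zero_le hk0
  exact hν m (by rw [hν', hm]; simp)

theorem phiInt_eq_bsForm {ν : ℝ} (h0 : 0 < ν) (hν : ∀ m : ℕ, ν ≠ (m : ℝ) / 2) {z : ℝ}
    (hz : 0 < z) : phiInt (ν + 1 / 2) z = bsForm ν z := by
  obtain ⟨n, hn⟩ := exists_nat_gt ν
  induction n generalizing ν z with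
  | zero => exact absurd h0 (by push_cast at hn; linarith)
  | succ n ih =>
    have hc := cos_pi_mul_ne_zero h0 hν
    have hν1 : ν ≠ 1 := by simpa using hν 2
    rcases lt_or_gt_of_ne hν1 with hlt | hgt
    · exact phiInt_eq_bsForm_of_lt_one h0 hlt (by simpa using hν 1) hc hz
    have hμ0 : 0 < ν - 1 := by linarith
    have hμ : ∀ m : ℕ, ν - 1 ≠ (m : ℝ) / 2 := fun m h => hν (m + 2) (by push_cast; linarith)
    have hcμ := cos_pi_mul_ne_zero hμ0 hμ
    have hih : ∀ w, 0 < w → phiInt (ν - 1 + 1 / 2) w = bsForm (ν - 1) w := fun w hw =>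
      ih hμ0 hμ hw (by push_cast at hn; linarith)
    have hr : 1 / 2 < ν - 1 + 1 / 2 := by linarith
    refine eq_of_hasDerivAt_of_tendsto_zero
      (f' := fun w => (1 - w * bsForm (ν - 1) w) / (2 * (ν - 1) + 1)) (fun w hw => ?_)
      (fun w hw => ?_) (tendsto_phiInt_zero (by linarith)) (tendsto_bsForm_zero h0) hz
    · have h := hasDerivAt_phiInt_add_one hr w
      rw [hih w hw, show ν - 1 + 1 / 2 + 1 = ν + 1 / 2 by ring,
        show 2 * (ν - 1 + 1 / 2) = 2 * (ν - 1) + 1 by ring] at h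
      exact h
    · have h := hasDerivAt_bsForm_add_one hμ0 hcμ hw
      rwa [sub_add_cancel] at h

/-! ### The Bessel–Struve form of the cross-covariance -/

lemma crossIm_re_eq_phiInt {ν a : ℝ} (hν : 0 < ν) (ha : 0 < a) (h : ℝ) :
    (crossIm ν a ν a h).re =
      -2 * (Real.Gamma (ν + 1 / 2) / (Real.Gamma (1 / 2) * Real.Gamma ν)) *
        phiInt (ν + 1 / 2) (a * h) := by
  have hg : ∀ x : ℝ, gFun ν a ν a x =
      ((normConst ν a ^ 2 * (a ^ 2 + x ^ 2) ^ (-(ν + 1 / 2)) : ℝ) : ℂ) := by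
    intro x
    have h1 : specPow ν a x * specPow ν a (-x) = ((‖specPow ν a x‖ ^ 2 : ℝ) : ℂ) := by
      rw [← conj_specPow ha, Complex.mul_conj, Complex.normSq_eq_norm_sq]
    rw [gFun_eq, h1, norm_specPow, ← Real.rpow_natCast _ 2, ← Real.rpow_mul (by positivity)]
    push_cast
    rw [show -(ν + 1 / 2) / 2 * 2 = -(ν + 1 / 2) by ring]
    ring
  have hexp : ∀ x : ℝ, (Complex.exp (Complex.I * h * x)).im = Real.sin (h * x) := fun x => by
    rw [show Complex.I * h * x = ((h * x : ℝ) : ℂ) * Complex.I by push_cast; ring,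
      Complex.exp_ofReal_mul_I_im]
  have hc : normConst ν a ^ 2 =
      a ^ (2 * ν) * (Real.Gamma (ν + 1 / 2) / (Real.Gamma (1 / 2) * Real.Gamma ν)) := by
    have h1 := Real.Gamma_pos_of_pos hν
    have h2 := Real.Gamma_pos_of_pos (by linarith : 0 < ν + 1 / 2)
    rw [normConst, Real.sq_sqrt (by positivity), ← Real.sqrt_eq_rpow, Real.Gamma_one_half_eq,
      mul_div_assoc]
  have hs := integral_comp_mul_left_Ioi
    (fun x : ℝ => Real.sin (h * x) * (a ^ 2 + x ^ 2) ^ (-(ν + 1 / 2))) 0 ha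
  rw [mul_zero, smul_eq_mul] at hs
  have hs' : ∫ x in Set.Ioi (0 : ℝ), Real.sin (h * (a * x)) * (a ^ 2 + (a * x) ^ 2) ^ (-(ν + 1 / 2)) =
      a ^ (-(2 * ν) - 1) * phiInt (ν + 1 / 2) (a * h) := by
    rw [phiInt, ← integral_const_mul]
    congr 1; ext x
    rw [show a ^ 2 + (a * x) ^ 2 = a ^ 2 * (1 + x ^ 2) by ring,
      Real.mul_rpow (by positivity) (by positivity), ← Real.rpow_natCast a 2,
      ← Real.rpow_mul ha.le, show h * (a * x) = a * h * x by ring]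
    push_cast
    rw [show 2 * -(ν + 1 / 2) = -(2 * ν) - 1 by ring]
    ring
  rw [hs'] at hs
  rw [crossIm_re_eq_integral_Ioi ha ha hν hν]
  simp only [hg, Complex.im_mul_ofReal, hexp]
  have hI : ∫ x in Set.Ioi (0 : ℝ), Real.sin (h * x) *
      (normConst ν a ^ 2 * (a ^ 2 + x ^ 2) ^ (-(ν + 1 / 2))) =
      normConst ν a ^ 2 * (a * (a ^ (-(2 * ν) - 1) * phiInt (ν + 1 / 2) (a * h))) := by
    rw [hs, mul_inv_cancel_left₀ ha.ne', ← integral_const_mul]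
    congr 1; ext x; ring
  rw [hI, hc, Real.rpow_sub_one ha.ne', Real.rpow_neg ha.le]
  have : a ^ (2 * ν) ≠ 0 := by positivity
  field_simp

lemma crossIm_re_of_pos {ν a : ℝ} (h0 : 0 < ν) (hν : ∀ m : ℕ, ν ≠ (m : ℝ) / 2) (ha : 0 < a) {h : ℝ}
    (hh : 0 < h) :
    (crossIm ν a ν a h).re = Real.pi / (2 * Real.cos (Real.pi * ν)) *
      ((2 : ℝ) ^ (1 - ν) / Real.Gamma ν) * (a * h) ^ ν *
        (struveL (-ν) (a * h) - besselI ν (a * h)) := by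
  have hz : 0 < a * h := by positivity
  have hG1 : Real.Gamma (ν + 1 / 2) ≠ 0 := (Real.Gamma_pos_of_pos (by positivity)).ne'
  have hG2 : Real.Gamma (1 / 2) ≠ 0 := (Real.Gamma_pos_of_pos (by norm_num)).ne'
  have hG3 : Real.Gamma ν ≠ 0 := (Real.Gamma_pos_of_pos h0).ne'
  have hc := cos_pi_mul_ne_zero h0 hν
  rw [crossIm_re_eq_phiInt h0 ha, phiInt_eq_bsForm h0 hν hz, bsForm, bsConst,
    ← rpow_mul_besselI ν hz, ← rpow_mul_struveL ν hz, Real.div_rpow hz.le two_pos.le,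
    Real.rpow_sub two_pos, Real.rpow_one]
  have : (2 : ℝ) ^ ν ≠ 0 := by positivity
  field_simp
  ring

lemma crossIm_re_eq_struveL_sub_besselI {ν a : ℝ} (h0 : 0 < ν) (hν : ∀ m : ℕ, ν ≠ (m : ℝ) / 2)
    (ha : 0 < a) {h : ℝ} (hh : h ≠ 0) :
    (crossIm ν a ν a h).re = Real.pi * Real.sign h / (2 * Real.cos (Real.pi * ν)) *
      ((2 : ℝ) ^ (1 - ν) / Real.Gamma ν) * (a * |h|) ^ ν *
        (struveL (-ν) (a * |h|) - besselI ν (a * |h|)) := by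
  rcases lt_or_gt_of_ne hh with hneg | hpos
  · have := crossIm_re_of_pos h0 hν ha (neg_pos.2 hneg)
    rw [crossIm_neg, Complex.neg_re] at this
    rw [Real.sign_of_neg hneg, abs_of_neg hneg, ← neg_inj, this]
    ring
  · rw [Real.sign_of_pos hpos, abs_of_pos hpos, mul_one, crossIm_re_of_pos h0 hν ha hpos]

lemma crossCov_eq_ofReal {σ : ℂ} (hσ : σ.re = 0) {νj aj νk ak : ℝ} (hνj : 0 < νj) (hνk : 0 < νk)
    (haj : 0 < aj) (hak : 0 < ak) {h r : ℝ} (hr : (crossIm νj aj νk ak h).re = r) :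
    crossCov σ νj aj νk ak h = ((σ.im * r : ℝ) : ℂ) := by
  have hc : crossIm νj aj νk ak h = (r : ℂ) :=
    Complex.ext (by simpa using hr) (by simpa using crossIm_im haj hak h)
  rw [crossCov_eq σ hνj hνk haj hak, hσ, hc]
  simp

lemma crossCov_zero_of_eq {σ : ℂ} (hσ : σ.re = 0) {ν a : ℝ} (hν : 0 < ν) (ha : 0 < a) :
    crossCov σ ν a ν a 0 = 0 := by
  rw [crossCov_eq_ofReal hσ hν hν ha ha (r := 0) (by simp [crossIm_zero_of_eq])]
  simp

end MultivariateMatern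

theorem theorem3p2 {Ω : Type*} [MeasurableSpace Ω] (P : Measure Ω)
    [IsProbabilityMeasure P] {p : ℕ} (S : Matrix (Fin p) (Fin p) ℂ)
    (hS : S.PosSemidef) (ν a : Fin p → ℝ) (hν : ∀ i, 0 < ν i) (ha : ∀ i, 0 < a i)
    (j k : Fin p) :
    -- the covariances of the process are given by the spectral form
    (∀ Y : ℝ → Fin p → Ω → ℝ, IsMaternProcess S ν a P Y →
      ∀ t h : ℝ, ((covariance (Y (t + h) j) (Y t k) P : ℝ) : ℂ) =
        crossCov (S j k) (ν j) (a j) (ν k) (a k) h) ∧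
    -- decomposition into real functions, and the Hilbert transform relation
    (∀ h : ℝ,
      crossCov (S j k) (ν j) (a j) (ν k) (a k) h =
        (S j k).re * crossRe (ν j) (a j) (ν k) (a k) h +
          (S j k).im * crossIm (ν j) (a j) (ν k) (a k) h ∧
      (crossRe (ν j) (a j) (ν k) (a k) h).im = 0 ∧
      (crossIm (ν j) (a j) (ν k) (a k) h).im = 0 ∧
      HilbertConverges
        (fun u => (crossRe (ν j) (a j) (ν k) (a k) u).re) h ∧
      (crossIm (ν j) (a j) (ν k) (a k) h).re =
        -hilbertTransform
          (fun u => (crossRe (ν j) (a j) (ν k) (a k) u).re) h) ∧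
    -- the closed forms
    ((S j k).re = 0 →
      -- case 1
      (∀ ν₀ a₀ : ℝ, ν j = ν₀ → ν k = ν₀ → (∀ m : ℕ, ν₀ ≠ (m : ℝ) / 2) → a j = a₀ → a k = a₀ →
        (∀ h : ℝ, h ≠ 0 →
          crossCov (S j k) (ν j) (a j) (ν k) (a k) h =
            (((S j k).im * (Real.pi * Real.sign h / (2 * Real.cos (Real.pi * ν₀))) *
              ((2 : ℝ) ^ (1 - ν₀) / Real.Gamma ν₀) * (a₀ * |h|) ^ ν₀ *
              (struveL (-ν₀) (a₀ * |h|) -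
                besselI ν₀ (a₀ * |h|)) : ℝ) : ℂ)) ∧
        crossCov (S j k) (ν j) (a j) (ν k) (a k) 0 = 0) ∧
      -- case 2
      (ν j = 1 / 2 → ν k = 1 / 2 →
        (∀ h : ℝ, h ≠ 0 →
          crossCov (S j k) (ν j) (a j) (ν k) (a k) h =
            (((S j k).im * ((a j * a k) ^ (1 / 2 : ℝ) / ((a j + a k) / 2)) *
              (if h ≤ 0 then expR h (a j) (a k)
                else expR h (a k) (a j)) : ℝ) : ℂ)) ∧
        crossCov (S j k) (ν j) (a j) (ν k) (a k) 0 =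
          (((S j k).im * ((a j * a k) ^ (1 / 2 : ℝ) / ((a j + a k) / 2)) *
            (Real.log (a k / a j) / Real.pi) : ℝ) : ℂ) ∧
        (∀ a₀ : ℝ, a j = a₀ → a k = a₀ →
          ∀ h : ℝ, h ≠ 0 →
            crossCov (S j k) (ν j) (a j) (ν k) (a k) h =
              (((S j k).im * expR h a₀ a₀ : ℝ) : ℂ))) ∧
      -- case 3
      (∀ a₀ : ℝ, ν j = 3 / 2 → ν k = 3 / 2 → a j = a₀ → a k = a₀ →
        (∀ h : ℝ, h ≠ 0 →
          crossCov (S j k) (ν j) (a j) (ν k) (a k) h =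
            (((S j k).im * ((a₀ * |h| + 1) * expR h a₀ a₀ -
              2 * a₀ * h * Real.exp (a₀ * |h|) / Real.pi *
                expEi (-a₀ * |h|)) : ℝ) : ℂ)) ∧
        crossCov (S j k) (ν j) (a j) (ν k) (a k) 0 = 0)) := by
  refine ⟨fun Y hY t h => covariance_eq_crossCov ha hY j k t h, fun h => ⟨?_, ?_, ?_, ?_, ?_⟩,
    fun hre => ⟨?_, ?_, ?_⟩⟩
  · exact crossCov_eq _ (hν j) (hν k) (ha j) (ha k) h
  · exact crossRe_im (ha j) (ha k) h
  · exact crossIm_im (ha j) (ha k) h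
  · exact ⟨_, hasPVIntegral_crossRe (hν j) (hν k) (ha j) (ha k) h⟩
  · exact crossIm_re_eq_neg_hilbertTransform (hν j) (hν k) (ha j) (ha k) h
  · intro ν₀ a₀ hj hk hm haj hak
    have hν₀ : 0 < ν₀ := hj ▸ hν j
    have ha₀ : 0 < a₀ := haj ▸ ha j
    rw [hj, hk, haj, hak]
    refine ⟨fun h hh => ?_, crossCov_zero_of_eq hre hν₀ ha₀⟩
    rw [crossCov_eq_ofReal hre hν₀ hν₀ ha₀ ha₀
      (crossIm_re_eq_struveL_sub_besselI hν₀ hm ha₀ hh)]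
    congr 1; ring
  · intro hj hk
    have hp : (0 : ℝ) < 1 / 2 := by norm_num
    rw [hj, hk]
    refine ⟨fun h hh => ?_, ?_, fun a₀ haj hak h hh => ?_⟩
    · rw [crossCov_eq_ofReal hre hp hp (ha j) (ha k) (crossIm_half (ha j) (ha k) hh), mul_assoc]
    · rw [crossCov_eq_ofReal hre hp hp (ha j) (ha k) (crossIm_half_zero (ha j) (ha k)), mul_assoc]
    · have ha₀ : 0 < a₀ := haj ▸ ha j
      rw [haj, hak]
      refine crossCov_eq_ofReal hre hp hp ha₀ ha₀ ?_
      rw [crossIm_half ha₀ ha₀ hh, ite_self, ← Real.sqrt_eq_rpow, Real.sqrt_mul_self ha₀.le,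
        add_self_div_two, div_self ha₀.ne', one_mul]
  · intro a₀ hj hk haj hak
    have hp : (0 : ℝ) < 3 / 2 := by norm_num
    have ha₀ : 0 < a₀ := haj ▸ ha j
    rw [hj, hk, haj, hak]
    exact ⟨fun h hh => crossCov_eq_ofReal hre hp hp ha₀ ha₀ (crossIm_three_halves ha₀ hh),
      crossCov_zero_of_eq hre hp ha₀⟩
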